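/- **Setting.** Let $f=\frac1N\sum_{i=1}^N f_i$ on $\mathbb R^d$ with $f_i(x)=\mathbb E_{\xi\sim\mathcal D_i}[F_i(x;\xi)]$, where $F_i$ is measurable, differentiable in $x$, and integrable in $\xi$. Assume $f(x_0)-\inf f\le\Delta$, each $f_i$ is differentiable with $L$-Lipschitz gradient, and $\mathbb E_{\xi\sim\mathcal D_i}\|\nabla F_i(x;\xi)-\nabla f_i(x)\|^2\le\sigma^2$ for all $x$ and $i$ ($\Delta,L,\sigma\ge0$). Let $P\ge1$ divide the number of rounds $R$. For $0\le r<R$ the participation weights $q_r^i$ ($i=1,\dots,N$) are random variables with $q_r^i\ge0$, $\sum_i q_r^i=1$ and $\sum_i(q_r^i)^2\le\rho^2$ almost surely. For $r_0\in\{0,P,\dots,R-P\}$ put $\bar q_{r_0}^i=\frac1P\sum_{r=r_0}^{r_0+P-1}q_r^i$, and let $\mathcal Q_{:r_0}$ be the $\sigma$-algebra generated by the weights of the rounds before $r_0$. Participation is *regularized* if $\bar q_{r_0}^i=\frac1N$ almost surely for all such $r_0$ and all $i$. **Algorithm (Amplified SCAFFOLD, step sizes $\eta,\gamma>0$, $I\ge1$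 local steps).** $\bar x_0=x_0$, and $G_0^i$ is the average of $B\ge1$ stochastic gradients of client $i$ at $x_0$. In round $r$ of the window $r_0\le r<r_0+P$: $x_{r,0}^i=\bar x_r$ and, for $0\le k<I$, $x_{r,k+1}^i=x_{r,k}^i-\eta\,(\nabla F_i(x_{r,k}^i;\xi_{r,k}^i)-G_{r_0}^i+G_{r_0})$, with $G_{r_0}=\frac1N\sum_iG_{r_0}^i$. If $r+1<r_0+P$, then $\bar x_{r+1}=\bar x_r+\sum_iq_r^i(x_{r,I}^i-\bar x_r)$. At the end of the window, $\bar x_{r_0+P}=\bar x_{r_0}+\gamma\sum_{r=r_0}^{r_0+P-1}\sum_iq_r^i(x_{r,I}^i-\bar x_r)$, and $G_{r_0+P}^i=\frac1{P\bar q_{r_0}^iI}\sum_{r=r_0}^{r_0+P-1}q_r^i\sum_{k=0}^{I-1}\nabla F_i(x_{r,k}^i;\xi_{r,k}^i)$ if $\bar q_{r_0}^i>0$, and $G_{r_0+P}^i=G_{r_0}^i$ otherwise. The samples of client $i$ (including those that initialize $G_0^i$) have law $\mathcal D_i$; all samples are mutually independent and jointly independent of the weights. The output is $\hat x=\bar x_{mP}$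 with $m$ uniform on $\{0,\dots,R/P-1\}$ and independent of everything else. **Claim 1.** Under regularized participation, for all $r_0\in\{0,P,\dots,R-P\}$ and all $i$: $\mathbb E[\bar q_{r_0}^i\mid\mathcal Q_{:r_0}]=\frac1N$ a.s. and $\mathbb P(\bar q_{r_0}^i>0\mid\mathcal Q_{:r_0})\ge p_{\rm sample}=1$ a.s., and the following two conditions hold: $$\text{(1)}\quad \mathbb E[w_{r_0}^i]\le\frac{P^2}{N}\ \text{ and also }\ \mathbb E[w_{r_0}^i\mid\mathcal Q_{:r_0}]\le\frac{P^2}N\text{ a.s.},\qquad \text{(2)}\quad \mathbb E\Big[\sum_{i=1}^N(v_{r_0}^i)^2\Lambda_{r_0}^i\Big]\le\rho^2 .$$ Here $w_{r_0}^i=\frac1N\sum_{j=1}^N\frac{\mathbf 1\{\bar q_{r_0}^j>0\}}{P\bar q_{r_0}^j}\sum_{s=r_0}^{r_0+P-1}q_s^iq_s^j$, $v_{r_0}^i=\bar q_{r_0}^i-\frac1N$ and $\Lambda_{r_0}^i=\big(\frac1P\sum_{s=r_0-P}^{r_0-1}(z_s^i)^2\big)\big/\big(\frac1P\sum_{s=r_0-P}^{r_0-1}z_s^i\big)^2$,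 where, for $s$ in a window starting at $r_1$, $z_s^i=q_s^i$ if $\bar q_{r_1}^i>0$ and $z_s^i=z_{s-P}^i$ otherwise, with $z_s^i=q_0^i$ for $-P\le s<0$. **Claim 2.** There is a universal constant $C$ such that for all $P\ge1$, $\Delta,L,\sigma,\rho\ge0$ and $\epsilon>0$ there are $\eta,\gamma>0$, $I\ge1$ and a positive multiple $R$ of $P$, depending only on $(P,\Delta,L,\sigma,\rho,\epsilon)$, with $$R\le C\,P\max\Big\{1,\frac{\Delta L}{\epsilon^2}\Big\},\qquad RI\le C\,P\max\Big\{1,\frac{\Delta L}{\epsilon^2}\Big\}\max\Big\{1,\frac{\rho^2\sigma^2}{P\epsilon^2}\Big\},$$ such that, for every problem and every regularized participation process as above, Amplified SCAFFOLD satisfies $\mathbb E[\|\nabla f(\hat x)\|^2]\le C\epsilon^2$. In particular, $$R\le C\,\frac{\Delta LP}{\epsilon^2}\ \text{ if }\epsilon^2\le\Delta L,\qquad RI\le C\,\frac{\Delta L\rho^2\sigma^2}{\epsilon^4}\ \text{ if moreover }P\epsilon^2\le\rho^2\sigma^2 .$$ -/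

import Mathlib

open MeasureTheory ProbabilityTheory Finset

namespace AmpScaffold

noncomputable section

/-- The model space `ℝ^d` with the Euclidean norm. -/
abbrev Vec (d : ℕ) : Type := EuclideanSpace ℝ (Fin d)

/-! ### The optimization problem -/

/-- The local objective `f_i(x) = E_{ξ ∼ D_i} F_i(x; ξ)`. -/
def localObj {N d : ℕ} {Ξ : Type*} [MeasurableSpace Ξ] (F : Fin N → Vec d → Ξ → ℝ)
    (D : Fin N → Measure Ξ) (i : Fin N) (x : Vec d) : ℝ :=
  ∫ ξ, F i x ξ ∂(D i)

/-- The global objective `f = (1/N) ∑_i f_i`. -/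
def globalObj {N d : ℕ} {Ξ : Type*} [MeasurableSpace Ξ] (F : Fin N → Vec d → Ξ → ℝ)
    (D : Fin N → Measure Ξ) (x : Vec d) : ℝ :=
  (1 / (N : ℝ)) * ∑ i, localObj F D i x

/-- The stochastic gradient `∇F_i(x; ξ)` (gradient with respect to `x`). -/
def stochGrad {N d : ℕ} {Ξ : Type*} (F : Fin N → Vec d → Ξ → ℝ) (i : Fin N) (ξ : Ξ)
    (x : Vec d) : Vec d :=
  gradient (fun y => F i y ξ) x

/-- Assumptions on the objectives: the losses are measurable, differentiable in `x` and have
finite expectation; `f x₀ - inf f ≤ Δ`; each `f_i` is `L`-smooth; the stochastic gradients have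
variance at most `σ²`. -/
structure ObjectiveAssumption {N d : ℕ} {Ξ : Type*} [MeasurableSpace Ξ]
    (F : Fin N → Vec d → Ξ → ℝ) (D : Fin N → Measure Ξ) (x₀ : Vec d) (Δ L σ : ℝ) : Prop where
  measurable : ∀ i, Measurable (fun p : Vec d × Ξ => F i p.1 p.2)
  differentiable : ∀ i ξ, Differentiable ℝ (fun x => F i x ξ)
  integrable : ∀ i x, Integrable (F i x) (D i)
  gap : ∀ x, globalObj F D x₀ - globalObj F D x ≤ Δ
  smooth_differentiable : ∀ i, Differentiable ℝ (localObj F D i)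
  smooth : ∀ i x y,
    ‖gradient (localObj F D i) x - gradient (localObj F D i) y‖ ≤ L * ‖x - y‖
  variance : ∀ i x,
    ∫⁻ ξ, ‖stochGrad F i ξ x - gradient (localObj F D i) x‖ₑ ^ 2 ∂(D i) ≤ ENNReal.ofReal (σ ^ 2)

/-! ### Participation -/

/-- The participation of client `i` averaged over the window of `P` rounds that starts at round
`r₀`, for one realization `q` of the weights. -/
def qBar {N : ℕ} (P : ℕ) (q : ℕ → Fin N → ℝ) (r₀ : ℕ) (i : Fin N) : ℝ :=
  (1 / (P : ℝ)) * ∑ j ∈ range P, q (r₀ + j) i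

/-- The weights of rounds `0, …, R - 1` are random variables; in each round they are nonnegative,
sum to one, and their squares sum to at most `ρ²`. -/
structure WeightAssumption {Ω : Type*} [MeasurableSpace Ω] (μ : Measure Ω) {N : ℕ} (R : ℕ)
    (ρ : ℝ) (q : Ω → ℕ → Fin N → ℝ) : Prop where
  measurable : ∀ r < R, ∀ i, Measurable (fun ω => q ω r i)
  nonneg : ∀ r < R, ∀ i, ∀ᵐ ω ∂μ, 0 ≤ q ω r i
  sum_eq_one : ∀ r < R, ∀ᵐ ω ∂μ, ∑ i, q ω r i = 1
  sum_sq_le : ∀ r < R, ∀ᵐ ω ∂μ, ∑ i, (q ω r i) ^ 2 ≤ ρ ^ 2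

/-- Regularized participation: over every window `mP, …, (m+1)P - 1` with `m < R/P`, the averaged
weight of each client is almost surely `1/N`. -/
def IsRegularized {Ω : Type*} [MeasurableSpace Ω] (μ : Measure Ω) {N : ℕ} (P R : ℕ)
    (q : Ω → ℕ → Fin N → ℝ) : Prop :=
  ∀ m < R / P, ∀ i : Fin N, ∀ᵐ ω ∂μ, qBar P (q ω) (m * P) i = 1 / (N : ℝ)

/-- The σ-algebra generated by the weights of the rounds before `r₀`. -/
@[reducible] def pastWeights {Ω : Type*} {N : ℕ} (q : Ω → ℕ → Fin N → ℝ) (r₀ : ℕ) : MeasurableSpace Ω :=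
  MeasurableSpace.comap (fun ω (r : Fin r₀) (i : Fin N) => q ω r i) inferInstance

/-- Every window is unbiased across clients: given the weights before the window, the
expected averaged weight of each client is `1/N`. -/
def UnbiasedParticipation {Ω : Type*} [MeasurableSpace Ω] (μ : Measure Ω) {N : ℕ} (P R : ℕ)
    (q : Ω → ℕ → Fin N → ℝ) : Prop :=
  ∀ m < R / P, ∀ i : Fin N,
    μ[fun ω => qBar P (q ω) (m * P) i | pastWeights q (m * P)] =ᵐ[μ] fun _ => 1 / (N : ℝ)

/-- Given the weights before a window, each client is sampled in that window with
(conditional) probability at least `p`. -/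
def SampledWithProb {Ω : Type*} [MeasurableSpace Ω] (μ : Measure Ω) {N : ℕ} (P R : ℕ)
    (q : Ω → ℕ → Fin N → ℝ) (p : ℝ) : Prop :=
  ∀ m < R / P, ∀ i : Fin N, ∀ᵐ ω ∂μ,
    p ≤ (μ[Set.indicator {ω' | 0 < qBar P (q ω') (m * P) i} (fun _ => (1 : ℝ)) |
      pastWeights q (m * P)]) ω

open Classical in
/-- `w^i_{r₀} = (1/N) ∑_j (1{q̄^j > 0} / (P q̄^j)) ∑_{s = r₀}^{r₀ + P - 1} q_s^i q_s^j`. -/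
def wCoeff {N : ℕ} (P : ℕ) (q : ℕ → Fin N → ℝ) (r₀ : ℕ) (i : Fin N) : ℝ :=
  (1 / (N : ℝ)) * ∑ j : Fin N,
    ((if 0 < qBar P q r₀ j then 1 else 0) / ((P : ℝ) * qBar P q r₀ j)) *
      ∑ s ∈ range P, q (r₀ + s) i * q (r₀ + s) j

/-- `v^i_{r₀} = q̄^i_{r₀} - 1/N`. -/
def vCoeff {N : ℕ} (P : ℕ) (q : ℕ → Fin N → ℝ) (r₀ : ℕ) (i : Fin N) : ℝ :=
  qBar P q r₀ i - 1 / (N : ℝ)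

open Classical in
/-- `zPrev P q i m j` is `z^i_s` for `s = (m - 1) P + j`, `0 ≤ j < P`: the weight of client `i` in
the `j`-th round of the most recent window before round `mP` in which that client was sampled;
`z^i_s = q^i_0` for `-P ≤ s < 0`. -/
def zPrev {N : ℕ} (P : ℕ) (q : ℕ → Fin N → ℝ) (i : Fin N) : ℕ → ℕ → ℝ
  | 0, _ => q 0 i
  | m + 1, j => if 0 < qBar P q (m * P) i then q (m * P + j) i else zPrev P q i m j

/-- `Λ^i_{r₀}` at `r₀ = mP`: the mean over `s = r₀ - P, …, r₀ - 1` of `(z^i_s)²`, divided by the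
square of the mean of `z^i_s`. -/
def lambdaCoeff {N : ℕ} (P : ℕ) (q : ℕ → Fin N → ℝ) (m : ℕ) (i : Fin N) : ℝ :=
  ((1 / (P : ℝ)) * ∑ j ∈ range P, (zPrev P q i m j) ^ 2) /
    ((1 / (P : ℝ)) * ∑ j ∈ range P, zPrev P q i m j) ^ 2

/-- The first regularity condition, `E[w^i_{r₀}] ≤ P²/N`, both in this form and conditionally on
the weights before the window. -/
def WCondition {Ω : Type*} [MeasurableSpace Ω] (μ : Measure Ω) {N : ℕ} (P R : ℕ)
    (q : Ω → ℕ → Fin N → ℝ) : Prop :=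
  ∀ m < R / P, ∀ i : Fin N,
    Integrable (fun ω => wCoeff P (q ω) (m * P) i) μ ∧
    ∫ ω, wCoeff P (q ω) (m * P) i ∂μ ≤ (P : ℝ) ^ 2 / N ∧
    ∀ᵐ ω ∂μ, (μ[fun ω' => wCoeff P (q ω') (m * P) i | pastWeights q (m * P)]) ω ≤ (P : ℝ) ^ 2 / N

/-- The second regularity condition, `E[∑_i (v^i_{r₀})² Λ^i_{r₀}] ≤ ρ²`. -/
def VCondition {Ω : Type*} [MeasurableSpace Ω] (μ : Measure Ω) {N : ℕ} (P R : ℕ) (ρ : ℝ)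
    (q : Ω → ℕ → Fin N → ℝ) : Prop :=
  ∀ m < R / P,
    Integrable (fun ω => ∑ i, (vCoeff P (q ω) (m * P) i) ^ 2 * lambdaCoeff P (q ω) m i) μ ∧
    ∫ ω, ∑ i, (vCoeff P (q ω) (m * P) i) ^ 2 * lambdaCoeff P (q ω) m i ∂μ ≤ ρ ^ 2

/-! ### Data samples -/

/-- All data samples used by the algorithm: `ξ₀ ω b i` (`b < B`) are those that initialize the
control variate of client `i`, and `ξ ω r k i` is the one of round `r`, local step `k`. -/
def sample {Ω Ξ : Type*} {N : ℕ} (B R I : ℕ) (ξ₀ : Ω → ℕ → Fin N → Ξ)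
    (ξ : Ω → ℕ → ℕ → Fin N → Ξ) :
    (Fin B × Fin N) ⊕ (Fin R × Fin I × Fin N) → Ω → Ξ
  | Sum.inl s, ω => ξ₀ ω s.1 s.2
  | Sum.inr s, ω => ξ ω s.1 s.2.1 s.2.2

/-- The samples of client `i` have law `D_i`, all samples are mutually independent, and they are
independent of the participation weights. -/
structure SampleAssumption {Ω Ξ : Type*} [MeasurableSpace Ω] [MeasurableSpace Ξ] (μ : Measure Ω)
    {N : ℕ} (B R I : ℕ) (D : Fin N → Measure Ξ) (q : Ω → ℕ → Fin N → ℝ)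
    (ξ₀ : Ω → ℕ → Fin N → Ξ) (ξ : Ω → ℕ → ℕ → Fin N → Ξ) : Prop where
  law_init : ∀ b < B, ∀ i, MeasurePreserving (fun ω => ξ₀ ω b i) μ (D i)
  law : ∀ r < R, ∀ k < I, ∀ i, MeasurePreserving (fun ω => ξ ω r k i) μ (D i)
  indep : iIndepFun (sample B R I ξ₀ ξ) μ
  indep_weights : IndepFun (fun ω (r : Fin R) (i : Fin N) => q ω r i)
    (fun ω s => sample B R I ξ₀ ξ s ω) μ

/-! ### Amplified SCAFFOLD

One realization of the algorithm. The argument `g i r k x` is the stochastic gradient that client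
`i` computes at the point `x` in local step `k` of round `r`. -/

/-- The local iterates `x^i_{r,0} = x`, `x^i_{r,k+1} = x^i_{r,k} - η (∇F_i(x^i_{r,k}; ξ^i_{r,k}) -
G^i + G)` of one client in one round, where `h k` is its stochastic gradient in step `k`. -/
def localIter {d : ℕ} (η : ℝ) (h : ℕ → Vec d → Vec d) (Gi G x : Vec d) : ℕ → Vec d
  | 0 => x
  | k + 1 => localIter η h Gi G x k - η • (h k (localIter η h Gi G x k) - Gi + G)

/-- The server's variables at the start of a window: the global model and the clients' control
variates. -/
structure ServerState (N d : ℕ) where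
  model : Vec d
  control : Fin N → Vec d

/-- The averaged control variate `G = (1/N) ∑_i G^i`. -/
def ServerState.avgControl {N d : ℕ} (S : ServerState N d) : Vec d :=
  (1 / (N : ℝ)) • ∑ i, S.control i

/-- The local iterates of client `i` in round `r`, starting from the model `x`, in a window which
started in state `S`. -/
def clientIter {N d : ℕ} (η : ℝ) (g : Fin N → ℕ → ℕ → Vec d → Vec d) (S : ServerState N d)
    (r : ℕ) (i : Fin N) (x : Vec d) (k : ℕ) : Vec d :=
  localIter η (g i r) (S.control i) S.avgControl x k

/-- The weighted average of the local updates in round `r`, when the round starts at `x`. -/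
def roundUpdate {N d : ℕ} (η : ℝ) (I : ℕ) (g : Fin N → ℕ → ℕ → Vec d → Vec d)
    (q : ℕ → Fin N → ℝ) (S : ServerState N d) (r : ℕ) (x : Vec d) : Vec d :=
  ∑ i, q r i • (clientIter η g S r i x I - x)

/-- The global model at the start of the `j`-th round (`0 ≤ j < P`) of the window that starts at
round `r₀` in state `S`. -/
def windowModel {N d : ℕ} (η : ℝ) (I : ℕ) (g : Fin N → ℕ → ℕ → Vec d → Vec d)
    (q : ℕ → Fin N → ℝ) (S : ServerState N d) (r₀ : ℕ) : ℕ → Vec d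
  | 0 => S.model
  | j + 1 => windowModel η I g q S r₀ j +
      roundUpdate η I g q S (r₀ + j) (windowModel η I g q S r₀ j)

open Classical in
/-- One window of `P` rounds. The updates of its rounds are accumulated and applied, amplified by
`γ`, to the model at the start of the window. The control variate of a client that was sampled in
the window becomes the weighted average of its stochastic gradients in the window; otherwise
it is kept. -/
def windowStep {N d : ℕ} (η γ : ℝ) (P I : ℕ) (g : Fin N → ℕ → ℕ → Vec d → Vec d)
    (q : ℕ → Fin N → ℝ) (r₀ : ℕ) (S : ServerState N d) : ServerState N d where
  model := S.model + γ • ∑ j ∈ range P,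
    roundUpdate η I g q S (r₀ + j) (windowModel η I g q S r₀ j)
  control i :=
    if 0 < qBar P q r₀ i then
      (1 / ((P : ℝ) * qBar P q r₀ i * (I : ℝ))) • ∑ j ∈ range P, q (r₀ + j) i •
        ∑ k ∈ range I, g i (r₀ + j) k
          (clientIter η g S (r₀ + j) i (windowModel η I g q S r₀ j) k)
    else S.control i

/-- The server's variables at round `mP`. -/
def serverState {N d : ℕ} (η γ : ℝ) (P I : ℕ) (g : Fin N → ℕ → ℕ → Vec d → Vec d)
    (q : ℕ → Fin N → ℝ) (S₀ : ServerState N d) : ℕ → ServerState N d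
  | 0 => S₀
  | m + 1 => windowStep η γ P I g q (m * P) (serverState η γ P I g q S₀ m)

/-- Initially the model is `x₀` and `G^i_0` is the average of `B` stochastic gradients of client `i`
at `x₀`. -/
def initState {N d : ℕ} {Ξ : Type*} (F : Fin N → Vec d → Ξ → ℝ) (x₀ : Vec d) (B : ℕ)
    (ξ₀ : ℕ → Fin N → Ξ) : ServerState N d where
  model := x₀
  control i := (1 / (B : ℝ)) • ∑ b ∈ range B, stochGrad F i (ξ₀ b i) x₀

/-- The random iterate `x̄_{mP}` of Amplified SCAFFOLD. -/
def ampScaffold {Ω Ξ : Type*} {N d : ℕ} (F : Fin N → Vec d → Ξ → ℝ) (x₀ : Vec d)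
    (η γ : ℝ) (P I B : ℕ) (q : Ω → ℕ → Fin N → ℝ) (ξ₀ : Ω → ℕ → Fin N → Ξ)
    (ξ : Ω → ℕ → ℕ → Fin N → Ξ) (m : ℕ) (ω : Ω) : Vec d :=
  (serverState η γ P I (fun i r k => stochGrad F i (ξ ω r k i)) (q ω)
    (initState F x₀ B (ξ₀ ω)) m).model

/-- `E ‖∇f(x̂)‖² ≤ b`, where `x̂ = x̄_{mP}` and `m` is uniform on `{0, …, R/P - 1}` and independent
of everything else. -/
def OutputBound {Ω Ξ : Type*} [MeasurableSpace Ω] [MeasurableSpace Ξ] (μ : Measure Ω) {N d : ℕ}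
    (F : Fin N → Vec d → Ξ → ℝ) (D : Fin N → Measure Ξ) (x₀ : Vec d)
    (η γ : ℝ) (P R I B : ℕ) (q : Ω → ℕ → Fin N → ℝ) (ξ₀ : Ω → ℕ → Fin N → Ξ)
    (ξ : Ω → ℕ → ℕ → Fin N → Ξ) (b : ℝ) : Prop :=
  Integrable (fun p : Ω × ℕ =>
      ‖gradient (globalObj F D) (ampScaffold F x₀ η γ P I B q ξ₀ ξ p.2 p.1)‖ ^ 2)
    (μ.prod (uniformOn (Set.Iio (R / P)))) ∧
  ∫ p : Ω × ℕ, ‖gradient (globalObj F D) (ampScaffold F x₀ η γ P I B q ξ₀ ξ p.2 p.1)‖ ^ 2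
    ∂(μ.prod (uniformOn (Set.Iio (R / P)))) ≤ b

end

end AmpScaffold

namespace AmpScaffold

open scoped InnerProductSpace Topology ENNReal

/-! ### Smooth functions and stochastic gradients -/

/-! Claim 1 is almost immediate. Regularity makes the averaged weights almost surely `1/N`, hence
every sampling indicator equals `1`, `w = 1/N` and `v = 0`; conditional expectations of almost
surely constant variables are these constants.

For Claim 2, a window acts as one step of SGD. Every client has total weight `1/N` in it, so the
corrections `G^i - G` cancel from the accumulated update (`windowStep_model`). The weighted mean of
the stochastic gradients in the window is then `∇f` at its start, plus averaged noise, plus an error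
bounded by the drift of the local iterates (`norm_windowGradMean_sub_le`). The normalized weights `q
/ (P I)` have squares summing to at most `ρ² / (P I)` and the noise terms are uncorrelated, so the
averaged noise has second moment at most `ρ² σ² / (P I)` (`integral_windowNoiseMean_sq_le`); `I` is
chosen to make this at most `ε²`.

The amplification decouples two step sizes. The product `γ η P I = 1 / (24 L')` is the effective
step of a window, whereas the drift depends on `η` alone, which may be taken very small. A crude
drift estimate by the triangle inequality, without any cancellation in the noise, is therefore
enough (`sum_sq_drift_le`).

The drift is driven by the noise, by `‖∇f‖` and by the error of the control variates
(`windowDrift_le`). That error is in turn renewed in each window from noise, drift and the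
displacement of the server (`controlError_windowStep_le`), so no bound on the heterogeneity of the
clients is needed. Together with the descent inequality (`objective_windowStep_le`) this is a system
of linear recursions, which closes after summation over the windows (`sum_le_of_progress`). About
`max 1 (Δ L / ε²)` windows then suffice.

On the probabilistic side, the weights are independent of the samples, so by Fubini they can be
fixed and the samples put on a product space. Conditional expectations given the past are replaced
there by resampling one coordinate, which preserves the law (`integral_inner_noise_eq_zero`).
Unbiasedness of the stochastic gradients is not an assumption; it follows from the variance bound
(`integral_gradient_eq`). -/

theorem abs_sub_sub_inner_gradient_le {E : Type*} [NormedAddCommGroup E] [InnerProductSpace ℝ E]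
    [CompleteSpace E] {f : E → ℝ} {L : ℝ} (hf : Differentiable ℝ f)
    (hL : ∀ x y, ‖gradient f x - gradient f y‖ ≤ L * ‖x - y‖) (hL0 : 0 ≤ L) (x y : E) :
    |f y - f x - ⟪gradient f x, y - x⟫_ℝ| ≤ L * ‖y - x‖ ^ 2 := by
  -- Mean value inequality for `f` minus its linearization at `x`, on the ball about `x` through
  -- `y`. It gives the constant `L` instead of the sharp `L / 2`, which costs only a numerical
  -- factor later.
  have h := (convex_closedBall x ‖y - x‖).norm_image_sub_le_of_norm_hasFDerivWithin_le'
    (f := f) (f' := fun z => fderiv ℝ f z) (φ := fderiv ℝ f x) (C := L * ‖y - x‖)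
    (fun z _ => (hf z).hasFDerivAt.hasFDerivWithinAt) (x := x) (y := y) ?_
    (by simp) (by simp [dist_eq_norm])
  · have h2 : ⟪gradient f x, y - x⟫_ℝ = fderiv ℝ f x (y - x) := inner_gradient_left ..
    rw [h2, ← Real.norm_eq_abs]
    calc _ ≤ _ := h
      _ = _ := by ring
  · intro z hz
    rw [← toDual_gradient, ← toDual_gradient, ← map_sub, LinearIsometryEquiv.norm_map]
    refine (hL z x).trans ?_
    rw [Metric.mem_closedBall, dist_eq_norm] at hz
    gcongr

theorem tendsto_smul_sub_inner_gradient {d : ℕ} {f : Vec d → ℝ} (hf : Differentiable ℝ f)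
    (x v : Vec d) :
    Filter.Tendsto (fun n : ℕ => ((n : ℝ) + 1) * (f (x + ((n : ℝ) + 1)⁻¹ • v) - f x)) Filter.atTop
      (𝓝 ⟪gradient f x, v⟫_ℝ) := by
  rw [inner_gradient_left]
  refine HasFDerivAt.lim (hf x).hasFDerivAt v (c := fun n : ℕ => (n : ℝ) + 1) ?_
  refine Filter.tendsto_atTop_mono (fun n => ?_)
    (tendsto_natCast_atTop_atTop (R := ℝ) : Filter.Tendsto _ _ _)
  rw [Real.norm_of_nonneg (by positivity)]
  linarith

/-- Directional derivatives are limits of difference quotients along the fixed sequence `1 / (n +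
1)`, and these are jointly measurable in the point and the sample. -/
theorem measurable_inner_gradient {d : ℕ} {Ξ : Type*} [MeasurableSpace Ξ] {F : Vec d → Ξ → ℝ}
    (hm : Measurable (fun p : Vec d × Ξ => F p.1 p.2))
    (hd : ∀ ξ, Differentiable ℝ (fun x => F x ξ)) (v : Vec d) :
    Measurable (fun p : Vec d × Ξ => ⟪gradient (fun y => F y p.2) p.1, v⟫_ℝ) := by
  refine measurable_of_tendsto_metrizable
    (f := fun (n : ℕ) (p : Vec d × Ξ) =>
      ((n : ℝ) + 1) * (F (p.1 + (((n : ℝ) + 1)⁻¹) • v) p.2 - F p.1 p.2)) ?_ ?_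
  · intro n
    have h1 : Measurable (fun p : Vec d × Ξ => F (p.1 + (((n : ℝ) + 1)⁻¹) • v) p.2) :=
      hm.comp ((measurable_fst.add_const _).prodMk measurable_snd)
    exact (h1.sub hm).const_mul _
  · rw [tendsto_pi_nhds]
    intro p
    exact tendsto_smul_sub_inner_gradient (hd p.2) p.1 v

theorem measurable_stochGrad {N d : ℕ} {Ξ : Type*} [MeasurableSpace Ξ]
    {F : Fin N → Vec d → Ξ → ℝ} {i : Fin N}
    (hm : Measurable (fun p : Vec d × Ξ => F i p.1 p.2))
    (hd : ∀ ξ, Differentiable ℝ (fun x => F i x ξ)) :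
    Measurable (fun p : Vec d × Ξ => stochGrad F i p.2 p.1) := by
  have h : (fun p : Vec d × Ξ => stochGrad F i p.2 p.1) = fun p => ∑ j,
      ⟪stochGrad F i p.2 p.1, EuclideanSpace.basisFun (Fin d) ℝ j⟫_ℝ •
        EuclideanSpace.basisFun (Fin d) ℝ j := by
    funext p
    conv_lhs => rw [← (EuclideanSpace.basisFun (Fin d) ℝ).sum_repr' (stochGrad F i p.2 p.1)]
    simp only [real_inner_comm]
  rw [h]
  exact Finset.measurable_sum _ fun j _ => (measurable_inner_gradient hm hd _).smul_const _

theorem eLpNorm_two_sq {α E : Type*} [MeasurableSpace α] [NormedAddCommGroup E] (μ : Measure α)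
    (f : α → E) : eLpNorm f 2 μ ^ 2 = ∫⁻ a, ‖f a‖ₑ ^ 2 ∂μ := by
  have h := eLpNorm_nnreal_pow_eq_lintegral (μ := μ) (f := f) (p := 2) (by norm_num)
  simpa using h

theorem memLp_two_iff_lintegral_lt_top {α E : Type*} [MeasurableSpace α] [NormedAddCommGroup E]
    {μ : Measure α} {f : α → E} (hf : AEStronglyMeasurable f μ) :
    MemLp f 2 μ ↔ ∫⁻ a, ‖f a‖ₑ ^ 2 ∂μ < ∞ := by
  rw [← eLpNorm_two_sq, MemLp, and_iff_right hf]
  simp [lt_top_iff_ne_top]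

/-- The derivative need not be continuous. If the right side is infinite there is nothing to prove;
otherwise the derivative is integrable, the fundamental theorem of calculus applies, and the `L¹`
norm is at most the `L²` norm on a probability space. -/
theorem enorm_sub_sq_le_lintegral_deriv {φ : ℝ → ℝ} (hφ : Differentiable ℝ φ) :
    ‖φ 1 - φ 0‖ₑ ^ 2 ≤ ∫⁻ s in Set.Ioc 0 1, ‖deriv φ s‖ₑ ^ 2 := by
  have hm : AEStronglyMeasurable (deriv φ) (volume.restrict (Set.Ioc (0 : ℝ) 1)) :=
    (measurable_deriv φ).aestronglyMeasurable
  have : IsProbabilityMeasure (volume.restrict (Set.Ioc (0 : ℝ) 1)) := ⟨by simp⟩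
  rcases eq_or_ne (∫⁻ s in Set.Ioc (0 : ℝ) 1, ‖deriv φ s‖ₑ ^ 2) ∞ with h | h
  · simp [h]
  · have hL : MemLp (deriv φ) 2 (volume.restrict (Set.Ioc (0 : ℝ) 1)) :=
      (memLp_two_iff_lintegral_lt_top hm).2 h.lt_top
    have hint := hL.integrable one_le_two
    rw [← intervalIntegral.integral_eq_sub_of_hasDerivAt (fun x _ => (hφ x).hasDerivAt)
      ((intervalIntegrable_iff_integrableOn_Ioc_of_le zero_le_one).2 hint),
      intervalIntegral.integral_of_le zero_le_one, ← eLpNorm_two_sq]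
    gcongr
    refine (enorm_integral_le_lintegral_enorm _).trans ?_
    rw [← eLpNorm_one_eq_lintegral_enorm]
    exact eLpNorm_le_eLpNorm_of_exponent_le one_le_two hm

/-- A form of Vitali's theorem: an `L²` bound gives uniform integrability. Fatou puts the limit into
`L²`, and the difference `δ` is split by `|δ| ≤ min |δ| M + δ² / M`; the first part tends to zero in
mean by dominated convergence, the second is small uniformly in `n` for large `M`. -/
theorem tendsto_integral_of_lintegral_sq_le {α : Type*} [MeasurableSpace α] {μ : Measure α}
    [IsProbabilityMeasure μ] {φ : ℕ → α → ℝ} {ψ : α → ℝ} (hm : ∀ n, Measurable (φ n))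
    {K : ℝ≥0∞} (hK : K ≠ ∞) (hφ : ∀ n, ∫⁻ a, ‖φ n a‖ₑ ^ 2 ∂μ ≤ K)
    (h : ∀ a, Filter.Tendsto (fun n => φ n a) Filter.atTop (𝓝 (ψ a))) :
    Filter.Tendsto (fun n => ∫ a, φ n a ∂μ) Filter.atTop (𝓝 (∫ a, ψ a ∂μ)) := by
  have hψm : Measurable ψ := measurable_of_tendsto_metrizable hm (tendsto_pi_nhds.2 h)
  have hψ : ∫⁻ a, ‖ψ a‖ₑ ^ 2 ∂μ ≤ K := by
    have h1 : ∀ a, ‖ψ a‖ₑ ^ 2 = Filter.liminf (fun n => ‖φ n a‖ₑ ^ 2) Filter.atTop := fun a =>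
      (((ENNReal.continuous_pow 2).tendsto _).comp ((h a).enorm)).liminf_eq.symm
    simp_rw [h1]
    refine (lintegral_liminf_le fun n => ((hm n).enorm.pow_const 2)).trans ?_
    refine Filter.liminf_le_of_le (by isBoundedDefault) fun b hb => ?_
    obtain ⟨n, hn⟩ := hb.exists
    exact hn.trans (hφ n)
  have hL : ∀ n, MemLp (φ n) 2 μ := fun n =>
    (memLp_two_iff_lintegral_lt_top (hm n).aestronglyMeasurable).2 ((hφ n).trans_lt hK.lt_top)
  have hLψ : MemLp ψ 2 μ :=
    (memLp_two_iff_lintegral_lt_top hψm.aestronglyMeasurable).2 (hψ.trans_lt hK.lt_top)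
  have hsq : ∀ {f : α → ℝ}, MemLp f 2 μ → ∫⁻ a, ‖f a‖ₑ ^ 2 ∂μ ≤ K →
      ∫ a, (f a) ^ 2 ∂μ ≤ K.toReal := by
    intro f hf hfK
    rw [integral_eq_lintegral_of_nonneg_ae (Filter.Eventually.of_forall fun a => sq_nonneg _)
      hf.integrable_sq.aestronglyMeasurable]
    refine ENNReal.toReal_mono hK (le_trans (le_of_eq ?_) hfK)
    refine lintegral_congr fun a => ?_
    rw [← Real.enorm_of_nonneg (sq_nonneg _), enorm_pow]
  set δ : ℕ → α → ℝ := fun n a => φ n a - ψ a with hδ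
  have hδL : ∀ n, MemLp (δ n) 2 μ := fun n => (hL n).sub hLψ
  have hδsq : ∀ n, ∫ a, (δ n a) ^ 2 ∂μ ≤ 4 * K.toReal := by
    intro n
    have h1 : ∫ a, (δ n a) ^ 2 ∂μ ≤ ∫ a, (2 * (φ n a) ^ 2 + 2 * (ψ a) ^ 2) ∂μ := by
      refine integral_mono (hδL n).integrable_sq
        (((hL n).integrable_sq.const_mul 2).add (hLψ.integrable_sq.const_mul 2)) fun a => ?_
      simp only [hδ]
      nlinarith [sq_nonneg (φ n a + ψ a)]
    rw [integral_add ((hL n).integrable_sq.const_mul 2) (hLψ.integrable_sq.const_mul 2),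
      integral_const_mul, integral_const_mul] at h1
    linarith [hsq (hL n) (hφ n), hsq hLψ hψ]
  have hmin : ∀ M : ℝ, 0 < M →
      Filter.Tendsto (fun n => ∫ a, min |δ n a| M ∂μ) Filter.atTop (𝓝 0) := by
    intro M hM
    have := tendsto_integral_of_dominated_convergence (μ := μ)
      (F := fun n a => min |δ n a| M) (f := fun _ => 0) (fun _ => M)
      (fun n => (((hm n).sub hψm).abs.min measurable_const).aestronglyMeasurable)
      (integrable_const _)
      (fun n => Filter.Eventually.of_forall fun a => by
        rw [Real.norm_of_nonneg (le_min (abs_nonneg _) hM.le)]; exact min_le_right _ _)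
      (Filter.Eventually.of_forall fun a => by
        have h1 : Filter.Tendsto (fun n => δ n a) Filter.atTop (𝓝 0) := by
          simpa [hδ] using (h a).sub_const (ψ a)
        simpa [hM.le] using h1.abs.min (tendsto_const_nhds (x := M)))
    simpa using this
  have hint : ∀ n, ∫ a, φ n a ∂μ - ∫ a, ψ a ∂μ = ∫ a, δ n a ∂μ := fun n =>
    (integral_sub ((hL n).integrable one_le_two) (hLψ.integrable one_le_two)).symm
  rw [tendsto_iff_norm_sub_tendsto_zero]
  simp_rw [hint]
  rw [Metric.tendsto_atTop]
  intro ε hε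
  -- Since `∫ δ² ≤ 4 K`, this cutoff makes the tail `∫ δ² / M` at most `ε / 2`; the summand `1`
  -- keeps `M` positive when `K = 0`.
  set M : ℝ := (8 * K.toReal + 1) / ε with hMdef
  have hK0 : 0 ≤ K.toReal := ENNReal.toReal_nonneg
  have hM : 0 < M := by positivity
  obtain ⟨n₀, hn₀⟩ := (Metric.tendsto_atTop.1 (hmin M hM)) (ε / 2) (by positivity)
  refine ⟨n₀, fun n hn => ?_⟩
  have h1 := hn₀ n hn
  rw [dist_zero_right, Real.norm_eq_abs] at h1
  rw [dist_zero_right, norm_norm]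
  have hmi : Integrable (fun a => min |δ n a| M) μ := by
    refine ((hδL n).integrable one_le_two).abs.mono'
      (((hm n).sub hψm).abs.min measurable_const).aestronglyMeasurable
      (Filter.Eventually.of_forall fun a => ?_)
    rw [Real.norm_of_nonneg (le_min (abs_nonneg _) hM.le)]; exact min_le_left _ _
  have hsi : Integrable (fun a => (δ n a) ^ 2 / M) μ := (hδL n).integrable_sq.div_const M
  have h2 : ‖∫ a, δ n a ∂μ‖ ≤ ∫ a, (min |δ n a| M + (δ n a) ^ 2 / M) ∂μ := by
    refine norm_integral_le_of_norm_le (hmi.add hsi) (Filter.Eventually.of_forall fun a => ?_)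
    rw [Real.norm_eq_abs]
    rcases le_total |δ n a| M with h3 | h3
    · rw [min_eq_left h3]
      have : 0 ≤ (δ n a) ^ 2 / M := by positivity
      linarith
    · rw [min_eq_right h3]
      have : |δ n a| ≤ (δ n a) ^ 2 / M := by
        rw [le_div_iff₀ hM, ← sq_abs, sq]
        gcongr
      linarith
  rw [integral_add hmi hsi, integral_div] at h2
  have h4 : (∫ a, (δ n a) ^ 2 ∂μ) / M ≤ ε / 2 := by
    rw [div_le_iff₀ hM, hMdef]
    refine (hδsq n).trans ?_
    field_simp
    linarith
  have := le_abs_self (∫ a, min |δ n a| M ∂μ)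
  linarith

/-- Integrate the one-dimensional bound along the segment from `x` to `x + w` and exchange the
integrals by Tonelli; `K` bounds the second moment of the gradient on the segment. -/
theorem lintegral_enorm_sub_sq_le {d : ℕ} {Ξ : Type*} [MeasurableSpace Ξ] {F : Vec d → Ξ → ℝ}
    {D : Measure Ξ} [IsProbabilityMeasure D] (hm : Measurable (fun p : Vec d × Ξ => F p.1 p.2))
    (hd : ∀ ξ, Differentiable ℝ (fun x => F x ξ)) {K : ℝ≥0∞} (x w : Vec d)
    (hK : ∀ s ∈ Set.Ioc (0 : ℝ) 1,
      ∫⁻ ξ, ‖gradient (fun y => F y ξ) (x + s • w)‖ₑ ^ 2 ∂D ≤ K) :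
    ∫⁻ ξ, ‖F (x + w) ξ - F x ξ‖ₑ ^ 2 ∂D ≤ K * ‖w‖ₑ ^ 2 := by
  have hder : ∀ ξ s, deriv (fun s : ℝ => F (x + s • w) ξ) s =
      ⟪gradient (fun y => F y ξ) (x + s • w), w⟫_ℝ := by
    intro ξ s
    rw [inner_gradient_left]
    have h1 : HasDerivAt (fun s : ℝ => x + s • w) w s := by
      simpa using ((hasDerivAt_id s).smul_const w).const_add x
    exact ((hd ξ (x + s • w)).hasFDerivAt.comp_hasDerivAt s h1).deriv
  have hdiff : ∀ ξ, Differentiable ℝ (fun s : ℝ => F (x + s • w) ξ) := fun ξ =>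
    (hd ξ).comp ((differentiable_id.smul_const w).const_add x)
  calc ∫⁻ ξ, ‖F (x + w) ξ - F x ξ‖ₑ ^ 2 ∂D
      ≤ ∫⁻ ξ, (∫⁻ s in Set.Ioc (0 : ℝ) 1,
          ‖⟪gradient (fun y => F y ξ) (x + s • w), w⟫_ℝ‖ₑ ^ 2) ∂D := by
        refine lintegral_mono fun ξ => ?_
        have h := enorm_sub_sq_le_lintegral_deriv (hdiff ξ)
        simp_rw [hder] at h
        simpa using h
    _ = ∫⁻ s in Set.Ioc (0 : ℝ) 1, ∫⁻ ξ,
          ‖⟪gradient (fun y => F y ξ) (x + s • w), w⟫_ℝ‖ₑ ^ 2 ∂D := by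
        refine lintegral_lintegral_swap (Measurable.aemeasurable ?_)
        have h1 : Measurable (fun p : Ξ × ℝ => (x + p.2 • w, p.1)) := by fun_prop
        exact (((measurable_inner_gradient hm hd w).comp h1).enorm.pow_const 2)
    _ ≤ ∫⁻ s in Set.Ioc (0 : ℝ) 1, K * ‖w‖ₑ ^ 2 := by
        refine setLIntegral_mono measurable_const fun s hs => ?_
        calc ∫⁻ ξ, ‖⟪gradient (fun y => F y ξ) (x + s • w), w⟫_ℝ‖ₑ ^ 2 ∂D
            ≤ ∫⁻ ξ, ‖gradient (fun y => F y ξ) (x + s • w)‖ₑ ^ 2 * ‖w‖ₑ ^ 2 ∂D := by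
              refine lintegral_mono fun ξ => ?_
              rw [← mul_pow]
              gcongr
              rw [← ofReal_norm, ← ofReal_norm, ← ofReal_norm,
                ← ENNReal.ofReal_mul (norm_nonneg _)]
              exact ENNReal.ofReal_le_ofReal (norm_inner_le_norm _ _)
          _ = (∫⁻ ξ, ‖gradient (fun y => F y ξ) (x + s • w)‖ₑ ^ 2 ∂D) * ‖w‖ₑ ^ 2 :=
              lintegral_mul_const' _ _ (by simp)
          _ ≤ _ := by gcongr; exact hK s hs
    _ = K * ‖w‖ₑ ^ 2 := by simp

theorem ennreal_add_sq_le (a b : ℝ≥0∞) : (a + b) ^ 2 ≤ 2 * (a ^ 2 + b ^ 2) := by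
  rcases eq_or_ne a ∞ with rfl | ha
  · simp [ENNReal.mul_top]
  rcases eq_or_ne b ∞ with rfl | hb
  · simp [ENNReal.mul_top]
  lift a to NNReal using ha
  lift b to NNReal using hb
  have h : (a + b) ^ 2 ≤ 2 * (a ^ 2 + b ^ 2) := add_sq_le
  exact_mod_cast h

theorem lintegral_enorm_sq_le_of_sub {α E : Type*} [MeasurableSpace α] [NormedAddCommGroup E]
    {μ : Measure α} [IsProbabilityMeasure μ] {f : α → E} {c : E} {s b : ℝ} (hc : ‖c‖ ≤ b)
    (h : ∫⁻ a, ‖f a - c‖ₑ ^ 2 ∂μ ≤ ENNReal.ofReal s) :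
    ∫⁻ a, ‖f a‖ₑ ^ 2 ∂μ ≤ 2 * (ENNReal.ofReal s + ENNReal.ofReal b ^ 2) := by
  calc ∫⁻ a, ‖f a‖ₑ ^ 2 ∂μ
      ≤ ∫⁻ a, 2 * (‖f a - c‖ₑ ^ 2 + ENNReal.ofReal b ^ 2) ∂μ := by
        refine lintegral_mono fun a => ?_
        calc ‖f a‖ₑ ^ 2 ≤ (‖f a - c‖ₑ + ENNReal.ofReal b) ^ 2 := by
              gcongr
              calc ‖f a‖ₑ = ‖(f a - c) + c‖ₑ := by simp
                _ ≤ ‖f a - c‖ₑ + ‖c‖ₑ := enorm_add_le _ _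
                _ ≤ _ := by gcongr; rw [← ofReal_norm]; exact ENNReal.ofReal_le_ofReal hc
          _ ≤ _ := ennreal_add_sq_le _ _
    _ = 2 * ((∫⁻ a, ‖f a - c‖ₑ ^ 2 ∂μ) + ENNReal.ofReal b ^ 2) := by
        rw [lintegral_const_mul' _ _ (by simp), lintegral_add_right _ measurable_const]
        simp
    _ ≤ _ := by gcongr

theorem integrable_of_lintegral_sub_const {α E : Type*} [MeasurableSpace α] [NormedAddCommGroup E]
    {μ : Measure α} [IsProbabilityMeasure μ] {f : α → E} {c : E} {s : ℝ}
    (hf : AEStronglyMeasurable f μ) (h : ∫⁻ a, ‖f a - c‖ₑ ^ 2 ∂μ ≤ ENNReal.ofReal s) :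
    Integrable f μ := by
  refine MemLp.integrable one_le_two ((memLp_two_iff_lintegral_lt_top hf).2
    ((lintegral_enorm_sq_le_of_sub le_rfl h).trans_lt ?_))
  finiteness

/-- Differentiation under the integral without a dominating function. The variance bound and the
Lipschitz gradient of `f` bound the second moment of `∇F` uniformly on a segment, so the difference
quotients are bounded in `L²` and their means converge to the mean of their pointwise limit. -/
theorem integral_gradient_eq {d : ℕ} {Ξ : Type*} [MeasurableSpace Ξ] {F : Vec d → Ξ → ℝ}
    {D : Measure Ξ} [IsProbabilityMeasure D] {f : Vec d → ℝ} {L s : ℝ} (hL0 : 0 ≤ L)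
    (hm : Measurable (fun p : Vec d × Ξ => F p.1 p.2))
    (hd : ∀ ξ, Differentiable ℝ (fun x => F x ξ)) (hint : ∀ x, Integrable (F x) D)
    (hf : ∀ x, f x = ∫ ξ, F x ξ ∂D) (hfd : Differentiable ℝ f)
    (hL : ∀ x y, ‖gradient f x - gradient f y‖ ≤ L * ‖x - y‖)
    (hvar : ∀ x, ∫⁻ ξ, ‖gradient (fun y => F y ξ) x - gradient f x‖ₑ ^ 2 ∂D ≤ ENNReal.ofReal s)
    (hgm : Measurable (fun p : Vec d × Ξ => gradient (fun y => F y p.2) p.1)) (x : Vec d) :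
    ∫ ξ, gradient (fun y => F y ξ) x ∂D = gradient f x := by
  have hgi : Integrable (fun ξ => gradient (fun y => F y ξ) x) D :=
    integrable_of_lintegral_sub_const
      (hgm.comp (measurable_const.prodMk measurable_id)).aestronglyMeasurable (hvar x)
  refine ext_inner_right ℝ fun v => ?_
  rw [real_inner_comm, ← integral_inner hgi]
  simp_rw [real_inner_comm _ v]
  -- Bounds the second moment of `∇F` at every point of the segment from `x` to `x + v`.
  set K : ℝ≥0∞ := 2 * (ENNReal.ofReal s + ENNReal.ofReal (‖gradient f x‖ + L * ‖v‖) ^ 2) with hK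
  have hKf : K * ‖v‖ₑ ^ 2 ≠ ∞ := by finiteness
  have hmx : ∀ y, Measurable (fun ξ => F y ξ) := fun y =>
    hm.comp (measurable_const.prodMk measurable_id)
  refine tendsto_nhds_unique (tendsto_integral_of_lintegral_sq_le (μ := D)
    (φ := fun n ξ => ((n : ℝ) + 1) * (F (x + ((n : ℝ) + 1)⁻¹ • v) ξ - F x ξ))
    (fun n => ((hmx _).sub (hmx _)).const_mul _) hKf ?_
    (fun ξ => tendsto_smul_sub_inner_gradient (hd ξ) x v)) ?_
  · intro n
    have h1 : ∀ ξ, ‖((n : ℝ) + 1) * (F (x + ((n : ℝ) + 1)⁻¹ • v) ξ - F x ξ)‖ₑ ^ 2 =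
        ‖(n : ℝ) + 1‖ₑ ^ 2 * ‖F (x + ((n : ℝ) + 1)⁻¹ • v) ξ - F x ξ‖ₑ ^ 2 := fun ξ => by
      rw [enorm_mul, mul_pow]
    simp_rw [h1]
    rw [lintegral_const_mul' _ _ (by simp)]
    have h2 := lintegral_enorm_sub_sq_le (D := D) hm hd (K := K) x (((n : ℝ) + 1)⁻¹ • v) ?_
    · calc _ ≤ ‖(n : ℝ) + 1‖ₑ ^ 2 * (K * ‖((n : ℝ) + 1)⁻¹ • v‖ₑ ^ 2) := by gcongr
        _ = K * ‖((n : ℝ) + 1) • (((n : ℝ) + 1)⁻¹ • v)‖ₑ ^ 2 := by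
          rw [enorm_smul ((n : ℝ) + 1), mul_pow]; ring
        _ ≤ _ := by rw [smul_inv_smul₀ (by positivity)]
    · intro t ht
      refine lintegral_enorm_sq_le_of_sub ?_ (hvar _)
      have h3 : ‖t • (((n : ℝ) + 1)⁻¹ • v)‖ ≤ ‖v‖ := by
        rw [smul_smul, norm_smul, Real.norm_of_nonneg (mul_nonneg ht.1.le (by positivity))]
        refine mul_le_of_le_one_left (norm_nonneg _) (mul_le_one₀ ht.2 (by positivity) ?_)
        exact inv_le_one_of_one_le₀ (by linarith [Nat.cast_nonneg (α := ℝ) n])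
      calc _ ≤ ‖gradient f x‖ + ‖gradient f (x + t • (((n : ℝ) + 1)⁻¹ • v)) - gradient f x‖ := by
            have := norm_add_le (gradient f x)
              (gradient f (x + t • (((n : ℝ) + 1)⁻¹ • v)) - gradient f x)
            simpa using this
        _ ≤ _ := by
            gcongr
            refine (hL _ _).trans ?_
            rw [add_sub_cancel_left]
            gcongr
  · have h4 : ∀ n : ℕ, ∫ ξ, ((n : ℝ) + 1) * (F (x + ((n : ℝ) + 1)⁻¹ • v) ξ - F x ξ) ∂D =
        ((n : ℝ) + 1) * (f (x + ((n : ℝ) + 1)⁻¹ • v) - f x) := fun n => by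
      rw [integral_const_mul, integral_sub (hint _) (hint _), hf, hf]
    simp_rw [h4]
    exact tendsto_smul_sub_inner_gradient hfd x v

/-! ### The iterates depend only on earlier stochastic gradients -/

section Congr

variable {N d : ℕ} {η γ : ℝ} {P I : ℕ} {g g' : Fin N → ℕ → ℕ → Vec d → Vec d}
  {q q' : ℕ → Fin N → ℝ} {S : ServerState N d}

theorem localIter_congr {h h' : ℕ → Vec d → Vec d} {Gi G x : Vec d} {n : ℕ}
    (hh : ∀ k < n, h k = h' k) : localIter η h Gi G x n = localIter η h' Gi G x n := by
  induction n with
  | zero => rfl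
  | succ n ih =>
    rw [localIter, localIter, ih fun k hk => hh k (by lia), hh n (by lia)]

theorem roundUpdate_congr {r : ℕ} {x : Vec d} (hg : ∀ i, ∀ k < I, g i r k = g' i r k)
    (hq : q r = q' r) : roundUpdate η I g q S r x = roundUpdate η I g' q' S r x := by
  simp only [roundUpdate, clientIter, hq]
  exact Finset.sum_congr rfl fun i _ => by rw [localIter_congr (hg i)]

theorem windowModel_congr {r₀ j : ℕ}
    (hg : ∀ i, ∀ r, r₀ ≤ r → r < r₀ + j → ∀ k < I, g i r k = g' i r k)
    (hq : ∀ r, r₀ ≤ r → r < r₀ + j → q r = q' r) :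
    windowModel η I g q S r₀ j = windowModel η I g' q' S r₀ j := by
  induction j with
  | zero => rfl
  | succ j ih =>
    rw [windowModel, windowModel, ih (fun i r h1 h2 => hg i r h1 (by lia))
      (fun r h1 h2 => hq r h1 (by lia)),
      roundUpdate_congr (fun i => hg i _ (by lia) (by lia)) (hq _ (by lia) (by lia))]

theorem qBar_congr {r₀ : ℕ} (hq : ∀ r, r₀ ≤ r → r < r₀ + P → q r = q' r) :
    qBar P q r₀ = qBar P q' r₀ := by
  funext i
  unfold qBar
  congr 1
  exact Finset.sum_congr rfl fun j hj => by
    rw [hq _ (by lia) (by have := Finset.mem_range.1 hj; lia)]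

theorem windowStep_congr {r₀ : ℕ}
    (hg : ∀ i, ∀ r, r₀ ≤ r → r < r₀ + P → ∀ k < I, g i r k = g' i r k)
    (hq : ∀ r, r₀ ≤ r → r < r₀ + P → q r = q' r) :
    windowStep η γ P I g q r₀ S = windowStep η γ P I g' q' r₀ S := by
  have hw : ∀ j < P, windowModel η I g q S r₀ j = windowModel η I g' q' S r₀ j := fun j hj =>
    windowModel_congr (fun i r h1 h2 => hg i r h1 (by lia)) (fun r h1 h2 => hq r h1 (by lia))
  unfold windowStep
  congr 1
  · congr 2
    refine Finset.sum_congr rfl fun j hj => ?_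
    have hj := Finset.mem_range.1 hj
    rw [hw j hj, roundUpdate_congr (fun i => hg i _ (by lia) (by lia)) (hq _ (by lia) (by lia))]
  · funext i
    rw [qBar_congr hq]
    congr 2
    refine Finset.sum_congr rfl fun j hj => ?_
    have hj := Finset.mem_range.1 hj
    rw [hw j hj, hq _ (by lia) (by lia)]
    congr 1
    refine Finset.sum_congr rfl fun k hk => ?_
    have hk := Finset.mem_range.1 hk
    rw [hg i _ (by lia) (by lia) k hk, clientIter, clientIter,
      localIter_congr fun k' hk' => hg i _ (by lia) (by lia) k' (by lia)]

/-- Allows weights and samples from round `m P` on to be replaced by arbitrary default values. -/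
theorem serverState_congr {m : ℕ} (hg : ∀ i, ∀ r < m * P, ∀ k < I, g i r k = g' i r k)
    (hq : ∀ r < m * P, q r = q' r) :
    serverState η γ P I g q S m = serverState η γ P I g' q' S m := by
  induction m with
  | zero => rfl
  | succ m ih =>
    rw [Nat.succ_mul] at hg hq
    rw [serverState, serverState, ih (fun i r hr => hg i r (by lia)) (fun r hr => hq r (by lia)),
      windowStep_congr (fun i r _ h2 => hg i r h2) (fun r _ h2 => hq r h2)]

end Congr

/-! ### Measurability of the iterates -/

section Measurability

variable {Θ : Type*} [MeasurableSpace Θ] {N d : ℕ} {η γ : ℝ} {P I : ℕ}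
  {g : Θ → Fin N → ℕ → ℕ → Vec d → Vec d} {q : Θ → ℕ → Fin N → ℝ} {S : Θ → ServerState N d}

theorem measurable_avgControl (hS : ∀ i, Measurable fun θ => (S θ).control i) :
    Measurable fun θ => (S θ).avgControl :=
  Measurable.fun_const_smul (Finset.measurable_sum _ fun i _ => hS i) _

theorem measurable_clientIter {r : ℕ} {i : Fin N} {x : Θ → Vec d}
    (hg : ∀ k, Measurable fun p : Θ × Vec d => g p.1 i r k p.2)
    (hS : ∀ i, Measurable fun θ => (S θ).control i) (hx : Measurable x) (k : ℕ) :
    Measurable fun θ => clientIter η (g θ) (S θ) r i (x θ) k := by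
  induction k with
  | zero => exact hx
  | succ k ih =>
    have h1 : Measurable fun θ => g θ i r k (clientIter η (g θ) (S θ) r i (x θ) k) :=
      (hg k).comp (measurable_id.prodMk ih)
    exact ih.sub (((h1.sub (hS i)).add (measurable_avgControl hS)).const_smul η)

theorem measurable_roundUpdate {r : ℕ} {x : Θ → Vec d}
    (hg : ∀ i k, Measurable fun p : Θ × Vec d => g p.1 i r k p.2)
    (hq : ∀ i, Measurable fun θ => q θ r i)
    (hS : ∀ i, Measurable fun θ => (S θ).control i) (hx : Measurable x) :
    Measurable fun θ => roundUpdate η I (g θ) (q θ) (S θ) r (x θ) :=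
  Finset.measurable_sum _ fun i _ =>
    (hq i).smul ((measurable_clientIter (hg i) hS hx I).sub hx)

theorem measurable_windowModel
    (hg : ∀ i r k, Measurable fun p : Θ × Vec d => g p.1 i r k p.2)
    (hq : ∀ r i, Measurable fun θ => q θ r i) (hS : Measurable fun θ => (S θ).model)
    (hS' : ∀ i, Measurable fun θ => (S θ).control i) (r₀ j : ℕ) :
    Measurable fun θ => windowModel η I (g θ) (q θ) (S θ) r₀ j := by
  induction j with
  | zero => exact hS
  | succ j ih =>
    exact ih.add (measurable_roundUpdate (fun i k => hg i _ k) (hq _) hS' ih)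

theorem measurable_windowStep
    (hg : ∀ i r k, Measurable fun p : Θ × Vec d => g p.1 i r k p.2)
    (hq : ∀ r i, Measurable fun θ => q θ r i) (hS : Measurable fun θ => (S θ).model)
    (hS' : ∀ i, Measurable fun θ => (S θ).control i) (r₀ : ℕ) :
    (Measurable fun θ => (windowStep η γ P I (g θ) (q θ) r₀ (S θ)).model) ∧
      ∀ i, Measurable fun θ => (windowStep η γ P I (g θ) (q θ) r₀ (S θ)).control i := by
  have hw := fun j => measurable_windowModel (η := η) (I := I) hg hq hS hS' r₀ j
  have hqb : ∀ i, Measurable fun θ => qBar P (q θ) r₀ i := fun i =>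
    (Finset.measurable_sum _ fun j _ => hq _ i).const_mul _
  constructor
  · exact hS.add ((Finset.measurable_sum _ fun j _ =>
      measurable_roundUpdate (fun i k => hg i _ k) (hq _) hS' (hw j)).const_smul γ)
  · intro i
    refine Measurable.ite (measurableSet_lt measurable_const (hqb i)) ?_ (hS' i)
    refine Measurable.smul ((((hqb i).const_mul _).mul_const _).const_div _) (Finset.measurable_sum _ fun j _ => ?_)
    refine (hq _ i).smul (Finset.measurable_sum _ fun k _ => ?_)
    exact (hg i _ k).comp (measurable_id.prodMk (measurable_clientIter (hg i _) hS' (hw j) k))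

theorem measurable_serverState
    (hg : ∀ i r k, Measurable fun p : Θ × Vec d => g p.1 i r k p.2)
    (hq : ∀ r i, Measurable fun θ => q θ r i) (hS : Measurable fun θ => (S θ).model)
    (hS' : ∀ i, Measurable fun θ => (S θ).control i) (m : ℕ) :
    (Measurable fun θ => (serverState η γ P I (g θ) (q θ) (S θ) m).model) ∧
      ∀ i, Measurable fun θ => (serverState η γ P I (g θ) (q θ) (S θ) m).control i := by
  induction m with
  | zero => exact ⟨hS, hS'⟩
  | succ m ih => exact measurable_windowStep hg hq ih.1 ih.2 _

end Measurability

/-! ### One window under regularized participation -/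

section Window

variable {N d : ℕ} {η γ : ℝ} {P I : ℕ} {g : Fin N → ℕ → ℕ → Vec d → Vec d}
  {q : ℕ → Fin N → ℝ} {S : ServerState N d} {r₀ : ℕ}

/-- The iterate of client `i` before step `k` of the `j`-th round of a window. -/
noncomputable def windowIter (η : ℝ) (I : ℕ) (g : Fin N → ℕ → ℕ → Vec d → Vec d)
    (q : ℕ → Fin N → ℝ) (S : ServerState N d) (r₀ j : ℕ) (i : Fin N) (k : ℕ) : Vec d :=
  clientIter η g S (r₀ + j) i (windowModel η I g q S r₀ j) k

/-- The stochastic gradient that client `i` computes in step `k` of the `j`-th round of a window. -/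
noncomputable def windowGrad (η : ℝ) (I : ℕ) (g : Fin N → ℕ → ℕ → Vec d → Vec d)
    (q : ℕ → Fin N → ℝ) (S : ServerState N d) (r₀ j : ℕ) (i : Fin N) (k : ℕ) : Vec d :=
  g i (r₀ + j) k (windowIter η I g q S r₀ j i k)

/-- The deviation of that stochastic gradient from its mean, when the local gradients are `h`. -/
noncomputable def windowNoise (η : ℝ) (I : ℕ) (g : Fin N → ℕ → ℕ → Vec d → Vec d)
    (h : Fin N → Vec d → Vec d) (q : ℕ → Fin N → ℝ) (S : ServerState N d) (r₀ j : ℕ) (i : Fin N)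
    (k : ℕ) : Vec d :=
  windowGrad η I g q S r₀ j i k - h i (windowIter η I g q S r₀ j i k)

theorem clientIter_sub (r : ℕ) (i : Fin N) (x : Vec d) (n : ℕ) :
    clientIter η g S r i x n - x =
      -(η • ∑ k ∈ range n, (g i r k (clientIter η g S r i x k) - S.control i + S.avgControl)) := by
  induction n with
  | zero => simp [clientIter, localIter]
  | succ n ih =>
    rw [Finset.sum_range_succ, smul_add, neg_add, ← ih]
    simp only [clientIter, localIter]
    abel

theorem sum_weights_of_qBar (hP : 0 < P) {i : Fin N} {b : ℝ} (h : qBar P q r₀ i = b) :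
    ∑ j ∈ range P, q (r₀ + j) i = P * b := by
  have hP' : (P : ℝ) ≠ 0 := by positivity
  rw [← h, qBar]
  field_simp

/-- The corrections disappear: `G^i - G` enters with the factor `∑_j q_j^i = P / N`, the same for
all clients, and `∑_i (G^i - G) = 0`. The amplified step is then a plain weighted sum of stochastic
gradients. -/
theorem windowStep_model (hP : 0 < P) (hN : 0 < N) (hq : ∀ i, qBar P q r₀ i = 1 / (N : ℝ)) :
    (windowStep η γ P I g q r₀ S).model = S.model - (γ * η) •
      ∑ j ∈ range P, ∑ i, q (r₀ + j) i • ∑ k ∈ range I, windowGrad η I g q S r₀ j i k := by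
  have hN' : (N : ℝ) ≠ 0 := by positivity
  have hz : ∑ j ∈ range P, ∑ i, q (r₀ + j) i • ((I : ℝ) • (S.control i - S.avgControl)) = 0 := by
    rw [Finset.sum_comm]
    simp_rw [← Finset.sum_smul, sum_weights_of_qBar hP (hq _), ← Finset.smul_sum]
    have h0 : ∑ i, (S.control i - S.avgControl) = 0 := by
      rw [Finset.sum_sub_distrib, Finset.sum_const, Finset.card_univ, Fintype.card_fin,
        ServerState.avgControl, ← Nat.cast_smul_eq_nsmul ℝ, smul_smul, mul_one_div_cancel hN',
        one_smul, sub_self]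
    rw [h0, smul_zero, smul_zero]
  have hr : ∀ j, roundUpdate η I g q S (r₀ + j) (windowModel η I g q S r₀ j) =
      -(η • (∑ i, q (r₀ + j) i • ∑ k ∈ range I, windowGrad η I g q S r₀ j i k -
        ∑ i, q (r₀ + j) i • ((I : ℝ) • (S.control i - S.avgControl)))) := by
    intro j
    rw [← Finset.sum_sub_distrib, Finset.smul_sum, ← Finset.sum_neg_distrib]
    refine Finset.sum_congr rfl fun i _ => ?_
    rw [clientIter_sub, Finset.sum_add_distrib, Finset.sum_sub_distrib, Finset.sum_const,
      Finset.sum_const, Finset.card_range, ← Nat.cast_smul_eq_nsmul ℝ, ← Nat.cast_smul_eq_nsmul ℝ]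
    simp only [windowGrad, windowIter]
    module
  change S.model + γ • ∑ j ∈ range P, _ = _
  simp_rw [hr]
  rw [Finset.sum_neg_distrib, ← Finset.smul_sum, Finset.sum_sub_distrib, hz]
  module

theorem windowStep_control (hN : 0 < N) {i : Fin N} (hq : qBar P q r₀ i = 1 / (N : ℝ)) :
    (windowStep η γ P I g q r₀ S).control i = ((N : ℝ) / (P * I)) •
      ∑ j ∈ range P, q (r₀ + j) i • ∑ k ∈ range I, windowGrad η I g q S r₀ j i k := by
  have hN' : (0 : ℝ) < 1 / N := by positivity
  simp only [windowStep, hq, hN', if_true, windowGrad, windowIter]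
  congr 1
  field_simp

end Window

/-! ### Client drift -/

theorem sq_sum_mul_le {ι : Type*} (s : Finset ι) {a b : ι → ℝ} (ha : ∀ i ∈ s, 0 ≤ a i) :
    (∑ i ∈ s, a i * b i) ^ 2 ≤ (∑ i ∈ s, a i) * ∑ i ∈ s, a i * b i ^ 2 :=
  Finset.sum_sq_le_sum_mul_sum_of_sq_le_mul s ha
    (fun i hi => mul_nonneg (ha i hi) (sq_nonneg _)) fun i _ => le_of_eq (by ring)

theorem norm_sum_smul_sq_le {ι V : Type*} [NormedAddCommGroup V] [NormedSpace ℝ V] (s : Finset ι)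
    {a : ι → ℝ} {v : ι → V} (ha : ∀ i ∈ s, 0 ≤ a i) :
    ‖∑ i ∈ s, a i • v i‖ ^ 2 ≤ (∑ i ∈ s, a i) * ∑ i ∈ s, a i * ‖v i‖ ^ 2 := by
  refine le_trans ?_ (sq_sum_mul_le s ha)
  gcongr
  refine (norm_sum_le _ _).trans (Finset.sum_le_sum fun i hi => ?_)
  rw [norm_smul, Real.norm_of_nonneg (ha i hi)]

/-- A deterministic discrete Gronwall argument, applied twice: over the local steps of a round and
over the rounds of a window. Here `u` are the local directions, `ν` stands for the noise norms and
`β` for the part of the direction that does not depend on the iterate. The smallness `4 η P I L ≤ 1`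
absorbs the feedback through `L ‖y - X 0‖` at both levels. -/
theorem sum_sq_drift_le {V : Type*} [NormedAddCommGroup V] [NormedSpace ℝ V] {N P I : ℕ}
    {η L : ℝ} {q : ℕ → Fin N → ℝ} {X : ℕ → V} {y u : ℕ → Fin N → ℕ → V}
    {ν : ℕ → Fin N → ℕ → ℝ} {β : Fin N → ℝ} (hP : 1 ≤ P) (hη : 0 ≤ η) (hL : 0 ≤ L)
    (hηL : 4 * η * P * I * L ≤ 1) (hq0 : ∀ j < P, ∀ i, 0 ≤ q j i)
    (hq1 : ∀ j < P, ∑ i, q j i = 1) (hν : ∀ j i k, 0 ≤ ν j i k) (hβ : ∀ i, 0 ≤ β i)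
    (hy0 : ∀ j i, y j i 0 = X j) (hy : ∀ j i k, y j i (k + 1) = y j i k - η • u j i k)
    (hX : ∀ j, X (j + 1) = X j + ∑ i, q j i • (y j i I - X j))
    (hu : ∀ j < P, ∀ i, ∀ k < I, ‖u j i k‖ ≤ ν j i k + L * ‖y j i k - X 0‖ + β i) :
    ∑ j ∈ range P, ∑ i, q j i * ∑ k ∈ range I, ‖y j i k - X 0‖ ^ 2 ≤
      18 * η ^ 2 * P ^ 2 * I *
        ∑ j ∈ range P, ∑ i, q j i * (∑ k ∈ range I, ν j i k + I * β i) ^ 2 := by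
  set W : ℕ → Fin N → ℝ := fun j i => ∑ k ∈ range I, ν j i k + I * β i with hW
  set U : ℕ → Fin N → ℝ := fun j i => ∑ k ∈ range I, ‖u j i k‖ with hU
  set e : ℕ → ℝ := fun j => ‖X j - X 0‖ with he
  have hP1 : (1 : ℝ) ≤ P := by exact_mod_cast hP
  have hI0 : (0 : ℝ) ≤ I := Nat.cast_nonneg _
  have hηLI : η * L * I ≤ 1 / 4 := by
    have : η * L * I * 1 ≤ η * L * I * P := by gcongr
    nlinarith
  have hW0 : ∀ j i, 0 ≤ W j i := fun j i =>
    add_nonneg (Finset.sum_nonneg fun k _ => hν j i k) (mul_nonneg hI0 (hβ i))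
  have hU0 : ∀ j i, 0 ≤ U j i := fun j i => Finset.sum_nonneg fun k _ => norm_nonneg _
  have he0 : ∀ j, 0 ≤ e j := fun j => norm_nonneg _
  have hyX : ∀ j i, ∀ k ≤ I, ‖y j i k - X j‖ ≤ η * U j i := by
    intro j i k hk
    have h1 : ∀ n, ‖y j i n - X j‖ ≤ η * ∑ k ∈ range n, ‖u j i k‖ := by
      intro n
      induction n with
      | zero => simp [hy0]
      | succ n ih =>
        rw [hy, Finset.sum_range_succ, mul_add]
        calc _ = ‖(y j i n - X j) - η • u j i n‖ := by congr 1; abel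
          _ ≤ ‖y j i n - X j‖ + ‖η • u j i n‖ := norm_sub_le _ _
          _ ≤ _ := by rw [norm_smul, Real.norm_of_nonneg hη]; gcongr
    refine (h1 k).trans ?_
    gcongr
    exact Finset.sum_le_sum_of_subset_of_nonneg (Finset.range_mono hk)
      fun _ _ _ => norm_nonneg _
  have hye : ∀ j i, ∀ k ≤ I, ‖y j i k - X 0‖ ≤ e j + η * U j i := by
    intro j i k hk
    calc _ = ‖(X j - X 0) + (y j i k - X j)‖ := by congr 1; abel
      _ ≤ _ := norm_add_le _ _
      _ ≤ _ := by gcongr; exact hyX j i k hk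
  -- Local level: `U ≤ W + L I (e + η U)`, and the last term is absorbed because `η L I ≤ 1/4`,
  -- whence the factor `4/3`.
  have hUW : ∀ j < P, ∀ i, η * U j i ≤ 4 / 3 * (η * W j i) + 4 / 3 * (η * L * I * e j) := by
    intro j hj i
    have h1 : U j i ≤ W j i + L * I * (e j + η * U j i) := by
      calc U j i ≤ ∑ k ∈ range I, (ν j i k + L * (e j + η * U j i) + β i) := by
            refine Finset.sum_le_sum fun k hk => (hu j hj i k (Finset.mem_range.1 hk)).trans ?_
            gcongr
            exact hye j i k (Finset.mem_range.1 hk).le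
        _ = _ := by
            rw [Finset.sum_add_distrib, Finset.sum_add_distrib, Finset.sum_const, Finset.sum_const,
              Finset.card_range, nsmul_eq_mul, nsmul_eq_mul, hW]
            ring
    have h2 : η * U j i ≤ η * W j i + (η * L * I * e j + η * L * I * (η * U j i)) := by
      calc η * U j i ≤ η * (W j i + L * I * (e j + η * U j i)) := by gcongr
        _ = _ := by ring
    have h3 : η * L * I * (η * U j i) ≤ 1 / 4 * (η * U j i) :=
      mul_le_mul_of_nonneg_right hηLI (mul_nonneg hη (hU0 j i))
    linarith
  set w : ℕ → ℝ := fun j => ∑ i, q j i * W j i with hw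
  have hw0 : ∀ j < P, 0 ≤ w j := fun j hj =>
    Finset.sum_nonneg fun i _ => mul_nonneg (hq0 j hj i) (hW0 j i)
  have hstep : ∀ j < P, e (j + 1) ≤ e j + 4 / 3 * (η * (w j + L * I * e j)) := by
    intro j hj
    calc e (j + 1) = ‖(X j - X 0) + ∑ i, q j i • (y j i I - X j)‖ := by
          simp only [he, hX]; congr 1; abel
      _ ≤ e j + ∑ i, ‖q j i • (y j i I - X j)‖ :=
          (norm_add_le _ _).trans (by gcongr; exact norm_sum_le _ _)
      _ ≤ e j + ∑ i, q j i * (4 / 3 * η * W j i + 4 / 3 * η * L * I * e j) := by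
          gcongr with i
          rw [norm_smul, Real.norm_of_nonneg (hq0 j hj i)]
          refine mul_le_mul_of_nonneg_left ?_ (hq0 j hj i)
          linarith [hyX j i I le_rfl, hUW j hj i]
      _ = e j + (4 / 3 * η * w j + 4 / 3 * η * L * I * e j) := by
          have h1 : ∀ i, q j i * (4 / 3 * η * W j i + 4 / 3 * η * L * I * e j) =
              4 / 3 * η * (q j i * W j i) + 4 / 3 * η * L * I * e j * q j i := fun i => by ring
          simp_rw [h1]
          rw [Finset.sum_add_distrib, ← Finset.mul_sum, ← Finset.mul_sum, hq1 j hj, mul_one]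
      _ = _ := by ring
  set w' : ℝ := ∑ j ∈ range P, w j with hw'
  set e' : ℝ := ∑ j ∈ range P, e j with he'
  have he0' : 0 ≤ e' := Finset.sum_nonneg fun j _ => he0 j
  have hw0' : 0 ≤ w' := Finset.sum_nonneg fun j hj => hw0 j (Finset.mem_range.1 hj)
  have he1 : ∀ j < P, e j ≤ 4 / 3 * (η * (w' + L * I * e')) := by
    intro j hj
    have h1 : ∀ n ≤ P, e n ≤ ∑ j ∈ range n, 4 / 3 * (η * (w j + L * I * e j)) := by
      intro n hn
      induction n with
      | zero => simp [he]
      | succ n ih =>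
        rw [Finset.sum_range_succ]
        exact (hstep n (by lia)).trans (by gcongr; exact ih (by lia))
    calc e j ≤ _ := h1 j hj.le
      _ ≤ ∑ j ∈ range P, 4 / 3 * (η * (w j + L * I * e j)) := by
        refine Finset.sum_le_sum_of_subset_of_nonneg (Finset.range_mono hj.le) fun j hj _ => ?_
        have := hw0 j (Finset.mem_range.1 hj)
        have := he0 j
        positivity
      _ = _ := by
        rw [← Finset.mul_sum, ← Finset.mul_sum, Finset.sum_add_distrib, ← Finset.mul_sum]
  -- Window level: summing `he1` over the `P` rounds bounds `e'` by `4/3 η P w'` plus at most `e' /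
  -- 3`.
  have he2 : e' ≤ 2 * η * P * w' := by
    have h1 : e' ≤ P * (4 / 3 * (η * (w' + L * I * e'))) := by
      calc e' ≤ ∑ _j ∈ range P, 4 / 3 * (η * (w' + L * I * e')) :=
            Finset.sum_le_sum fun j hj => he1 j (Finset.mem_range.1 hj)
        _ = _ := by simp
    have h2 : 4 * η * P * I * L * e' ≤ 1 * e' := by gcongr
    linarith
  have he3 : ∀ j < P, e j ≤ 2 * η * w' := by
    intro j hj
    have h1 : η * L * I * e' ≤ η * L * I * (2 * η * P * w') := by gcongr
    have h2 : 4 * η * P * I * L * (η * w') ≤ 1 * (η * w') := by gcongr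
    linarith [he1 j hj]
  have hfin : ∀ j < P, ∀ i, ∀ k ∈ range I,
      ‖y j i k - X 0‖ ^ 2 ≤ 32 / 9 * η ^ 2 * (4 * w' ^ 2 + W j i ^ 2) := by
    intro j hj i k hk
    have h1 : η * L * I * e j ≤ 1 / 4 * e j := mul_le_mul_of_nonneg_right hηLI (he0 j)
    have h2 : ‖y j i k - X 0‖ ≤ 4 / 3 * η * (2 * w' + W j i) := by
      linarith [hye j i k (Finset.mem_range.1 hk).le, hUW j hj i, he3 j hj]
    calc ‖y j i k - X 0‖ ^ 2 ≤ (4 / 3 * η * (2 * w' + W j i)) ^ 2 := by gcongr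
      _ = 16 / 9 * η ^ 2 * (2 * w' + W j i) ^ 2 := by ring
      _ ≤ 16 / 9 * η ^ 2 * (2 * ((2 * w') ^ 2 + W j i ^ 2)) := by gcongr; exact add_sq_le
      _ = _ := by ring
  set V : ℝ := ∑ j ∈ range P, ∑ i, q j i * W j i ^ 2 with hV
  -- Cauchy–Schwarz with the weights `q`, whose total over the window is `P`.
  have hwV : w' ^ 2 ≤ P * V := by
    have h1 : w' = ∑ p ∈ range P ×ˢ univ, q p.1 p.2 * W p.1 p.2 := by
      rw [Finset.sum_product]
    have h2 : V = ∑ p ∈ range P ×ˢ univ, q p.1 p.2 * W p.1 p.2 ^ 2 := by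
      rw [Finset.sum_product]
    have h3 : (P : ℝ) = ∑ p ∈ range P ×ˢ univ, q p.1 p.2 := by
      rw [Finset.sum_product, Finset.sum_congr rfl fun j hj => hq1 j (Finset.mem_range.1 hj)]
      simp
    rw [h1, h2, h3]
    exact sq_sum_mul_le _ fun p hp =>
      hq0 _ (Finset.mem_range.1 (Finset.mem_product.1 hp).1) _
  have hV0 : 0 ≤ V := Finset.sum_nonneg fun j hj => Finset.sum_nonneg fun i _ =>
    mul_nonneg (hq0 j (Finset.mem_range.1 hj) i) (sq_nonneg _)
  calc ∑ j ∈ range P, ∑ i, q j i * ∑ k ∈ range I, ‖y j i k - X 0‖ ^ 2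
      ≤ ∑ j ∈ range P, ∑ i, q j i * (I * (32 / 9 * η ^ 2 * (4 * w' ^ 2 + W j i ^ 2))) := by
        refine Finset.sum_le_sum fun j hj => Finset.sum_le_sum fun i _ =>
          mul_le_mul_of_nonneg_left ?_ (hq0 j (Finset.mem_range.1 hj) i)
        refine (Finset.sum_le_sum (hfin j (Finset.mem_range.1 hj) i)).trans ?_
        simp
    _ = 32 / 9 * η ^ 2 * I * (4 * w' ^ 2 * P + V) := by
        have h1 : ∀ j i, q j i * (I * (32 / 9 * η ^ 2 * (4 * w' ^ 2 + W j i ^ 2))) =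
            32 / 9 * η ^ 2 * I * (4 * w' ^ 2) * q j i +
              32 / 9 * η ^ 2 * I * (q j i * W j i ^ 2) := fun j i => by ring
        simp_rw [h1, Finset.sum_add_distrib, ← Finset.mul_sum]
        rw [Finset.sum_congr rfl fun j hj => hq1 j (Finset.mem_range.1 hj)]
        simp only [Finset.sum_const, Finset.card_range, nsmul_eq_mul, mul_one]
        ring
    _ ≤ 32 / 9 * η ^ 2 * I * (4 * (P * V) * P + P ^ 2 * V) := by
        gcongr
        exact le_mul_of_one_le_left hV0 (one_le_pow₀ hP1)
    _ = 160 / 9 * (η ^ 2 * P ^ 2 * I * V) := by ring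
    _ ≤ 18 * (η ^ 2 * P ^ 2 * I * V) := by gcongr; norm_num
    _ = _ := by ring

/-! ### Square-integrable random vectors -/

section L2

variable {Z V : Type*} [MeasurableSpace Z] {π : Measure Z} [NormedAddCommGroup V]

theorem _root_.MeasureTheory.MemLp.integrable_inner_two [InnerProductSpace ℝ V] {f g : Z → V}
    (hf : MemLp f 2 π) (hg : MemLp g 2 π) : Integrable (fun z => ⟪f z, g z⟫_ℝ) π := by
  refine (hf.norm.integrable_mul hg.norm).mono' (hf.1.inner hg.1)
    (Filter.Eventually.of_forall fun z => ?_)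
  exact norm_inner_le_norm _ _

theorem _root_.MeasureTheory.MemLp.integrable_norm_sq {f : Z → V} (hf : MemLp f 2 π) :
    Integrable (fun z => ‖f z‖ ^ 2) π :=
  (memLp_two_iff_integrable_sq_norm hf.1).1 hf

theorem integral_norm_sq_le_of_lintegral {f : Z → V} {s : ℝ} (hs : 0 ≤ s)
    (hf : AEStronglyMeasurable f π) (h : ∫⁻ z, ‖f z‖ₑ ^ 2 ∂π ≤ ENNReal.ofReal s) :
    ∫ z, ‖f z‖ ^ 2 ∂π ≤ s := by
  rw [integral_eq_lintegral_of_nonneg_ae (Filter.Eventually.of_forall fun z => sq_nonneg _)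
    (hf.norm.pow 2)]
  refine ENNReal.toReal_le_of_le_ofReal hs (le_trans (le_of_eq ?_) h)
  refine lintegral_congr fun z => ?_
  rw [ENNReal.ofReal_pow (norm_nonneg _), ofReal_norm]

theorem _root_.MeasureTheory.MemLp.comp_of_norm_sub_le [IsFiniteMeasure π] {W : Type*}
    [NormedAddCommGroup W] {h : V → W} {L : ℝ} (hL : ∀ x y, ‖h x - h y‖ ≤ L * ‖x - y‖) {f : Z → V}
    (hf : MemLp f 2 π) : MemLp (fun z => h (f z)) 2 π := by
  have hc : Continuous h := by
    refine (LipschitzWith.of_dist_le_mul (K := L.toNNReal) fun x y => ?_).continuous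
    rw [dist_eq_norm, dist_eq_norm]
    exact (hL x y).trans (by gcongr; exact Real.le_coe_toNNReal L)
  have h1 : MemLp (fun z => h (f z) - h 0) 2 π := by
    refine hf.of_le_mul ((hc.comp_aestronglyMeasurable hf.1).sub aestronglyMeasurable_const)
      (c := L) (Filter.Eventually.of_forall fun z => ?_)
    simpa using hL (f z) 0
  have h2 := h1.add (memLp_const (h 0))
  simpa [Pi.add_def] using h2

theorem memLp_fun_const_smul [NormedSpace ℝ V] {f : Z → V} (hf : MemLp f 2 π) (c : ℝ) :
    MemLp (fun z => c • f z) 2 π :=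
  hf.const_smul c

theorem memLp_fun_sum_smul [NormedSpace ℝ V] {ι : Type*} (s : Finset ι) (c : ι → ℝ) {n : ι → Z → V}
    (hn : ∀ p ∈ s, MemLp (n p) 2 π) : MemLp (fun z => ∑ p ∈ s, c p • n p z) 2 π :=
  memLp_finsetSum _ fun p hp => memLp_fun_const_smul (hn p hp) (c p)

/-- Pythagoras for pairwise orthogonal random vectors. -/
theorem integral_norm_sq_sum_smul_le [InnerProductSpace ℝ V] {ι : Type*} (s : Finset ι) {c : ι → ℝ}
    {n : ι → Z → V} {b : ℝ} (hn : ∀ p ∈ s, MemLp (n p) 2 π)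
    (ho : ∀ p ∈ s, ∀ p' ∈ s, p ≠ p' → ∫ z, ⟪n p z, n p' z⟫_ℝ ∂π = 0)
    (hb : ∀ p ∈ s, ∫ z, ‖n p z‖ ^ 2 ∂π ≤ b) :
    ∫ z, ‖∑ p ∈ s, c p • n p z‖ ^ 2 ∂π ≤ b * ∑ p ∈ s, c p ^ 2 := by
  classical
  induction s using Finset.induction_on with
  | empty => simp
  | insert a s ha ih =>
    have hS : MemLp (fun z => ∑ p ∈ s, c p • n p z) 2 π :=
      memLp_fun_sum_smul _ _ fun p hp => hn p (Finset.mem_insert_of_mem hp)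
    have hA := hn a (Finset.mem_insert_self _ _)
    have h0 : ∫ z, ⟪n a z, ∑ p ∈ s, c p • n p z⟫_ℝ ∂π = 0 := by
      simp_rw [inner_sum, real_inner_smul_right]
      rw [integral_finsetSum _ fun p hp =>
        (hA.integrable_inner_two (hn p (Finset.mem_insert_of_mem hp))).const_mul _]
      refine Finset.sum_eq_zero fun p hp => ?_
      rw [integral_const_mul, ho a (Finset.mem_insert_self _ _) p (Finset.mem_insert_of_mem hp)
        (fun h => ha (h ▸ hp)), mul_zero]
    have h1 : ∀ z, ‖∑ p ∈ insert a s, c p • n p z‖ ^ 2 = c a ^ 2 * ‖n a z‖ ^ 2 +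
        2 * c a * ⟪n a z, ∑ p ∈ s, c p • n p z⟫_ℝ + ‖∑ p ∈ s, c p • n p z‖ ^ 2 := fun z => by
      rw [Finset.sum_insert ha, norm_add_sq_real, norm_smul, real_inner_smul_left, mul_pow,
        Real.norm_eq_abs, sq_abs]
      ring
    simp_rw [h1]
    rw [integral_add (f := fun z => c a ^ 2 * ‖n a z‖ ^ 2 +
        2 * c a * ⟪n a z, ∑ p ∈ s, c p • n p z⟫_ℝ) ((hA.integrable_norm_sq.const_mul _).add
        ((hA.integrable_inner_two hS).const_mul _)) hS.integrable_norm_sq,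
      integral_add (hA.integrable_norm_sq.const_mul _) ((hA.integrable_inner_two hS).const_mul _),
      integral_const_mul, integral_const_mul, h0, Finset.sum_insert ha]
    have h2 := ih (fun p hp => hn p (Finset.mem_insert_of_mem hp))
      (fun p hp p' hp' => ho p (Finset.mem_insert_of_mem hp) p' (Finset.mem_insert_of_mem hp'))
      (fun p hp => hb p (Finset.mem_insert_of_mem hp))
    have h3 := mul_le_mul_of_nonneg_left (hb a (Finset.mem_insert_self _ _)) (sq_nonneg (c a))
    linarith

end L2

/-! ### Resampling one coordinate -/

section Resample

variable {Z Ξ V : Type*} [MeasurableSpace Z] [MeasurableSpace Ξ] {π : Measure Z} {D : Measure Ξ}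
  [IsProbabilityMeasure π] [IsProbabilityMeasure D] [NormedAddCommGroup V]
  {τ : Z × Ξ → Z} {s : Z → Ξ} {X : Z → V} {G : Ξ → V → V} {h : V → V} {σ : ℝ}

/-- Since `τ` preserves the law, the integral may be taken over `τ (z, y)`. There `X` does not see
`y`, so the inner integral over `y` is the variance at a fixed point. -/
theorem lintegral_noise_sq_le (hτ : MeasurePreserving τ (π.prod D) π)
    (hs : ∀ z y, s (τ (z, y)) = y) (hX : ∀ z y, X (τ (z, y)) = X z)
    (hm : Measurable fun z => ‖G (s z) (X z) - h (X z)‖ₑ)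
    (hv : ∀ x, ∫⁻ y, ‖G y x - h x‖ₑ ^ 2 ∂D ≤ ENNReal.ofReal (σ ^ 2)) :
    ∫⁻ z, ‖G (s z) (X z) - h (X z)‖ₑ ^ 2 ∂π ≤ ENNReal.ofReal (σ ^ 2) := by
  rw [← hτ.lintegral_comp (hm.pow_const 2), lintegral_prod
    (fun p => ‖G (s (τ p)) (X (τ p)) - h (X (τ p))‖ₑ ^ 2) ((hm.pow_const 2).comp
    hτ.measurable).aemeasurable]
  simp only [hs, hX]
  calc _ ≤ ∫⁻ _z, ENNReal.ofReal (σ ^ 2) ∂π := lintegral_mono fun z => hv _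
    _ = _ := by simp

/-- Replaces the statement that noise has conditional mean zero given the past: after the
substitution by `τ`, both `X` and `Y` are constant in the fresh sample `y`, and integrating the
noise over `y` gives zero. -/
theorem integral_inner_noise_eq_zero [InnerProductSpace ℝ V] [CompleteSpace V] {Y : Z → V}
    (hτ : MeasurePreserving τ (π.prod D) π)
    (hs : ∀ z y, s (τ (z, y)) = y) (hX : ∀ z y, X (τ (z, y)) = X z)
    (hY : ∀ z y, Y (τ (z, y)) = Y z) (hYL : MemLp Y 2 π)
    (hn : MemLp (fun z => G (s z) (X z) - h (X z)) 2 π)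
    (hi : ∀ x, Integrable (fun y => G y x) D) (hG : ∀ x, ∫ y, G y x ∂D = h x) :
    ∫ z, ⟪Y z, G (s z) (X z) - h (X z)⟫_ℝ ∂π = 0 := by
  have hint := hYL.integrable_inner_two hn
  have h1 : ∫ z, ⟪Y z, G (s z) (X z) - h (X z)⟫_ℝ ∂π =
      ∫ p, ⟪Y (τ p), G (s (τ p)) (X (τ p)) - h (X (τ p))⟫_ℝ ∂(π.prod D) := by
    conv_lhs => rw [← hτ.map_eq]
    exact integral_map hτ.aemeasurable (by rw [hτ.map_eq]; exact hint.aestronglyMeasurable)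
  rw [h1, integral_prod (fun p => ⟪Y (τ p), G (s (τ p)) (X (τ p)) - h (X (τ p))⟫_ℝ)
    (hτ.integrable_comp_of_integrable hint)]
  simp only [hs, hX, hY]
  refine integral_eq_zero_of_ae (Filter.Eventually.of_forall fun z => ?_)
  simp only [Pi.zero_apply]
  rw [integral_inner (f := fun y => G y (X z) - h (X z)) ((hi _).sub (integrable_const _)), integral_sub (hi _) (integrable_const _),
    hG]
  simp

end Resample

/-- Unbiased stochastic gradients `G` of variance at most `σ²` for Lipschitz local gradients `h`. -/
structure GradOracle {N d : ℕ} {Ξ : Type*} [MeasurableSpace Ξ] (G : Fin N → Ξ → Vec d → Vec d)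
    (h : Fin N → Vec d → Vec d) (D : Fin N → Measure Ξ) (L σ : ℝ) : Prop where
  measurable : ∀ i, Measurable (fun p : Vec d × Ξ => G i p.2 p.1)
  integral_eq : ∀ i x, ∫ ξ, G i ξ x ∂(D i) = h i x
  variance : ∀ i x, ∫⁻ ξ, ‖G i ξ x - h i x‖ₑ ^ 2 ∂(D i) ≤ ENNReal.ofReal (σ ^ 2)
  lipschitz : ∀ i x y, ‖h i x - h i y‖ ≤ L * ‖x - y‖

/-- `τ r k i (z, y)` replaces the sample `ξ z r k i` by `y` and keeps all others; replacing it by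
an independent sample of `D i` does not change the law. -/
structure Resampling {Z Ξ : Type*} [MeasurableSpace Z] [MeasurableSpace Ξ] {N : ℕ} (π : Measure Z)
    (D : Fin N → Measure Ξ) (R I : ℕ) (ξ : Z → ℕ → ℕ → Fin N → Ξ)
    (τ : ℕ → ℕ → Fin N → Z × Ξ → Z) : Prop where
  measurable : ∀ r k i, Measurable (fun z => ξ z r k i)
  measurePreserving : ∀ r < R, ∀ k < I, ∀ i, MeasurePreserving (τ r k i) (π.prod (D i)) π
  apply_same : ∀ r < R, ∀ k < I, ∀ i z y, ξ (τ r k i (z, y)) r k i = y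
  apply_other : ∀ r < R, ∀ k < I, ∀ i r' k' i', (r', k', i') ≠ (r, k, i) → ∀ z y,
    ξ (τ r k i (z, y)) r' k' i' = ξ z r' k' i'

/-- A square-integrable server state that depends only on the samples before round `r₀`. -/
structure AdaptedState {Z Ξ : Type*} [MeasurableSpace Z] {N d : ℕ} (π : Measure Z)
    (R I : ℕ) (τ : ℕ → ℕ → Fin N → Z × Ξ → Z) (r₀ : ℕ) (T : Z → ServerState N d) : Prop where
  measurable_model : Measurable fun z => (T z).model
  measurable_control : ∀ i, Measurable fun z => (T z).control i
  memLp_model : MemLp (fun z => (T z).model) 2 π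
  memLp_control : ∀ i, MemLp (fun z => (T z).control i) 2 π
  invariant : ∀ r, r₀ ≤ r → r < R → ∀ k < I, ∀ i z y, T (τ r k i (z, y)) = T z

/-! ### Gradient noise within a window: centred, uncorrelated, square-integrable -/

section Noise

set_option linter.unusedSectionVars false

variable {Z Ξ : Type*} [MeasurableSpace Z] [MeasurableSpace Ξ] {N d : ℕ} {π : Measure Z}
  [IsProbabilityMeasure π] {D : Fin N → Measure Ξ} [∀ i, IsProbabilityMeasure (D i)]
  {P R I r₀ : ℕ} {ξ : Z → ℕ → ℕ → Fin N → Ξ} {τ : ℕ → ℕ → Fin N → Z × Ξ → Z}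
  {G : Fin N → Ξ → Vec d → Vec d} {h : Fin N → Vec d → Vec d} {L σ η γ : ℝ}
  {q : ℕ → Fin N → ℝ} {T : Z → ServerState N d}

/-- The stochastic gradients computed with the samples `ξ`. -/
def sampleGrad (G : Fin N → Ξ → Vec d → Vec d) (ξ : ℕ → ℕ → Fin N → Ξ) :
    Fin N → ℕ → ℕ → Vec d → Vec d :=
  fun i r k => G i (ξ r k i)

theorem GradOracle.integrable (hG : GradOracle G h D L σ) (i : Fin N) (x : Vec d) :
    Integrable (fun y => G i y x) (D i) :=
  integrable_of_lintegral_sub_const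
    ((hG.measurable i).comp (measurable_const.prodMk measurable_id)).aestronglyMeasurable
    (hG.variance i x)

theorem GradOracle.continuous (hG : GradOracle G h D L σ) (i : Fin N) : Continuous (h i) := by
  refine (LipschitzWith.of_dist_le_mul (K := L.toNNReal) fun x y => ?_).continuous
  rw [dist_eq_norm, dist_eq_norm]
  exact (hG.lipschitz i x y).trans (by gcongr; exact Real.le_coe_toNNReal L)

theorem measurable_sampleGrad (hG : GradOracle G h D L σ) (hξ : Resampling π D R I ξ τ)
    (i : Fin N) (r k : ℕ) : Measurable fun p : Z × Vec d => sampleGrad G (ξ p.1) i r k p.2 :=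
  (hG.measurable i).comp (measurable_snd.prodMk ((hξ.measurable r k i).comp measurable_fst))

theorem measurable_windowIter (hG : GradOracle G h D L σ) (hξ : Resampling π D R I ξ τ)
    (hT : AdaptedState π R I τ r₀ T) (j : ℕ) (i : Fin N) (k : ℕ) :
    Measurable fun z => windowIter η I (sampleGrad G (ξ z)) q (T z) r₀ j i k :=
  measurable_clientIter (g := fun z => sampleGrad G (ξ z))
    (fun k => measurable_sampleGrad hG hξ i _ k) hT.measurable_control
    (measurable_windowModel (g := fun z => sampleGrad G (ξ z)) (q := fun _ => q)
      (measurable_sampleGrad hG hξ) (fun _ _ => measurable_const)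
      hT.measurable_model hT.measurable_control r₀ j) k

theorem measurable_windowGrad (hG : GradOracle G h D L σ) (hξ : Resampling π D R I ξ τ)
    (hT : AdaptedState π R I τ r₀ T) (j : ℕ) (i : Fin N) (k : ℕ) :
    Measurable fun z => windowGrad η I (sampleGrad G (ξ z)) q (T z) r₀ j i k :=
  (measurable_sampleGrad hG hξ i _ k).comp
    (measurable_id.prodMk (measurable_windowIter hG hξ hT j i k))

theorem measurable_windowNoise (hG : GradOracle G h D L σ) (hξ : Resampling π D R I ξ τ)
    (hT : AdaptedState π R I τ r₀ T) (j : ℕ) (i : Fin N) (k : ℕ) :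
    Measurable fun z => windowNoise η I (sampleGrad G (ξ z)) h q (T z) r₀ j i k :=
  (measurable_windowGrad hG hξ hT j i k).sub
    ((hG.continuous i).measurable.comp (measurable_windowIter hG hξ hT j i k))

/-- The iterate before step `k` uses only samples of earlier rounds and of steps before `k` in its
own round. Hence a sample of the very same round and step, of any client, may be resampled too, as
the non-strict `k ≤ k'` allows. -/
theorem windowIter_invariant (hξ : Resampling π D R I ξ τ) (hT : AdaptedState π R I τ r₀ T)
    {j k r' k' : ℕ} {i i' : Fin N} (hr' : r' < R) (hk' : k' < I)
    (hlt : r₀ + j < r' ∨ r₀ + j = r' ∧ k ≤ k') (z : Z) (y : Ξ) :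
    windowIter η I (sampleGrad G (ξ (τ r' k' i' (z, y)))) q (T (τ r' k' i' (z, y))) r₀ j i k =
      windowIter η I (sampleGrad G (ξ z)) q (T z) r₀ j i k := by
  rw [hT.invariant r' (by lia) hr' k' hk']
  have hg : ∀ i r k, (r < r' ∨ r = r' ∧ k < k') →
      sampleGrad G (ξ (τ r' k' i' (z, y))) i r k = sampleGrad G (ξ z) i r k := by
    intro i r k hrk
    unfold sampleGrad
    rw [hξ.apply_other r' hr' k' hk']
    rintro ⟨⟩
    lia
  rw [windowIter, windowIter, windowModel_congr (fun i r h1 h2 k hk => hg i r k (by lia))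
    (fun _ _ _ => rfl), clientIter, clientIter,
    localIter_congr fun k'' hk'' => hg i _ _ (by lia)]

/-- Beyond what the iterate uses, the noise involves exactly one more sample, its own; `hne`
excludes it. -/
theorem windowNoise_invariant (hξ : Resampling π D R I ξ τ) (hT : AdaptedState π R I τ r₀ T)
    {j k r' k' : ℕ} {i i' : Fin N} (hr' : r' < R) (hk' : k' < I)
    (hlt : r₀ + j < r' ∨ r₀ + j = r' ∧ k ≤ k') (hne : (r₀ + j, k, i) ≠ (r', k', i'))
    (z : Z) (y : Ξ) :
    windowNoise η I (sampleGrad G (ξ (τ r' k' i' (z, y)))) h q (T (τ r' k' i' (z, y))) r₀ j i k =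
      windowNoise η I (sampleGrad G (ξ z)) h q (T z) r₀ j i k := by
  rw [windowNoise, windowNoise, windowGrad, windowGrad, windowIter_invariant hξ hT hr' hk' hlt]
  unfold sampleGrad
  rw [hξ.apply_other r' hr' k' hk' _ _ _ _ hne]

theorem lintegral_windowNoise_sq_le (hG : GradOracle G h D L σ) (hξ : Resampling π D R I ξ τ)
    (hT : AdaptedState π R I τ r₀ T) {j k : ℕ} (hj : r₀ + j < R) (hk : k < I) (i : Fin N) :
    ∫⁻ z, ‖windowNoise η I (sampleGrad G (ξ z)) h q (T z) r₀ j i k‖ₑ ^ 2 ∂π ≤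
      ENNReal.ofReal (σ ^ 2) :=
  lintegral_noise_sq_le (G := G i) (h := h i) (hξ.measurePreserving _ hj _ hk i)
    (hξ.apply_same _ hj _ hk i)
    (windowIter_invariant hξ hT hj hk (Or.inr ⟨rfl, le_rfl⟩))
    (measurable_windowNoise hG hξ hT j i k).enorm (hG.variance i)

theorem memLp_windowNoise (hG : GradOracle G h D L σ) (hξ : Resampling π D R I ξ τ)
    (hT : AdaptedState π R I τ r₀ T) {j k : ℕ} (hj : r₀ + j < R) (hk : k < I) (i : Fin N) :
    MemLp (fun z => windowNoise η I (sampleGrad G (ξ z)) h q (T z) r₀ j i k) 2 π :=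
  (memLp_two_iff_lintegral_lt_top
    (measurable_windowNoise hG hξ hT j i k).aestronglyMeasurable).2
    ((lintegral_windowNoise_sq_le hG hξ hT hj hk i).trans_lt ENNReal.ofReal_lt_top)

theorem integral_windowNoise_sq_le (hG : GradOracle G h D L σ) (hξ : Resampling π D R I ξ τ)
    (hT : AdaptedState π R I τ r₀ T) {j k : ℕ} (hj : r₀ + j < R) (hk : k < I) (i : Fin N) :
    ∫ z, ‖windowNoise η I (sampleGrad G (ξ z)) h q (T z) r₀ j i k‖ ^ 2 ∂π ≤ σ ^ 2 :=
  integral_norm_sq_le_of_lintegral (sq_nonneg σ)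
    (measurable_windowNoise hG hξ hT j i k).aestronglyMeasurable
    (lintegral_windowNoise_sq_le hG hξ hT hj hk i)

theorem integral_inner_windowNoise (hG : GradOracle G h D L σ) (hξ : Resampling π D R I ξ τ)
    (hT : AdaptedState π R I τ r₀ T) {j k : ℕ} (hj : r₀ + j < R) (hk : k < I) (i : Fin N)
    {Y : Z → Vec d} (hY : MemLp Y 2 π) (hYτ : ∀ z y, Y (τ (r₀ + j) k i (z, y)) = Y z) :
    ∫ z, ⟪Y z, windowNoise η I (sampleGrad G (ξ z)) h q (T z) r₀ j i k⟫_ℝ ∂π = 0 :=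
  integral_inner_noise_eq_zero (G := G i) (h := h i) (hξ.measurePreserving _ hj _ hk i)
    (hξ.apply_same _ hj _ hk i)
    (windowIter_invariant hξ hT hj hk (Or.inr ⟨rfl, le_rfl⟩)) hYτ hY
    (memLp_windowNoise hG hξ hT hj hk i) (hG.integrable i) (hG.integral_eq i)

/-- Of two different noise terms, resample the one that is not earlier in the order by round and
step. The other is then unchanged, also when both belong to the same step of different clients. -/
theorem integral_inner_windowNoise_windowNoise (hG : GradOracle G h D L σ)
    (hξ : Resampling π D R I ξ τ) (hT : AdaptedState π R I τ r₀ T) {j k j' k' : ℕ} {i i' : Fin N}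
    (hj : r₀ + j < R) (hk : k < I) (hj' : r₀ + j' < R) (hk' : k' < I)
    (hne : (j, i, k) ≠ (j', i', k')) :
    ∫ z, ⟪windowNoise η I (sampleGrad G (ξ z)) h q (T z) r₀ j i k,
      windowNoise η I (sampleGrad G (ξ z)) h q (T z) r₀ j' i' k'⟫_ℝ ∂π = 0 := by
  have hne' : (r₀ + j, k, i) ≠ (r₀ + j', k', i') := by
    rintro h0
    simp only [Prod.mk.injEq, add_right_inj] at h0
    exact hne (by rw [h0.1, h0.2.1, h0.2.2])
  rcases (by lia : (r₀ + j < r₀ + j' ∨ r₀ + j = r₀ + j' ∧ k ≤ k') ∨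
      (r₀ + j' < r₀ + j ∨ r₀ + j' = r₀ + j ∧ k' ≤ k)) with hlt | hlt
  · exact integral_inner_windowNoise hG hξ hT hj' hk' i' (memLp_windowNoise hG hξ hT hj hk i)
      (windowNoise_invariant hξ hT hj' hk' hlt hne')
  · refine (integral_congr_ae (Filter.Eventually.of_forall fun z => real_inner_comm _ _)).trans ?_
    exact integral_inner_windowNoise hG hξ hT hj hk i (memLp_windowNoise hG hξ hT hj' hk' i')
      (windowNoise_invariant hξ hT hj hk hlt hne'.symm)

/-- The noise is in `L²` by the variance bound alone, and the mean gradient is a Lipschitz function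
of the iterate. This is what carries square integrability through the recursion. -/
theorem memLp_windowGrad_of_windowIter (hG : GradOracle G h D L σ) (hξ : Resampling π D R I ξ τ)
    (hT : AdaptedState π R I τ r₀ T) {j k : ℕ} (hj : r₀ + j < R) (hk : k < I) (i : Fin N)
    (hi : MemLp (fun z => windowIter η I (sampleGrad G (ξ z)) q (T z) r₀ j i k) 2 π) :
    MemLp (fun z => windowGrad η I (sampleGrad G (ξ z)) q (T z) r₀ j i k) 2 π := by
  have := (memLp_windowNoise (η := η) (q := q) hG hξ hT hj hk i).add
    (hi.comp_of_norm_sub_le (hG.lipschitz i))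
  simpa only [windowNoise, Pi.add_def, sub_add_cancel] using this

theorem memLp_avgControl (hT : AdaptedState π R I τ r₀ T) :
    MemLp (fun z => (T z).avgControl) 2 π :=
  memLp_fun_const_smul (f := fun z => ∑ i, (T z).control i)
    (memLp_finsetSum _ fun i _ => hT.memLp_control i) (1 / (N : ℝ))

theorem memLp_windowIter_of_windowModel (hG : GradOracle G h D L σ) (hξ : Resampling π D R I ξ τ)
    (hT : AdaptedState π R I τ r₀ T) {j : ℕ} (hj : r₀ + j < R)
    (hX : MemLp (fun z => windowModel η I (sampleGrad G (ξ z)) q (T z) r₀ j) 2 π) (i : Fin N)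
    {k : ℕ} (hk : k ≤ I) :
    MemLp (fun z => windowIter η I (sampleGrad G (ξ z)) q (T z) r₀ j i k) 2 π := by
  induction k with
  | zero => exact hX
  | succ k ih =>
    have h1 := ih (by lia)
    exact h1.sub (memLp_fun_const_smul (((memLp_windowGrad_of_windowIter hG hξ hT hj (by lia) i h1).sub
      (hT.memLp_control i)).add (memLp_avgControl hT)) η)

theorem memLp_windowModel (hG : GradOracle G h D L σ) (hξ : Resampling π D R I ξ τ)
    (hT : AdaptedState π R I τ r₀ T) {j : ℕ} (hj : r₀ + j ≤ R) :
    MemLp (fun z => windowModel η I (sampleGrad G (ξ z)) q (T z) r₀ j) 2 π := by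
  induction j with
  | zero => exact hT.memLp_model
  | succ j ih =>
    have h1 := ih (by lia)
    exact h1.add (memLp_fun_sum_smul _ (fun i => q (r₀ + j) i) fun i _ =>
      (memLp_windowIter_of_windowModel hG hξ hT (by lia) h1 i le_rfl).sub h1)

theorem memLp_windowIter (hG : GradOracle G h D L σ) (hξ : Resampling π D R I ξ τ)
    (hT : AdaptedState π R I τ r₀ T) {j : ℕ} (hj : r₀ + j < R) (i : Fin N) {k : ℕ} (hk : k ≤ I) :
    MemLp (fun z => windowIter η I (sampleGrad G (ξ z)) q (T z) r₀ j i k) 2 π :=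
  memLp_windowIter_of_windowModel hG hξ hT hj (memLp_windowModel hG hξ hT hj.le) i hk

theorem memLp_windowGrad (hG : GradOracle G h D L σ) (hξ : Resampling π D R I ξ τ)
    (hT : AdaptedState π R I τ r₀ T) {j : ℕ} (hj : r₀ + j < R) (i : Fin N) {k : ℕ} (hk : k < I) :
    MemLp (fun z => windowGrad η I (sampleGrad G (ξ z)) q (T z) r₀ j i k) 2 π :=
  memLp_windowGrad_of_windowIter hG hξ hT hj hk i (memLp_windowIter hG hξ hT hj i hk.le)

theorem AdaptedState.windowStep (hG : GradOracle G h D L σ) (hξ : Resampling π D R I ξ τ)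
    (hT : AdaptedState π R I τ r₀ T) (hR : r₀ + P ≤ R) :
    AdaptedState π R I τ (r₀ + P)
      (fun z => windowStep η γ P I (sampleGrad G (ξ z)) q r₀ (T z)) where
  measurable_model := (measurable_windowStep (g := fun z => sampleGrad G (ξ z))
    (q := fun _ => q) (measurable_sampleGrad hG hξ)
    (fun _ _ => measurable_const) hT.measurable_model hT.measurable_control r₀).1
  measurable_control := (measurable_windowStep (g := fun z => sampleGrad G (ξ z))
    (q := fun _ => q) (measurable_sampleGrad hG hξ)
    (fun _ _ => measurable_const) hT.measurable_model hT.measurable_control r₀).2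
  memLp_model := by
    refine hT.memLp_model.add (memLp_fun_const_smul (f := fun z => ∑ j ∈ range P,
      roundUpdate η I (sampleGrad G (ξ z)) q (T z) (r₀ + j)
        (windowModel η I (sampleGrad G (ξ z)) q (T z) r₀ j)) (memLp_finsetSum _ fun j hj => ?_) γ)
    have hj := Finset.mem_range.1 hj
    exact memLp_fun_sum_smul _ (fun i => q (r₀ + j) i) fun i _ =>
      (memLp_windowIter hG hξ hT (by lia) i le_rfl).sub (memLp_windowModel hG hξ hT (by lia))
  memLp_control i := by
    by_cases hq : 0 < qBar P q r₀ i
    · simp only [AmpScaffold.windowStep, if_pos hq]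
      refine memLp_fun_const_smul (memLp_fun_sum_smul _ (fun j => q (r₀ + j) i)
        (n := fun j z => ∑ k ∈ range I, windowGrad η I (sampleGrad G (ξ z)) q (T z) r₀ j i k)
        fun j hj => memLp_finsetSum _ fun k hk => ?_) (1 / ((P : ℝ) * qBar P q r₀ i * (I : ℝ)))
      exact memLp_windowGrad hG hξ hT (by have := Finset.mem_range.1 hj; lia) i
        (Finset.mem_range.1 hk)
    · simp only [AmpScaffold.windowStep, if_neg hq]
      exact hT.memLp_control i
  invariant r hr hrR k hk i z y := by
    rw [hT.invariant r (by lia) hrR k hk]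
    refine windowStep_congr (fun i' r' _ h2 k' _ => ?_) fun _ _ _ => rfl
    unfold sampleGrad
    rw [hξ.apply_other r hrR k hk]
    rintro ⟨⟩
    lia

theorem adaptedState_serverState (hG : GradOracle G h D L σ) (hξ : Resampling π D R I ξ τ)
    (hT : AdaptedState π R I τ 0 T) {m : ℕ} (hR : m * P ≤ R) :
    AdaptedState π R I τ (m * P)
      (fun z => serverState η γ P I (sampleGrad G (ξ z)) q (T z) m) := by
  induction m with
  | zero => simpa [serverState] using hT
  | succ m ih =>
    rw [Nat.succ_mul] at hR ⊢
    exact (ih (by lia)).windowStep hG hξ hR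

end Noise

/-! ### Pathwise estimates for one window -/

/-- The weights in the window from `r₀` are those of regularized participation, and their squares
sum to at most `ρ²` in each round. -/
structure RegularWindow {N : ℕ} (P : ℕ) (ρ : ℝ) (q : ℕ → Fin N → ℝ) (r₀ : ℕ) : Prop where
  nonneg : ∀ j < P, ∀ i, 0 ≤ q (r₀ + j) i
  sum_eq_one : ∀ j < P, ∑ i, q (r₀ + j) i = 1
  sum_sq_le : ∀ j < P, ∑ i, q (r₀ + j) i ^ 2 ≤ ρ ^ 2
  qBar_eq : ∀ i, qBar P q r₀ i = 1 / (N : ℝ)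

/-- The triples (round in the window, client, local step). -/
def windowIdx (N P I : ℕ) : Finset (ℕ × Fin N × ℕ) := range P ×ˢ univ ×ˢ range I

/-- The weight `q^i_{r₀ + j} / (P I)` of the stochastic gradient `(j, i, k)` in a window. -/
noncomputable def windowWeight {N : ℕ} (P I : ℕ) (q : ℕ → Fin N → ℝ) (r₀ : ℕ) (p : ℕ × Fin N × ℕ) :
    ℝ :=
  q (r₀ + p.1) p.2.1 / (P * I)

/-- `∇f = (1/N) ∑_i ∇f_i`. -/
noncomputable def meanGrad {N d : ℕ} (h : Fin N → Vec d → Vec d) (x : Vec d) : Vec d :=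
  (1 / (N : ℝ)) • ∑ i, h i x

/-- The mean squared error of the control variates. -/
noncomputable def controlError {N d : ℕ} (h : Fin N → Vec d → Vec d) (S : ServerState N d) : ℝ :=
  (1 / (N : ℝ)) * ∑ i, ‖S.control i - h i S.model‖ ^ 2

/-- The weighted mean squared distance of the local iterates to the model at the start. -/
noncomputable def windowDrift {N d : ℕ} (η : ℝ) (P I : ℕ) (g : Fin N → ℕ → ℕ → Vec d → Vec d)
    (q : ℕ → Fin N → ℝ) (S : ServerState N d) (r₀ : ℕ) : ℝ :=
  ∑ p ∈ windowIdx N P I, windowWeight P I q r₀ p *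
    ‖windowIter η I g q S r₀ p.1 p.2.1 p.2.2 - S.model‖ ^ 2

/-- The weighted mean of the squared gradient noise. -/
noncomputable def windowNoiseSq {N d : ℕ} (η : ℝ) (P I : ℕ) (g : Fin N → ℕ → ℕ → Vec d → Vec d)
    (h : Fin N → Vec d → Vec d) (q : ℕ → Fin N → ℝ) (S : ServerState N d) (r₀ : ℕ) : ℝ :=
  ∑ p ∈ windowIdx N P I, windowWeight P I q r₀ p *
    ‖windowNoise η I g h q S r₀ p.1 p.2.1 p.2.2‖ ^ 2

/-- The weighted mean of the gradient noise. -/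
noncomputable def windowNoiseMean {N d : ℕ} (η : ℝ) (P I : ℕ) (g : Fin N → ℕ → ℕ → Vec d → Vec d)
    (h : Fin N → Vec d → Vec d) (q : ℕ → Fin N → ℝ) (S : ServerState N d) (r₀ : ℕ) : Vec d :=
  ∑ p ∈ windowIdx N P I, windowWeight P I q r₀ p • windowNoise η I g h q S r₀ p.1 p.2.1 p.2.2

/-- The weighted mean of the stochastic gradients. -/
noncomputable def windowGradMean {N d : ℕ} (η : ℝ) (P I : ℕ) (g : Fin N → ℕ → ℕ → Vec d → Vec d)
    (q : ℕ → Fin N → ℝ) (S : ServerState N d) (r₀ : ℕ) : Vec d :=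
  ∑ p ∈ windowIdx N P I, windowWeight P I q r₀ p • windowGrad η I g q S r₀ p.1 p.2.1 p.2.2

theorem norm_add_three_sq_le {V : Type*} [NormedAddCommGroup V] (a b c : V) :
    ‖a + b + c‖ ^ 2 ≤ 3 * (‖a‖ ^ 2 + ‖b‖ ^ 2 + ‖c‖ ^ 2) := by
  have h : ‖a + b + c‖ ≤ ‖a‖ + ‖b‖ + ‖c‖ := norm_add₃_le
  calc ‖a + b + c‖ ^ 2 ≤ (‖a‖ + ‖b‖ + ‖c‖) ^ 2 := by gcongr
    _ ≤ _ := by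
      nlinarith [sq_nonneg (‖a‖ - ‖b‖), sq_nonneg (‖b‖ - ‖c‖), sq_nonneg (‖a‖ - ‖c‖)]

section Pathwise

variable {N d : ℕ} {η γ ρ L : ℝ} {P I : ℕ} {g : Fin N → ℕ → ℕ → Vec d → Vec d}
  {h : Fin N → Vec d → Vec d} {q : ℕ → Fin N → ℝ} {S : ServerState N d} {r₀ : ℕ}

theorem windowWeight_nonneg (hq : RegularWindow P ρ q r₀) {p : ℕ × Fin N × ℕ}
    (hp : p ∈ windowIdx N P I) : 0 ≤ windowWeight P I q r₀ p :=
  div_nonneg (hq.nonneg _ (Finset.mem_range.1 (Finset.mem_product.1 hp).1) _) (by positivity)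

theorem sum_windowWeight_smul {V : Type*} [AddCommGroup V] [Module ℝ V]
    (v : ℕ → Fin N → ℕ → V) :
    ∑ p ∈ windowIdx N P I, windowWeight P I q r₀ p • v p.1 p.2.1 p.2.2 =
      (1 / ((P : ℝ) * I)) • ∑ j ∈ range P, ∑ i, q (r₀ + j) i • ∑ k ∈ range I, v j i k := by
  simp only [windowIdx, windowWeight, Finset.sum_product, Finset.smul_sum, smul_smul]
  refine Finset.sum_congr rfl fun j _ => Finset.sum_congr rfl fun i _ =>
    Finset.sum_congr rfl fun k _ => ?_
  congr 1
  ring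

/-- The place where regularity acts on averages: the window weights of each client sum to `1 / N`,
so quantities depending only on the client are averaged uniformly. -/
theorem sum_windowWeight_smul_client {V : Type*} [AddCommGroup V] [Module ℝ V] (hP : 0 < P)
    (hI : 0 < I) (hq : RegularWindow P ρ q r₀) (v : Fin N → V) :
    ∑ p ∈ windowIdx N P I, windowWeight P I q r₀ p • v p.2.1 = (1 / (N : ℝ)) • ∑ i, v i := by
  rw [sum_windowWeight_smul (v := fun _ i _ => v i), Finset.sum_comm]
  simp_rw [← Finset.sum_smul, sum_weights_of_qBar hP (hq.qBar_eq _), Finset.sum_const,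
    Finset.card_range, ← Nat.cast_smul_eq_nsmul ℝ, Finset.smul_sum, smul_smul]
  refine Finset.sum_congr rfl fun i _ => ?_
  congr 1
  have : (P : ℝ) ≠ 0 := by positivity
  have : (I : ℝ) ≠ 0 := by positivity
  field_simp

theorem sum_windowWeight (hP : 0 < P) (hI : 0 < I) (hN : 0 < N) (hq : RegularWindow P ρ q r₀) :
    ∑ p ∈ windowIdx N P I, windowWeight P I q r₀ p = 1 := by
  have h1 := sum_windowWeight_smul_client hP hI hq (fun _ => (1 : ℝ))
  have : (N : ℝ) ≠ 0 := by positivity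
  simpa [this] using h1

/-- Source of the variance reduction: each of the `I` local steps repeats the weights `q / (P I)`,
so the sum is `I / (P I)²` times at most `P ρ²`. -/
theorem sum_windowWeight_sq_le (hP : 0 < P) (hI : 0 < I) (hq : RegularWindow P ρ q r₀) :
    ∑ p ∈ windowIdx N P I, windowWeight P I q r₀ p ^ 2 ≤ ρ ^ 2 / (P * I) := by
  have hP' : (0 : ℝ) < P := by positivity
  have hI' : (0 : ℝ) < I := by positivity
  have h1 : ∑ p ∈ windowIdx N P I, windowWeight P I q r₀ p ^ 2 =
      (I / ((P : ℝ) * I) ^ 2) * ∑ j ∈ range P, ∑ i, q (r₀ + j) i ^ 2 := by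
    simp only [windowIdx, windowWeight, Finset.sum_product, Finset.mul_sum, Finset.sum_const,
      Finset.card_range, nsmul_eq_mul]
    refine Finset.sum_congr rfl fun j _ => Finset.sum_congr rfl fun i _ => ?_
    ring
  have h2 : ∑ j ∈ range P, ∑ i, q (r₀ + j) i ^ 2 ≤ P * ρ ^ 2 := by
    calc _ ≤ ∑ _j ∈ range P, ρ ^ 2 :=
          Finset.sum_le_sum fun j hj => hq.sum_sq_le j (Finset.mem_range.1 hj)
      _ = _ := by simp
  calc _ ≤ (I / ((P : ℝ) * I) ^ 2) * (P * ρ ^ 2) := by rw [h1]; gcongr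
    _ = _ := by field_simp

theorem windowStep_model_eq (hP : 0 < P) (hI : 0 < I) (hN : 0 < N) (hq : RegularWindow P ρ q r₀) :
    (windowStep η γ P I g q r₀ S).model =
      S.model - (γ * η * P * I) • windowGradMean η P I g q S r₀ := by
  have : (P : ℝ) ≠ 0 := by positivity
  have : (I : ℝ) ≠ 0 := by positivity
  rw [windowStep_model hP hN hq.qBar_eq, windowGradMean,
    sum_windowWeight_smul (v := fun j i k => windowGrad η I g q S r₀ j i k), smul_smul]
  congr 2
  field_simp

/-- By regularity `∇f` at the start is the average of the local gradients there with the same window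
weights. What is left is a weighted mean of differences of local gradients, to which Jensen and the
Lipschitz bound apply. -/
theorem norm_windowGradMean_sub_le (hP : 0 < P) (hI : 0 < I) (hN : 0 < N)
    (hL : ∀ i x y, ‖h i x - h i y‖ ≤ L * ‖x - y‖)
    (hq : RegularWindow P ρ q r₀) :
    ‖windowGradMean η P I g q S r₀ - meanGrad h S.model - windowNoiseMean η P I g h q S r₀‖ ^ 2 ≤
      L ^ 2 * windowDrift η P I g q S r₀ := by
  have h1 : windowGradMean η P I g q S r₀ - meanGrad h S.model -
      windowNoiseMean η P I g h q S r₀ = ∑ p ∈ windowIdx N P I, windowWeight P I q r₀ p •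
        (h p.2.1 (windowIter η I g q S r₀ p.1 p.2.1 p.2.2) - h p.2.1 S.model) := by
    rw [meanGrad, ← sum_windowWeight_smul_client hP hI hq, windowGradMean, windowNoiseMean,
      ← Finset.sum_sub_distrib, ← Finset.sum_sub_distrib]
    refine Finset.sum_congr rfl fun p _ => ?_
    rw [← smul_sub, ← smul_sub, windowNoise]
    congr 1
    abel
  rw [h1]
  refine (norm_sum_smul_sq_le _ fun p hp => windowWeight_nonneg hq hp).trans ?_
  rw [sum_windowWeight hP hI hN hq, one_mul, windowDrift, Finset.mul_sum]
  refine Finset.sum_le_sum fun p hp => ?_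
  have hw := windowWeight_nonneg hq hp
  calc _ ≤ windowWeight P I q r₀ p *
        (L * ‖windowIter η I g q S r₀ p.1 p.2.1 p.2.2 - S.model‖) ^ 2 := by
        gcongr
        exact hL _ _ _
    _ = _ := by ring

/-- A local direction is noise, plus a gradient difference controlled by the drift itself, plus
`(∇f_i - G^i) + (G - ∇f) + ∇f`. The control variates replace the heterogeneity `∇f_i - ∇f` by their
own error. -/
theorem windowDrift_le (hP : 0 < P) (hI : 0 < I) (hN : 0 < N)
    (hL : ∀ i x y, ‖h i x - h i y‖ ≤ L * ‖x - y‖) (hL0 : 0 ≤ L) (hη : 0 ≤ η)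
    (hηL : 4 * η * P * I * L ≤ 1) (hq : RegularWindow P ρ q r₀) :
    windowDrift η P I g q S r₀ ≤ 216 * (η * P * I) ^ 2 *
      (windowNoiseSq η P I g h q S r₀ + controlError h S + ‖meanGrad h S.model‖ ^ 2) := by
  have hP' : (0 : ℝ) < P := by positivity
  have hI' : (0 : ℝ) < I := by positivity
  have hN' : (0 : ℝ) < N := by positivity
  set x := S.model with hx
  set β : Fin N → ℝ := fun i =>
    ‖h i x - S.control i‖ + ‖S.avgControl - meanGrad h x‖ + ‖meanGrad h x‖ with hβ
  set n := fun j i k => windowNoise η I g h q S r₀ j i k with hn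
  have hβ0 : ∀ i, 0 ≤ β i := fun i => by positivity
  have hdr := sum_sq_drift_le (q := fun j i => q (r₀ + j) i)
    (X := windowModel η I g q S r₀) (y := windowIter η I g q S r₀)
    (u := fun j i k => windowGrad η I g q S r₀ j i k - S.control i + S.avgControl)
    (ν := fun j i k => ‖n j i k‖) (β := β) hP hη hL0 hηL hq.nonneg hq.sum_eq_one
    (fun _ _ _ => norm_nonneg _) hβ0 (fun _ _ => rfl) (fun _ _ _ => rfl) (fun _ => rfl) ?_
  · have hV : ∀ j i, (∑ k ∈ range I, ‖n j i k‖ + I * β i) ^ 2 ≤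
        2 * I * ∑ k ∈ range I, ‖n j i k‖ ^ 2 + 2 * I * ∑ _k ∈ range I, β i ^ 2 := by
      intro j i
      have h1 : (∑ k ∈ range I, ‖n j i k‖) ^ 2 ≤ I * ∑ k ∈ range I, ‖n j i k‖ ^ 2 := by
        simpa using sq_sum_le_card_mul_sum_sq (s := range I) (f := fun k => ‖n j i k‖)
      have h2 : (∑ k ∈ range I, ‖n j i k‖ + I * β i) ^ 2 ≤
        2 * ((∑ k ∈ range I, ‖n j i k‖) ^ 2 + (I * β i) ^ 2) := add_sq_le
      simp only [Finset.sum_const, Finset.card_range, nsmul_eq_mul]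
      linarith
    have hV' : ∑ j ∈ range P, ∑ i, q (r₀ + j) i * (∑ k ∈ range I, ‖n j i k‖ + I * β i) ^ 2 ≤
        2 * I * (P * I) * (windowNoiseSq η P I g h q S r₀ + 1 / (N : ℝ) * ∑ i, β i ^ 2) := by
      have e1 := sum_windowWeight_smul (P := P) (I := I) (q := q) (r₀ := r₀)
        (v := fun j i k => ‖n j i k‖ ^ 2)
      have e2 := sum_windowWeight_smul (P := P) (I := I) (q := q) (r₀ := r₀)
        (v := fun _ i _ => β i ^ 2)
      rw [sum_windowWeight_smul_client hP hI hq (fun i => β i ^ 2)] at e2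
      simp only [smul_eq_mul] at e1 e2
      rw [windowNoiseSq, e1, e2]
      calc _ ≤ ∑ j ∈ range P, ∑ i, q (r₀ + j) i *
            (2 * I * ∑ k ∈ range I, ‖n j i k‖ ^ 2 + 2 * I * ∑ _k ∈ range I, β i ^ 2) :=
            Finset.sum_le_sum fun j hj => Finset.sum_le_sum fun i _ =>
              mul_le_mul_of_nonneg_left (hV j i) (hq.nonneg j (Finset.mem_range.1 hj) i)
        _ = 2 * I * ((∑ j ∈ range P, ∑ i, q (r₀ + j) i * ∑ k ∈ range I, ‖n j i k‖ ^ 2) +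
              ∑ j ∈ range P, ∑ i, q (r₀ + j) i * ∑ _k ∈ range I, β i ^ 2) := by
            rw [← Finset.sum_add_distrib, Finset.mul_sum]
            refine Finset.sum_congr rfl fun j _ => ?_
            rw [← Finset.sum_add_distrib, Finset.mul_sum]
            refine Finset.sum_congr rfl fun i _ => ?_
            ring
        _ = _ := by field_simp
    -- Jensen: the error of the average is at most the average error.
    have hc : ‖S.avgControl - meanGrad h x‖ ^ 2 ≤ controlError h S := by
      have h1 : S.avgControl - meanGrad h x = ∑ i, (1 / (N : ℝ)) • (S.control i - h i x) := by
        rw [ServerState.avgControl, meanGrad, ← smul_sub, ← Finset.sum_sub_distrib,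
          Finset.smul_sum]
      rw [h1]
      refine (norm_sum_smul_sq_le univ fun i _ => by positivity).trans (le_of_eq ?_)
      rw [controlError, ← Finset.mul_sum]
      simp [hN'.ne', hx]
    have hβs : 1 / (N : ℝ) * ∑ i, β i ^ 2 ≤
        6 * controlError h S + 3 * ‖meanGrad h x‖ ^ 2 := by
      calc 1 / (N : ℝ) * ∑ i, β i ^ 2 ≤ 1 / (N : ℝ) * ∑ i, (3 * ‖S.control i - h i x‖ ^ 2 +
            3 * (controlError h S + ‖meanGrad h x‖ ^ 2)) := by
            gcongr with i
            rw [norm_sub_rev (S.control i)]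
            simp only [hβ]
            set a := ‖h i x - S.control i‖
            set b := ‖S.avgControl - meanGrad h x‖
            set c := ‖meanGrad h x‖
            nlinarith [sq_nonneg (a - b), sq_nonneg (b - c), sq_nonneg (a - c)]
        _ = _ := by
            rw [Finset.sum_add_distrib, ← Finset.mul_sum, controlError]
            simp only [Finset.sum_const, Finset.card_univ, Fintype.card_fin, nsmul_eq_mul]
            field_simp
            ring
    have e3 := sum_windowWeight_smul (P := P) (I := I) (q := q) (r₀ := r₀)
        (v := fun j i k => ‖windowIter η I g q S r₀ j i k - x‖ ^ 2)
    simp only [smul_eq_mul] at e3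
    have hNn : 0 ≤ windowNoiseSq η P I g h q S r₀ :=
      Finset.sum_nonneg fun p hp => mul_nonneg (windowWeight_nonneg hq hp) (sq_nonneg _)
    have hCe : 0 ≤ controlError h S := (sq_nonneg _).trans hc
    rw [windowDrift, e3]
    calc _ ≤ 1 / ((P : ℝ) * I) * (18 * η ^ 2 * P ^ 2 * I * (2 * I * (P * I) *
          (windowNoiseSq η P I g h q S r₀ +
            (6 * controlError h S + 3 * ‖meanGrad h x‖ ^ 2)))) := by
          gcongr
          refine hdr.trans ?_
          gcongr
          refine hV'.trans ?_
          gcongr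
      _ = 36 * (η * P * I) ^ 2 * (windowNoiseSq η P I g h q S r₀ +
            (6 * controlError h S + 3 * ‖meanGrad h x‖ ^ 2)) := by field_simp; ring
      -- `216 = 36 * 6`, with `36 = 18 * 2` from the drift estimate and from squaring noise plus
      -- bias.
      _ ≤ 36 * (η * P * I) ^ 2 * (6 * (windowNoiseSq η P I g h q S r₀ +
            controlError h S + ‖meanGrad h x‖ ^ 2)) := by
          gcongr
          linarith [sq_nonneg ‖meanGrad h x‖]
      _ = _ := by ring
  · intro j _ i k _
    change ‖windowGrad η I g q S r₀ j i k - S.control i + S.avgControl‖ ≤ ‖n j i k‖ +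
      L * ‖windowIter η I g q S r₀ j i k - x‖ + β i
    have h1 : windowGrad η I g q S r₀ j i k - S.control i + S.avgControl =
        n j i k + (h i (windowIter η I g q S r₀ j i k) - h i x) +
          ((h i x - S.control i) + (S.avgControl - meanGrad h x) + meanGrad h x) := by
      simp only [hn, windowNoise]
      abel
    rw [h1]
    refine norm_add₃_le.trans ?_
    gcongr
    · exact hL _ _ _
    · exact norm_add₃_le

/-- The new control variate is a convex combination of the client's stochastic gradients in the
window, with weights `N q / (P I)`. Each differs from the target by noise, drift and the
displacement of the server, and averaging over the clients cancels `N`. The old control error enters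
only through the drift. -/
theorem controlError_windowStep_le (hP : 0 < P) (hI : 0 < I) (hN : 0 < N)
    (hL : ∀ i x y, ‖h i x - h i y‖ ≤ L * ‖x - y‖) (hq : RegularWindow P ρ q r₀) :
    controlError h (windowStep η γ P I g q r₀ S) ≤
      3 * (windowNoiseSq η P I g h q S r₀ + L ^ 2 * windowDrift η P I g q S r₀ +
        L ^ 2 * ‖(windowStep η γ P I g q r₀ S).model - S.model‖ ^ 2) := by
  have hP' : (0 : ℝ) < P := by positivity
  have hI' : (0 : ℝ) < I := by positivity
  have hN' : (0 : ℝ) < N := by positivity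
  set x := S.model
  set x' := (windowStep η γ P I g q r₀ S).model
  set E : ℕ → Fin N → ℕ → ℝ := fun j i k => 3 * (‖windowNoise η I g h q S r₀ j i k‖ ^ 2 +
    L ^ 2 * ‖windowIter η I g q S r₀ j i k - x‖ ^ 2 + L ^ 2 * ‖x' - x‖ ^ 2) with hE
  have hi : ∀ i, ‖(windowStep η γ P I g q r₀ S).control i - h i x'‖ ^ 2 ≤
      N * (1 / ((P : ℝ) * I) * ∑ j ∈ range P, q (r₀ + j) i * ∑ k ∈ range I, E j i k) := by
    intro i
    have hw : ∑ p ∈ range P ×ˢ range I, (N : ℝ) / (P * I) * q (r₀ + p.1) i = 1 := by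
      rw [Finset.sum_product, ← Finset.sum_comm]
      simp only [← Finset.mul_sum, sum_weights_of_qBar hP (hq.qBar_eq i), Finset.sum_const,
        Finset.card_range, nsmul_eq_mul]
      field_simp
    have h1 : (windowStep η γ P I g q r₀ S).control i - h i x' =
        ∑ p ∈ range P ×ˢ range I, ((N : ℝ) / (P * I) * q (r₀ + p.1) i) •
          (windowGrad η I g q S r₀ p.1 i p.2 - h i x') := by
      simp_rw [smul_sub]
      rw [Finset.sum_sub_distrib, ← Finset.sum_smul, hw, one_smul,
        windowStep_control hN (hq.qBar_eq i), Finset.sum_product]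
      congr 1
      simp_rw [Finset.smul_sum, smul_smul]
    rw [h1]
    refine (norm_sum_smul_sq_le _ fun p hp => mul_nonneg (by positivity)
      (hq.nonneg _ (Finset.mem_range.1 (Finset.mem_product.1 hp).1) i)).trans ?_
    rw [hw, one_mul, Finset.sum_product]
    simp only [Finset.mul_sum]
    refine Finset.sum_le_sum fun j hj => Finset.sum_le_sum fun k hk => ?_
    have hq0 := hq.nonneg j (Finset.mem_range.1 hj) i
    calc _ ≤ (N : ℝ) / (P * I) * q (r₀ + j) i * E j i k := by
          gcongr
          have h2 : windowGrad η I g q S r₀ j i k - h i x' = windowNoise η I g h q S r₀ j i k +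
              (h i (windowIter η I g q S r₀ j i k) - h i x) + (h i x - h i x') := by
            simp only [windowNoise]
            abel
          rw [h2]
          refine (norm_add_three_sq_le _ _ _).trans ?_
          simp only [hE, ← mul_pow]
          gcongr
          · exact hL _ _ _
          · rw [norm_sub_rev x']; exact hL _ _ _
      _ = _ := by ring
  calc controlError h (windowStep η γ P I g q r₀ S)
      ≤ 1 / (N : ℝ) * ∑ i, N * (1 / ((P : ℝ) * I) * ∑ j ∈ range P, q (r₀ + j) i *
          ∑ k ∈ range I, E j i k) := by
        unfold controlError
        gcongr with i
        exact hi i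
    _ = ∑ p ∈ windowIdx N P I, windowWeight P I q r₀ p * E p.1 p.2.1 p.2.2 := by
        have e := sum_windowWeight_smul (P := P) (I := I) (q := q) (r₀ := r₀) (v := E)
        simp only [smul_eq_mul] at e
        rw [e, Finset.sum_comm, ← Finset.mul_sum, ← Finset.mul_sum, ← mul_assoc,
          one_div_mul_cancel hN'.ne', one_mul]
    _ = 3 * (windowNoiseSq η P I g h q S r₀ + L ^ 2 * windowDrift η P I g q S r₀ +
          L ^ 2 * ‖x' - x‖ ^ 2 * ∑ p ∈ windowIdx N P I, windowWeight P I q r₀ p) := by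
        rw [windowNoiseSq, windowDrift, Finset.mul_sum, Finset.mul_sum, ← Finset.sum_add_distrib,
          ← Finset.sum_add_distrib, Finset.mul_sum]
        refine Finset.sum_congr rfl fun p _ => ?_
        simp only [hE]
        ring
    _ = _ := by rw [sum_windowWeight hP hI hN hq, mul_one]

theorem norm_windowGradMean_sq_le (hP : 0 < P) (hI : 0 < I) (hN : 0 < N)
    (hL : ∀ i x y, ‖h i x - h i y‖ ≤ L * ‖x - y‖) (hq : RegularWindow P ρ q r₀) :
    ‖windowGradMean η P I g q S r₀‖ ^ 2 ≤ 3 * (‖meanGrad h S.model‖ ^ 2 +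
      L ^ 2 * windowDrift η P I g q S r₀ + ‖windowNoiseMean η P I g h q S r₀‖ ^ 2) := by
  have h1 := norm_add_three_sq_le (meanGrad h S.model)
    (windowGradMean η P I g q S r₀ - meanGrad h S.model - windowNoiseMean η P I g h q S r₀)
    (windowNoiseMean η P I g h q S r₀)
  rw [show meanGrad h S.model + (windowGradMean η P I g q S r₀ - meanGrad h S.model -
    windowNoiseMean η P I g h q S r₀) + windowNoiseMean η P I g h q S r₀ =
    windowGradMean η P I g q S r₀ by abel] at h1
  linarith [norm_windowGradMean_sub_le (η := η) (g := g) (S := S) hP hI hN hL hq]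

/-- Descent inequality with the mean gradient written as `a + e + n`, where `a = ∇f`, `n` is the
averaged noise and `e` the drift error. Young's inequality `|⟪a, e⟫| ≤ ‖a‖² / 4 + ‖e‖²` gives the
`3/4`; the noise term is kept because its mean vanishes. -/
theorem objective_windowStep_le (hP : 0 < P) (hI : 0 < I) (hN : 0 < N)
    (hL : ∀ i x y, ‖h i x - h i y‖ ≤ L * ‖x - y‖) (hq : RegularWindow P ρ q r₀)
    {f : Vec d → ℝ} (hf : ∀ x y, f y ≤ f x + ⟪meanGrad h x, y - x⟫_ℝ + L * ‖y - x‖ ^ 2)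
    {γ' : ℝ} (hγ' : γ' = γ * η * P * I) (hγ0 : 0 ≤ γ') :
    f (windowStep η γ P I g q r₀ S).model ≤ f S.model -
      γ' * (3 / 4 * ‖meanGrad h S.model‖ ^ 2 - L ^ 2 * windowDrift η P I g q S r₀ +
        ⟪meanGrad h S.model, windowNoiseMean η P I g h q S r₀⟫_ℝ) +
      L * γ' ^ 2 * ‖windowGradMean η P I g q S r₀‖ ^ 2 := by
  have h1 := hf S.model (windowStep η γ P I g q r₀ S).model
  have h2 : (windowStep η γ P I g q r₀ S).model - S.model =
      -(γ' • windowGradMean η P I g q S r₀) := by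
    rw [windowStep_model_eq hP hI hN hq, hγ']
    abel
  rw [h2, norm_neg, norm_smul, mul_pow, Real.norm_eq_abs, sq_abs, inner_neg_right,
    real_inner_smul_right] at h1
  set a := meanGrad h S.model
  set n := windowNoiseMean η P I g h q S r₀
  set e := windowGradMean η P I g q S r₀ - a - n with he
  have h3 : ‖e‖ ^ 2 ≤ L ^ 2 * windowDrift η P I g q S r₀ :=
    norm_windowGradMean_sub_le hP hI hN hL hq
  have h4 : ⟪a, windowGradMean η P I g q S r₀⟫_ℝ = ‖a‖ ^ 2 + ⟪a, e⟫_ℝ + ⟪a, n⟫_ℝ := by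
    rw [← real_inner_self_eq_norm_sq, ← inner_add_right, ← inner_add_right, he]
    congr 1
    abel
  have h5 : 3 / 4 * ‖a‖ ^ 2 - L ^ 2 * windowDrift η P I g q S r₀ + ⟪a, n⟫_ℝ ≤
      ⟪a, windowGradMean η P I g q S r₀⟫_ℝ := by
    have h6 := abs_le.1 (abs_real_inner_le_norm a e)
    nlinarith [sq_nonneg (‖a‖ / 2 - ‖e‖)]
  have h7 := mul_le_mul_of_nonneg_left h5 hγ0
  linarith

end Pathwise

/-! ### Expected progress for fixed weights -/

section Expectation

set_option linter.unusedSectionVars false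

variable {Z Ξ : Type*} [MeasurableSpace Z] [MeasurableSpace Ξ] {N d : ℕ} {π : Measure Z}
  [IsProbabilityMeasure π] {D : Fin N → Measure Ξ} [∀ i, IsProbabilityMeasure (D i)]
  {P R I r₀ : ℕ} {ξ : Z → ℕ → ℕ → Fin N → Ξ} {τ : ℕ → ℕ → Fin N → Z × Ξ → Z}
  {G : Fin N → Ξ → Vec d → Vec d} {h : Fin N → Vec d → Vec d} {L σ ρ η γ : ℝ}
  {q : ℕ → Fin N → ℝ} {T : Z → ServerState N d}

theorem mem_windowIdx {p : ℕ × Fin N × ℕ} : p ∈ windowIdx N P I ↔ p.1 < P ∧ p.2.2 < I := by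
  simp [windowIdx]

theorem memLp_meanGrad (hG : GradOracle G h D L σ) (hT : AdaptedState π R I τ r₀ T) :
    MemLp (fun z => meanGrad h (T z).model) 2 π :=
  memLp_fun_const_smul (f := fun z => ∑ i, h i (T z).model)
    (memLp_finsetSum _ fun i _ => hT.memLp_model.comp_of_norm_sub_le (hG.lipschitz i))
    (1 / (N : ℝ))

theorem integrable_controlError (hG : GradOracle G h D L σ) (hT : AdaptedState π R I τ r₀ T) :
    Integrable (fun z => controlError h (T z)) π :=
  (integrable_finsetSum _ fun i _ => ((hT.memLp_control i).sub
    (hT.memLp_model.comp_of_norm_sub_le (hG.lipschitz i))).integrable_norm_sq).const_mul _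

theorem integrable_windowDrift (hG : GradOracle G h D L σ) (hξ : Resampling π D R I ξ τ)
    (hT : AdaptedState π R I τ r₀ T) (hR : r₀ + P ≤ R) :
    Integrable (fun z => windowDrift η P I (sampleGrad G (ξ z)) q (T z) r₀) π := by
  refine integrable_finsetSum _ fun p hp => Integrable.const_mul ?_ _
  obtain ⟨hj, hk⟩ := mem_windowIdx.1 hp
  exact ((memLp_windowIter hG hξ hT (by lia) p.2.1 hk.le).sub hT.memLp_model).integrable_norm_sq

theorem integrable_windowNoiseSq (hG : GradOracle G h D L σ) (hξ : Resampling π D R I ξ τ)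
    (hT : AdaptedState π R I τ r₀ T) (hR : r₀ + P ≤ R) :
    Integrable (fun z => windowNoiseSq η P I (sampleGrad G (ξ z)) h q (T z) r₀) π := by
  refine integrable_finsetSum _ fun p hp => Integrable.const_mul ?_ _
  obtain ⟨hj, hk⟩ := mem_windowIdx.1 hp
  exact (memLp_windowNoise hG hξ hT (by lia) hk p.2.1).integrable_norm_sq

theorem integral_windowNoiseSq_le (hG : GradOracle G h D L σ) (hξ : Resampling π D R I ξ τ)
    (hT : AdaptedState π R I τ r₀ T) (hR : r₀ + P ≤ R) (hP : 0 < P) (hI : 0 < I) (hN : 0 < N)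
    (hq : RegularWindow P ρ q r₀) :
    ∫ z, windowNoiseSq η P I (sampleGrad G (ξ z)) h q (T z) r₀ ∂π ≤ σ ^ 2 := by
  unfold windowNoiseSq
  rw [integral_finsetSum _ fun p hp => (memLp_windowNoise hG hξ hT
    (by have := (mem_windowIdx.1 hp).1; lia) (mem_windowIdx.1 hp).2 p.2.1).integrable_norm_sq.const_mul _]
  calc _ ≤ ∑ p ∈ windowIdx N P I, windowWeight P I q r₀ p * σ ^ 2 := by
        refine Finset.sum_le_sum fun p hp => ?_
        obtain ⟨hj, hk⟩ := mem_windowIdx.1 hp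
        rw [integral_const_mul]
        exact mul_le_mul_of_nonneg_left
          (integral_windowNoise_sq_le hG hξ hT (by lia) hk _) (windowWeight_nonneg hq hp)
    _ = σ ^ 2 := by rw [← Finset.sum_mul, sum_windowWeight hP hI hN hq, one_mul]

theorem memLp_windowNoiseMean (hG : GradOracle G h D L σ) (hξ : Resampling π D R I ξ τ)
    (hT : AdaptedState π R I τ r₀ T) (hR : r₀ + P ≤ R) :
    MemLp (fun z => windowNoiseMean η P I (sampleGrad G (ξ z)) h q (T z) r₀) 2 π :=
  memLp_fun_sum_smul _ (windowWeight P I q r₀) fun p hp => memLp_windowNoise hG hξ hT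
    (by have := (mem_windowIdx.1 hp).1; lia) (mem_windowIdx.1 hp).2 p.2.1

theorem memLp_windowGradMean (hG : GradOracle G h D L σ) (hξ : Resampling π D R I ξ τ)
    (hT : AdaptedState π R I τ r₀ T) (hR : r₀ + P ≤ R) :
    MemLp (fun z => windowGradMean η P I (sampleGrad G (ξ z)) q (T z) r₀) 2 π :=
  memLp_fun_sum_smul _ (windowWeight P I q r₀) fun p hp => memLp_windowGrad hG hξ hT
    (by have := (mem_windowIdx.1 hp).1; lia) p.2.1 (mem_windowIdx.1 hp).2

theorem integral_windowNoiseMean_sq_le (hG : GradOracle G h D L σ) (hξ : Resampling π D R I ξ τ)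
    (hT : AdaptedState π R I τ r₀ T) (hR : r₀ + P ≤ R) (hP : 0 < P) (hI : 0 < I)
    (hq : RegularWindow P ρ q r₀) :
    ∫ z, ‖windowNoiseMean η P I (sampleGrad G (ξ z)) h q (T z) r₀‖ ^ 2 ∂π ≤
      ρ ^ 2 * σ ^ 2 / (P * I) := by
  unfold windowNoiseMean
  have hP' : (0 : ℝ) < P := by positivity
  refine (integral_norm_sq_sum_smul_le (windowIdx N P I) (c := windowWeight P I q r₀)
    (n := fun p z => windowNoise η I (sampleGrad G (ξ z)) h q (T z) r₀ p.1 p.2.1 p.2.2)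
    (b := σ ^ 2) ?_ ?_ ?_).trans ?_
  · intro p hp
    obtain ⟨hj, hk⟩ := mem_windowIdx.1 hp
    exact memLp_windowNoise hG hξ hT (by lia) hk _
  · intro p hp p' hp' hne
    obtain ⟨hj, hk⟩ := mem_windowIdx.1 hp
    obtain ⟨hj', hk'⟩ := mem_windowIdx.1 hp'
    exact integral_inner_windowNoise_windowNoise hG hξ hT (by lia) hk (by lia) hk' hne
  · intro p hp
    obtain ⟨hj, hk⟩ := mem_windowIdx.1 hp
    exact integral_windowNoise_sq_le hG hξ hT (by lia) hk _
  · calc _ ≤ σ ^ 2 * (ρ ^ 2 / (P * I)) := by gcongr; exact sum_windowWeight_sq_le hP hI hq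
      _ = _ := by ring

/-- The gradient at the start of the window is unaffected by resampling inside it. -/
theorem integral_inner_windowNoiseMean (hG : GradOracle G h D L σ) (hξ : Resampling π D R I ξ τ)
    (hT : AdaptedState π R I τ r₀ T) (hR : r₀ + P ≤ R) :
    ∫ z, ⟪meanGrad h (T z).model,
      windowNoiseMean η P I (sampleGrad G (ξ z)) h q (T z) r₀⟫_ℝ ∂π = 0 := by
  unfold windowNoiseMean
  simp_rw [inner_sum, real_inner_smul_right]
  rw [integral_finsetSum _ fun p hp => ((memLp_meanGrad hG hT).integrable_inner_two
    (memLp_windowNoise hG hξ hT (by have := (mem_windowIdx.1 hp).1; lia)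
      (mem_windowIdx.1 hp).2 p.2.1)).const_mul _]
  refine Finset.sum_eq_zero fun p hp => ?_
  obtain ⟨hj, hk⟩ := mem_windowIdx.1 hp
  rw [integral_const_mul, integral_inner_windowNoise hG hξ hT (by lia) hk _
    (memLp_meanGrad hG hT), mul_zero]
  intro z y
  rw [hT.invariant _ (by lia) (by lia) _ hk]

theorem integral_windowDrift_le (hG : GradOracle G h D L σ) (hξ : Resampling π D R I ξ τ)
    (hT : AdaptedState π R I τ r₀ T) (hR : r₀ + P ≤ R) (hP : 0 < P) (hI : 0 < I) (hN : 0 < N)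
    (hq : RegularWindow P ρ q r₀) (hL0 : 0 ≤ L) (hη : 0 ≤ η) (hηL : 4 * η * P * I * L ≤ 1) :
    ∫ z, windowDrift η P I (sampleGrad G (ξ z)) q (T z) r₀ ∂π ≤ 216 * (η * P * I) ^ 2 *
      (σ ^ 2 + ∫ z, controlError h (T z) ∂π + ∫ z, ‖meanGrad h (T z).model‖ ^ 2 ∂π) := by
  have i1 := integrable_windowNoiseSq (η := η) (q := q) hG hξ hT hR
  have i2 := integrable_controlError hG hT
  have i3 := (memLp_meanGrad hG hT).integrable_norm_sq
  refine (integral_mono (integrable_windowDrift hG hξ hT hR) (((i1.add i2).add i3).const_mul _)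
    fun z => windowDrift_le hP hI hN hG.lipschitz hL0 hη hηL hq).trans ?_
  rw [integral_const_mul]
  have e1 := integral_add (i1.add i2) i3
  have e2 := integral_add i1 i2
  simp only [Pi.add_apply] at e1 e2 ⊢
  rw [e1, e2]
  gcongr
  exact integral_windowNoiseSq_le hG hξ hT hR hP hI hN hq

theorem integral_windowGradMean_sq_le (hG : GradOracle G h D L σ) (hξ : Resampling π D R I ξ τ)
    (hT : AdaptedState π R I τ r₀ T) (hR : r₀ + P ≤ R) (hP : 0 < P) (hI : 0 < I) (hN : 0 < N)
    (hq : RegularWindow P ρ q r₀) :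
    ∫ z, ‖windowGradMean η P I (sampleGrad G (ξ z)) q (T z) r₀‖ ^ 2 ∂π ≤
      3 * (∫ z, ‖meanGrad h (T z).model‖ ^ 2 ∂π +
        L ^ 2 * ∫ z, windowDrift η P I (sampleGrad G (ξ z)) q (T z) r₀ ∂π +
        ρ ^ 2 * σ ^ 2 / (P * I)) := by
  have i1 := (memLp_meanGrad hG hT).integrable_norm_sq
  have i2 := (integrable_windowDrift (η := η) (q := q) hG hξ hT hR).const_mul (L ^ 2)
  have i3 := (memLp_windowNoiseMean (η := η) (q := q) hG hξ hT hR).integrable_norm_sq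
  refine (integral_mono (memLp_windowGradMean hG hξ hT hR).integrable_norm_sq
    (((i1.add i2).add i3).const_mul _)
    fun z => norm_windowGradMean_sq_le hP hI hN hG.lipschitz hq).trans ?_
  rw [integral_const_mul]
  have e1 := integral_add (i1.add i2) i3
  have e2 := integral_add i1 i2
  simp only [Pi.add_apply] at e1 e2 ⊢
  rw [e1, e2, integral_const_mul]
  gcongr
  exact integral_windowNoiseMean_sq_le hG hξ hT hR hP hI hq

theorem integral_controlError_windowStep_le (hG : GradOracle G h D L σ)
    (hξ : Resampling π D R I ξ τ)
    (hT : AdaptedState π R I τ r₀ T) (hR : r₀ + P ≤ R) (hP : 0 < P) (hI : 0 < I) (hN : 0 < N)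
    (hq : RegularWindow P ρ q r₀) :
    ∫ z, controlError h (windowStep η γ P I (sampleGrad G (ξ z)) q r₀ (T z)) ∂π ≤
      3 * (σ ^ 2 + L ^ 2 * ∫ z, windowDrift η P I (sampleGrad G (ξ z)) q (T z) r₀ ∂π +
        L ^ 2 * (γ * η * P * I) ^ 2 *
          ∫ z, ‖windowGradMean η P I (sampleGrad G (ξ z)) q (T z) r₀‖ ^ 2 ∂π) := by
  have i1 := integrable_windowNoiseSq (η := η) (q := q) hG hξ hT hR
  have i2 := (integrable_windowDrift (η := η) (q := q) hG hξ hT hR).const_mul (L ^ 2)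
  have i3 := (memLp_windowGradMean (η := η) (q := q) hG hξ hT hR).integrable_norm_sq.const_mul
    (L ^ 2 * (γ * η * P * I) ^ 2)
  refine (integral_mono (integrable_controlError hG (hT.windowStep hG hξ hR))
    (((i1.add i2).add i3).const_mul 3) fun z => ?_).trans ?_
  · refine (controlError_windowStep_le hP hI hN hG.lipschitz hq).trans (le_of_eq ?_)
    rw [windowStep_model_eq hP hI hN hq, sub_sub_cancel_left, norm_neg, norm_smul, mul_pow,
      Real.norm_eq_abs, sq_abs, ← mul_assoc]
    rfl
  · rw [integral_const_mul]
    have e1 := integral_add (i1.add i2) i3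
    have e2 := integral_add i1 i2
    simp only [Pi.add_apply] at e1 e2 ⊢
    rw [e1, e2, integral_const_mul, integral_const_mul]
    gcongr
    exact integral_windowNoiseSq_le hG hξ hT hR hP hI hN hq

/-- The objective differs from an affine function by at most a quadratic one, and the model is in
`L²`. -/
theorem integrable_objective (hT : AdaptedState π R I τ r₀ T) {f : Vec d → ℝ} (hfm : Measurable f)
    (hf : ∀ x y, |f y - f x - ⟪meanGrad h x, y - x⟫_ℝ| ≤ L * ‖y - x‖ ^ 2) :
    Integrable (fun z => f (T z).model) π := by
  have h1 : Integrable (fun z => ⟪meanGrad h 0, (T z).model⟫_ℝ) π :=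
    (memLp_const (meanGrad h 0)).integrable_inner_two hT.memLp_model
  have h2 : Integrable (fun z => f (T z).model - f 0 - ⟪meanGrad h 0, (T z).model⟫_ℝ) π := by
    refine (hT.memLp_model.integrable_norm_sq.const_mul L).mono' ?_
      (Filter.Eventually.of_forall fun z => ?_)
    · exact ((hfm.comp hT.measurable_model).aestronglyMeasurable.sub
        aestronglyMeasurable_const).sub h1.aestronglyMeasurable
    · simpa using hf 0 (T z).model
  have h3 := (h2.add h1).add (integrable_const (f 0))
  refine h3.congr (Filter.Eventually.of_forall fun z => ?_)
  simp

theorem integral_objective_windowStep_le (hG : GradOracle G h D L σ) (hξ : Resampling π D R I ξ τ)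
    (hT : AdaptedState π R I τ r₀ T) (hR : r₀ + P ≤ R) (hP : 0 < P) (hI : 0 < I) (hN : 0 < N)
    (hq : RegularWindow P ρ q r₀) {f : Vec d → ℝ} (hfm : Measurable f)
    (hf : ∀ x y, |f y - f x - ⟪meanGrad h x, y - x⟫_ℝ| ≤ L * ‖y - x‖ ^ 2)
    (hγ0 : 0 ≤ γ * η * P * I) :
    ∫ z, f (windowStep η γ P I (sampleGrad G (ξ z)) q r₀ (T z)).model ∂π ≤
      ∫ z, f (T z).model ∂π -
        γ * η * P * I * (3 / 4 * ∫ z, ‖meanGrad h (T z).model‖ ^ 2 ∂π -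
          L ^ 2 * ∫ z, windowDrift η P I (sampleGrad G (ξ z)) q (T z) r₀ ∂π) +
        L * (γ * η * P * I) ^ 2 *
          ∫ z, ‖windowGradMean η P I (sampleGrad G (ξ z)) q (T z) r₀‖ ^ 2 ∂π := by
  have i0 := integrable_objective hT hfm hf
  have i1 := (memLp_meanGrad hG hT).integrable_norm_sq.const_mul (3 / 4)
  have i2 := (integrable_windowDrift (η := η) (q := q) hG hξ hT hR).const_mul (L ^ 2)
  have i3 := (memLp_meanGrad hG hT).integrable_inner_two
    (memLp_windowNoiseMean (η := η) (q := q) hG hξ hT hR)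
  have i4 := (memLp_windowGradMean (η := η) (q := q) hG hξ hT hR).integrable_norm_sq.const_mul
    (L * (γ * η * P * I) ^ 2)
  have i5 := ((i1.sub i2).add i3).const_mul (γ * η * P * I)
  refine (integral_mono (integrable_objective (hT.windowStep hG hξ hR) hfm hf)
    ((i0.sub i5).add i4) fun z => objective_windowStep_le hP hI hN hG.lipschitz hq
      (fun x y => ?_) rfl hγ0).trans (le_of_eq ?_)
  · linarith [(abs_le.1 (hf x y)).2]
  · have e1 := integral_add (i0.sub i5) i4
    have e2 := integral_sub i0 i5
    have e3 := integral_add (i1.sub i2) i3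
    have e4 := integral_sub i1 i2
    simp only [Pi.add_apply, Pi.sub_apply] at e1 e2 e3 e4 ⊢
    rw [e1, e2, integral_const_mul, e3, e4, integral_const_mul, integral_const_mul,
      integral_const_mul, integral_inner_windowNoiseMean hG hξ hT hR, add_zero]

/-- The recursions as plain real numbers: `a` is the squared gradient, `H` the control error, `Q`
the scaled drift, `B` the squared mean gradient, `s` the variance. Summed over the windows they
become linear inequalities between the totals; the small `δ` lets the drift be absorbed, so no
Lyapunov function is needed. -/
theorem sum_le_of_progress {M : ℕ} {a H Q B f : ℕ → ℝ} {γ δ s Δ ε : ℝ} (hM : 1 ≤ M) (hγ : 0 < γ)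
    (hδ0 : 0 ≤ δ) (hδ : 64 * δ ≤ 1) (hδs : 5 * δ * s ≤ ε ^ 2) (hs : 0 ≤ s)
    (ha : ∀ m, 0 ≤ a m) (hQ0 : ∀ m < M, 0 ≤ Q m) (hH0 : ∀ m, 0 ≤ H m) (hH : H 0 ≤ s)
    (hQ : ∀ m < M, Q m ≤ δ * (s + H m + a m))
    (hHs : ∀ m < M, H (m + 1) ≤ 3 * (s + Q m + B m / 576))
    (hB : ∀ m < M, B m ≤ 3 * (a m + Q m + ε ^ 2))
    (hf : ∀ m < M, f (m + 1) ≤ f m - γ * (3 / 4 * a m - Q m) + γ * B m / 24)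
    (hΔ0 : 0 ≤ Δ) (hΔ : f 0 - f M ≤ Δ) :
    ∑ m ∈ range M, a m ≤ 2 * (Δ / γ) + 3 * M * ε ^ 2 := by
  set A := ∑ m ∈ range M, a m with hA
  set QQ := ∑ m ∈ range M, Q m with hQQ
  set HH := ∑ m ∈ range M, H m with hHH
  have hM1 : (1 : ℝ) ≤ M := by exact_mod_cast hM
  have hA0 : 0 ≤ A := Finset.sum_nonneg fun m _ => ha m
  have hQQ0 : 0 ≤ QQ := Finset.sum_nonneg fun m hm => hQ0 m (Finset.mem_range.1 hm)
  have h1 : QQ ≤ δ * (M * s + HH + A) := by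
    calc QQ ≤ ∑ m ∈ range M, δ * (s + H m + a m) :=
          Finset.sum_le_sum fun m hm => hQ m (Finset.mem_range.1 hm)
      _ = _ := by
        rw [← Finset.mul_sum, Finset.sum_add_distrib, Finset.sum_add_distrib, Finset.sum_const,
          Finset.card_range, nsmul_eq_mul]
  -- Shift the index: the initial error is at most `s` and the last one is dropped. The `1/64` is `3
  -- * 3 / 576`.
  have h2 : HH ≤ s + (3 * M * s + 3 * QQ + 1 / 64 * (A + QQ + M * ε ^ 2)) := by
    have e1 := Finset.sum_range_succ H M
    have e2 := Finset.sum_range_succ' H M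
    have e3 : ∑ m ∈ range M, H (m + 1) ≤
        ∑ m ∈ range M, (3 * s + 3 * Q m + 1 / 64 * (a m + Q m + ε ^ 2)) := by
      refine Finset.sum_le_sum fun m hm => ?_
      have := hHs m (Finset.mem_range.1 hm)
      have := hB m (Finset.mem_range.1 hm)
      linarith
    simp only [Finset.sum_add_distrib, ← Finset.mul_sum] at e3
    simp only [Finset.sum_const, Finset.card_range, nsmul_eq_mul] at e3
    linarith [hH0 M]
  -- Telescoping descent; inserting the bound on `B` takes `3 / 24 = 1/8` from the coefficient `3/4`
  -- and adds `1/8` to those of `Q` and `ε²`.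
  have h3 : 5 / 8 * A ≤ Δ / γ + 9 / 8 * QQ + 1 / 8 * (M * ε ^ 2) := by
    have e1 : ∑ m ∈ range M, (5 / 8 * a m) ≤
        ∑ m ∈ range M, ((f m - f (m + 1)) / γ + 9 / 8 * Q m + 1 / 8 * ε ^ 2) := by
      refine Finset.sum_le_sum fun m hm => ?_
      have e2 := hf m (Finset.mem_range.1 hm)
      have e3 := hB m (Finset.mem_range.1 hm)
      have e4 : 3 / 4 * a m - Q m - B m / 24 ≤ (f m - f (m + 1)) / γ := by
        rw [le_div_iff₀ hγ]
        linarith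
      linarith
    rw [Finset.sum_add_distrib, Finset.sum_add_distrib, ← Finset.sum_div, ← Finset.mul_sum,
      ← Finset.mul_sum, Finset.sum_range_sub'] at e1
    simp only [Finset.sum_const, Finset.card_range, nsmul_eq_mul] at e1
    have e5 : (f 0 - f M) / γ ≤ Δ / γ := by gcongr
    linarith
  -- Substitute `h2` into `h1`: the variance part is paid by `5 δ s ≤ ε²`, the rest by `64 δ ≤ 1`.
  have h4 : QQ ≤ M * ε ^ 2 + 1 / 64 * (4 * QQ + 2 * A + M * ε ^ 2) := by
    have e1 : M * s + HH + A ≤ 5 * M * s + (4 * QQ + 2 * A + M * ε ^ 2) := by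
      have : s * 1 ≤ s * M := by gcongr
      have : 0 ≤ M * ε ^ 2 := by positivity
      linarith
    have e2 : δ * (M * s + HH + A) ≤ δ * (5 * M * s + (4 * QQ + 2 * A + M * ε ^ 2)) := by gcongr
    have e3 : M * (5 * δ * s) ≤ M * ε ^ 2 := by gcongr
    have e4 : δ * (4 * QQ + 2 * A + M * ε ^ 2) ≤ 1 / 64 * (4 * QQ + 2 * A + M * ε ^ 2) := by
      gcongr
      linarith
    linarith
  have : 0 ≤ M * ε ^ 2 := by positivity
  have : 0 ≤ Δ / γ := by positivity
  linarith

theorem sum_integral_meanGrad_sq_le (hG : GradOracle G h D L σ) (hξ : Resampling π D R I ξ τ)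
    (hT : AdaptedState π R I τ 0 T) {M : ℕ} (hM : 1 ≤ M) (hR : M * P ≤ R) (hP : 0 < P) (hI : 0 < I)
    (hN : 0 < N) (hq : ∀ m < M, RegularWindow P ρ q (m * P)) {f : Vec d → ℝ} (hfm : Measurable f)
    (hf : ∀ x y, |f y - f x - ⟪meanGrad h x, y - x⟫_ℝ| ≤ L * ‖y - x‖ ^ 2) {Δ ε : ℝ}
    {x₀ : Vec d} (hx₀ : ∀ z, (T z).model = x₀) (hΔ : ∀ x, f x₀ - f x ≤ Δ)
    (hc : ∫ z, controlError h (T z) ∂π ≤ σ ^ 2) (hL : 0 < L) (hη : 0 ≤ η)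
    (hγ : γ * η * P * I = 1 / (24 * L)) (hρ : ρ ^ 2 * σ ^ 2 / (P * I) ≤ ε ^ 2)
    (hη1 : 64 * (216 * (η * P * I * L) ^ 2) ≤ 1)
    (hη2 : 5 * (216 * (η * P * I * L) ^ 2) * σ ^ 2 ≤ ε ^ 2) :
    ∑ m ∈ range M, ∫ z, ‖meanGrad h
        (serverState η γ P I (sampleGrad G (ξ z)) q (T z) m).model‖ ^ 2 ∂π ≤
      2 * (Δ / (1 / (24 * L))) + 3 * M * ε ^ 2 := by
  set St : ℕ → Z → ServerState N d := fun m z =>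
    serverState η γ P I (sampleGrad G (ξ z)) q (T z) m with hSt
  have hA : ∀ m ≤ M, AdaptedState π R I τ (m * P) (St m) := fun m hm =>
    adaptedState_serverState hG hξ hT ((Nat.mul_le_mul_right P hm).trans hR)
  have hRm : ∀ m < M, m * P + P ≤ R := fun m hm => by
    rw [← Nat.succ_mul]; exact (Nat.mul_le_mul_right P hm).trans hR
  have hx : 0 ≤ η * P * I * L := by positivity
  have hη3 : 4 * η * P * I * L ≤ 1 := by nlinarith
  -- With the effective step `1 / (24 L)`, the displacement term has coefficient `1 / 24²` and the
  -- quadratic term of the descent inequality is `1/24` of the linear one.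
  have hL1 : L ^ 2 * (γ * η * P * I) ^ 2 = 1 / 576 := by rw [hγ]; field_simp; norm_num
  have hL2 : L * (γ * η * P * I) ^ 2 = γ * η * P * I / 24 := by rw [hγ]; field_simp
  have hγ0 : 0 < γ * η * P * I := by rw [hγ]; positivity
  have h0 : ∀ z, St 0 z = T z := fun z => rfl
  have hs : ∀ m z, St (m + 1) z =
      windowStep η γ P I (sampleGrad G (ξ z)) q (m * P) (St m z) := fun m z => rfl
  refine sum_le_of_progress (a := fun m => ∫ z, ‖meanGrad h (St m z).model‖ ^ 2 ∂π)
    (H := fun m => ∫ z, controlError h (St m z) ∂π)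
    (Q := fun m => L ^ 2 * ∫ z, windowDrift η P I (sampleGrad G (ξ z)) q (St m z) (m * P) ∂π)
    (B := fun m => ∫ z, ‖windowGradMean η P I (sampleGrad G (ξ z)) q (St m z) (m * P)‖ ^ 2 ∂π)
    (f := fun m => ∫ z, f (St m z).model ∂π) (δ := 216 * (η * P * I * L) ^ 2) (s := σ ^ 2)
    hM (by positivity) (by positivity) hη1 hη2 (sq_nonneg _)
    (fun m => integral_nonneg fun z => sq_nonneg _)
    (fun m hm => mul_nonneg (sq_nonneg _) (integral_nonneg fun z => Finset.sum_nonneg fun p hp =>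
      mul_nonneg (windowWeight_nonneg (hq m hm) hp) (sq_nonneg _)))
    (fun m => integral_nonneg fun z => mul_nonneg (by positivity)
      (Finset.sum_nonneg fun i _ => sq_nonneg _)) hc ?_ ?_ ?_ ?_ (by simpa using hΔ x₀) ?_
  · intro m hm
    have h1 := integral_windowDrift_le hG hξ (hA m hm.le) (hRm m hm) hP hI hN (hq m hm) hL.le hη hη3
    refine (mul_le_mul_of_nonneg_left h1 (sq_nonneg L)).trans (le_of_eq ?_)
    ring
  · intro m hm
    have h1 := integral_controlError_windowStep_le (η := η) (γ := γ) hG hξ (hA m hm.le) (hRm m hm)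
      hP hI hN (hq m hm)
    rw [hL1] at h1
    simp only [hs]
    linarith
  · intro m hm
    have h1 := integral_windowGradMean_sq_le (η := η) hG hξ (hA m hm.le) (hRm m hm) hP hI hN
      (hq m hm)
    linarith
  · intro m hm
    have h1 := integral_objective_windowStep_le (η := η) (γ := γ) hG hξ (hA m hm.le) (hRm m hm) hP
      hI hN (hq m hm) hfm hf hγ0.le
    rw [hL2, hγ] at h1
    simp only [hs]
    linarith
  · have h1 : f x₀ - Δ ≤ ∫ z, f (St M z).model ∂π := by
      have h2 := integral_mono (μ := π) (integrable_const (f x₀ - Δ))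
        (integrable_objective (hA M le_rfl) hfm hf)
        fun z => by have := hΔ (St M z).model; simp only; linarith
      simpa using h2
    simp only [h0, hx₀, integral_const, probReal_univ, smul_eq_mul, one_mul]
    linarith

end Expectation

/-! ### The product space of the samples -/

/-- Checked on boxes: the preimage of a box is the box with side `b` freed, times that side. -/
theorem measurePreserving_update {ι : Type*} [Fintype ι] [DecidableEq ι] {X : ι → Type*}
    [∀ i, MeasurableSpace (X i)] (μ : ∀ i, Measure (X i)) [∀ i, IsProbabilityMeasure (μ i)]
    (b : ι) : MeasurePreserving (fun p : (∀ i, X i) × X b => Function.update p.1 b p.2)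
      ((Measure.pi μ).prod (μ b)) (Measure.pi μ) := by
  refine ⟨measurable_update', (Measure.pi_eq fun s hs => ?_).symm⟩
  have hpre : (fun p : (∀ i, X i) × X b => Function.update p.1 b p.2) ⁻¹' (Set.univ.pi s) =
      (Set.univ.pi (Function.update s b Set.univ)) ×ˢ s b := by
    ext ⟨z, y⟩
    simp only [Set.mem_preimage, Set.mem_pi, Set.mem_univ, forall_true_left, Set.mem_prod]
    constructor
    · intro h
      refine ⟨fun i => ?_, by simpa using h b⟩
      rcases eq_or_ne i b with rfl | hi
      · simp
      · simpa [hi] using h i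
    · rintro ⟨h1, h2⟩ i
      rcases eq_or_ne i b with rfl | hi
      · simpa using h2
      · simpa [hi] using h1 i
  rw [Measure.map_apply measurable_update' (MeasurableSet.univ_pi hs), hpre, Measure.prod_prod,
    Measure.pi_pi, ← Finset.mul_prod_erase univ (fun i => μ i (Function.update s b Set.univ i))
      (Finset.mem_univ b), ← Finset.mul_prod_erase univ (fun i => μ i (s i)) (Finset.mem_univ b)]
  simp only [Function.update_self, measure_univ, one_mul]
  rw [mul_comm]
  congr 1
  refine Finset.prod_congr rfl fun i hi => ?_
  rw [Function.update_of_ne (Finset.ne_of_mem_erase hi)]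

section Product

variable {Ξ : Type*} {N B R I : ℕ}

/-- The index set of all samples. -/
abbrev SampleIdx (N B R I : ℕ) : Type := (Fin B × Fin N) ⊕ (Fin R × Fin I × Fin N)

/-- The client to which a sample belongs. -/
def SampleIdx.client : SampleIdx N B R I → Fin N :=
  Sum.elim Prod.snd fun s => s.2.2

/-- The samples of the rounds, as a function of all samples; `c` is returned out of range. -/
def roundSample (c : Ξ) (z : SampleIdx N B R I → Ξ) (r k : ℕ) (i : Fin N) : Ξ :=
  if h : r < R ∧ k < I then z (Sum.inr (⟨r, h.1⟩, ⟨k, h.2⟩, i)) else c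

/-- The samples for the initialization, as a function of all samples. -/
def initSample (c : Ξ) (z : SampleIdx N B R I → Ξ) (b : ℕ) (i : Fin N) : Ξ :=
  if h : b < B then z (Sum.inl (⟨b, h⟩, i)) else c

/-- Replaces one sample of the rounds. -/
def resample (r k : ℕ) (i : Fin N) (p : (SampleIdx N B R I → Ξ) × Ξ) : SampleIdx N B R I → Ξ :=
  if h : r < R ∧ k < I then Function.update p.1 (Sum.inr (⟨r, h.1⟩, ⟨k, h.2⟩, i)) p.2 else p.1

/-- Extends the weights of the rounds before `R` by zero. -/
def extendWeights (w : Fin R → Fin N → ℝ) (r : ℕ) (i : Fin N) : ℝ :=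
  if h : r < R then w ⟨r, h⟩ i else 0

theorem measurable_extendWeights (r : ℕ) (i : Fin N) :
    Measurable fun w : Fin R → Fin N → ℝ => extendWeights w r i := by
  unfold extendWeights
  by_cases h : r < R
  · simp only [dif_pos h]; fun_prop
  · simp only [dif_neg h]; fun_prop

theorem initSample_resample (c : Ξ) (r k : ℕ) (i : Fin N) (z : SampleIdx N B R I → Ξ) (y : Ξ) :
    initSample c (resample r k i (z, y)) = initSample c z := by
  funext b i'
  unfold initSample resample
  split_ifs <;> simp

variable [MeasurableSpace Ξ]

theorem measurable_roundSample (c : Ξ) (r k : ℕ) (i : Fin N) :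
    Measurable fun z : SampleIdx N B R I → Ξ => roundSample c z r k i := by
  unfold roundSample
  by_cases h : r < R ∧ k < I
  · simp only [dif_pos h]; fun_prop
  · simp only [dif_neg h]; fun_prop

theorem measurable_initSample (c : Ξ) (b : ℕ) (i : Fin N) :
    Measurable fun z : SampleIdx N B R I → Ξ => initSample c z b i := by
  unfold initSample
  by_cases h : b < B
  · simp only [dif_pos h]; fun_prop
  · simp only [dif_neg h]; fun_prop

theorem resampling_pi (D : Fin N → Measure Ξ) [∀ i, IsProbabilityMeasure (D i)] (c : Ξ) :
    Resampling (Measure.pi fun s : SampleIdx N B R I => D s.client) D R I (roundSample c)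
      resample where
  measurable := measurable_roundSample c
  measurePreserving r hr k hk i := by
    have h1 := measurePreserving_update (fun s : SampleIdx N B R I => D s.client)
      (Sum.inr (⟨r, hr⟩, ⟨k, hk⟩, i))
    have h2 : resample r k i = fun p : (SampleIdx N B R I → Ξ) × Ξ =>
        Function.update p.1 (Sum.inr (⟨r, hr⟩, ⟨k, hk⟩, i)) p.2 :=
      funext fun p => dif_pos ⟨hr, hk⟩
    rw [h2]
    exact h1
  apply_same r hr k hk i z y := by
    simp [roundSample, resample, hr, hk]
  apply_other r hr k hk i r' k' i' hne z y := by
    by_cases h : r' < R ∧ k' < I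
    · simp only [roundSample, resample, hr, hk, h, and_self, dif_pos]
      rw [Function.update_of_ne]
      simp only [ne_eq, Sum.inr.injEq, Prod.mk.injEq, Fin.mk.injEq] at hne ⊢
      exact hne
    · simp [roundSample, h]

theorem measurePreserving_initSample (D : Fin N → Measure Ξ) [∀ i, IsProbabilityMeasure (D i)]
    (c : Ξ) {b : ℕ} (hb : b < B) (i : Fin N) :
    MeasurePreserving (fun z : SampleIdx N B R I → Ξ => initSample c z b i)
      (Measure.pi fun s : SampleIdx N B R I => D s.client) (D i) := by
  simp only [initSample, hb, dif_pos]
  exact measurePreserving_eval (fun s : SampleIdx N B R I => D s.client)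
    (Sum.inl (⟨b, hb⟩, i))

end Product

/-! ### Initial control variates -/

section Init

set_option linter.unusedSectionVars false

variable {Ξ : Type*} [MeasurableSpace Ξ] {N B R I d : ℕ} {F : Fin N → Vec d → Ξ → ℝ}
  {h : Fin N → Vec d → Vec d} {D : Fin N → Measure Ξ} [∀ i, IsProbabilityMeasure (D i)] {L σ : ℝ}

theorem lintegral_init_sub_sq_le (hG : GradOracle (stochGrad F) h D L σ) (c : Ξ) (x₀ : Vec d)
    {b : ℕ} (hb : b < B) (i : Fin N) :
    ∫⁻ z, ‖stochGrad F i (initSample c z b i) x₀ - h i x₀‖ₑ ^ 2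
      ∂(Measure.pi fun s : SampleIdx N B R I => D s.client) ≤ ENNReal.ofReal (σ ^ 2) := by
  have h1 : Measurable fun y => ‖stochGrad F i y x₀ - h i x₀‖ₑ ^ 2 :=
    (((hG.measurable i).comp (measurable_const.prodMk measurable_id)).sub_const _).enorm.pow_const 2
  have h2 := (measurePreserving_initSample (R := R) (I := I) D c hb i).lintegral_comp h1
  rw [h2]
  exact hG.variance i x₀

theorem measurable_initGrad (hG : GradOracle (stochGrad F) h D L σ) (c : Ξ) (x₀ : Vec d)
    (b : ℕ) (i : Fin N) :
    Measurable fun z : SampleIdx N B R I → Ξ => stochGrad F i (initSample c z b i) x₀ :=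
  (hG.measurable i).comp (measurable_const.prodMk (measurable_initSample c b i))

theorem memLp_initGrad_sub (hG : GradOracle (stochGrad F) h D L σ) (c : Ξ) (x₀ : Vec d)
    {b : ℕ} (hb : b < B) (i : Fin N) :
    MemLp (fun z => stochGrad F i (initSample c z b i) x₀ - h i x₀) 2
      (Measure.pi fun s : SampleIdx N B R I => D s.client) :=
  (memLp_two_iff_lintegral_lt_top
    ((measurable_initGrad hG c x₀ b i).sub_const _).aestronglyMeasurable).2
    ((lintegral_init_sub_sq_le hG c x₀ hb i).trans_lt ENNReal.ofReal_lt_top)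

theorem adaptedState_initState (hG : GradOracle (stochGrad F) h D L σ) (c : Ξ) (x₀ : Vec d) :
    AdaptedState (Measure.pi fun s : SampleIdx N B R I => D s.client) R I resample 0
      (fun z => initState F x₀ B (initSample c z)) where
  measurable_model := measurable_const
  measurable_control i := Measurable.fun_const_smul
    (Finset.measurable_sum _ fun b _ => measurable_initGrad hG c x₀ b i) _
  memLp_model := memLp_const x₀
  memLp_control i := by
    refine memLp_fun_const_smul (f := fun z => ∑ b ∈ range B,
      stochGrad F i (initSample c z b i) x₀) (memLp_finsetSum _ fun b hb => ?_) (1 / (B : ℝ))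
    have h1 := (memLp_initGrad_sub (R := R) (I := I) hG c x₀ (Finset.mem_range.1 hb) i).add
      (memLp_const (h i x₀))
    simpa only [Pi.add_def, sub_add_cancel] using h1
  invariant r _ _ k _ i z y := by rw [initSample_resample]

/-- Jensen over the `B` samples suffices. The better `σ² / B` would need independence and is not
required, since each later window contributes an error of order `σ²` anyway. -/
theorem integral_controlError_initState_le (hG : GradOracle (stochGrad F) h D L σ) (c : Ξ)
    (x₀ : Vec d) (hB : 1 ≤ B) (hN : 0 < N) :
    ∫ z, controlError h (initState F x₀ B (initSample c z))
      ∂(Measure.pi fun s : SampleIdx N B R I => D s.client) ≤ σ ^ 2 := by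
  set π := Measure.pi fun s : SampleIdx N B R I => D s.client with hπ
  have hB' : (0 : ℝ) < B := by positivity
  have hN' : (0 : ℝ) < N := by positivity
  have hw : ∑ _b ∈ range B, 1 / (B : ℝ) = 1 := by simp [hB'.ne']
  have hi : ∀ i b, b ∈ range B → Integrable (fun z : SampleIdx N B R I → Ξ => 1 / (B : ℝ) *
      ‖stochGrad F i (initSample c z b i) x₀ - h i x₀‖ ^ 2) π := fun i b hb =>
    (memLp_initGrad_sub hG c x₀ (Finset.mem_range.1 hb) i).integrable_norm_sq.const_mul _
  have h1 : ∀ z : SampleIdx N B R I → Ξ, controlError h (initState F x₀ B (initSample c z)) ≤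
      1 / (N : ℝ) * ∑ i, ∑ b ∈ range B, 1 / (B : ℝ) *
        ‖stochGrad F i (initSample c z b i) x₀ - h i x₀‖ ^ 2 := by
    intro z
    unfold controlError
    gcongr with i
    have h2 : (initState F x₀ B (initSample c z)).control i -
        h i (initState F x₀ B (initSample c z)).model =
        ∑ b ∈ range B, (1 / (B : ℝ)) • (stochGrad F i (initSample c z b i) x₀ - h i x₀) := by
      simp_rw [smul_sub]
      rw [Finset.sum_sub_distrib, ← Finset.sum_smul, hw, one_smul, ← Finset.smul_sum]
      rfl
    rw [h2]
    refine (norm_sum_smul_sq_le _ fun b _ => by positivity).trans (le_of_eq ?_)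
    rw [hw, one_mul]
  refine (integral_mono (integrable_controlError hG (adaptedState_initState hG c x₀))
    ((integrable_finsetSum _ fun i _ => integrable_finsetSum _ (hi i)).const_mul _) h1).trans ?_
  rw [integral_const_mul, integral_finsetSum _ fun i _ => integrable_finsetSum _ (hi i)]
  calc _ ≤ 1 / (N : ℝ) * ∑ _i : Fin N, ∑ _b ∈ range B, 1 / (B : ℝ) * σ ^ 2 := by
        gcongr with i
        rw [integral_finsetSum _ (hi i)]
        gcongr with b hb
        rw [integral_const_mul]
        gcongr
        exact integral_norm_sq_le_of_lintegral (sq_nonneg σ)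
          ((measurable_initGrad hG c x₀ b i).sub_const _).aestronglyMeasurable
          (lintegral_init_sub_sq_le hG c x₀ (Finset.mem_range.1 hb) i)
    _ = σ ^ 2 := by
        simp only [← Finset.sum_mul, hw, one_mul, Finset.sum_const, Finset.card_univ,
          Fintype.card_fin, nsmul_eq_mul]
        field_simp

end Init

/-! ### The objective -/

section Objective

variable {Ξ : Type*} [MeasurableSpace Ξ] {N d : ℕ} {F : Fin N → Vec d → Ξ → ℝ}
  {D : Fin N → Measure Ξ} {x₀ : Vec d} {Δ L L' σ : ℝ}

/-- Enlarging the constant to `L'` makes a positive Lipschitz constant available when `L = 0`. -/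
theorem gradOracle_stochGrad [∀ i, IsProbabilityMeasure (D i)]
    (hF : ObjectiveAssumption F D x₀ Δ L σ) (hL0 : 0 ≤ L) (hL : L ≤ L') :
    GradOracle (stochGrad F) (fun i => gradient (localObj F D i)) D L' σ where
  measurable i := measurable_stochGrad (hF.measurable i) (hF.differentiable i)
  integral_eq i x := integral_gradient_eq hL0 (hF.measurable i) (hF.differentiable i)
    (hF.integrable i) (fun _ => rfl) (hF.smooth_differentiable i) (hF.smooth i) (hF.variance i)
    (measurable_stochGrad (hF.measurable i) (hF.differentiable i)) x
  variance := hF.variance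
  lipschitz i x y := (hF.smooth i x y).trans (by gcongr)

theorem hasGradientAt_globalObj (hF : ObjectiveAssumption F D x₀ Δ L σ) (x : Vec d) :
    HasGradientAt (globalObj F D) (meanGrad (fun i => gradient (localObj F D i)) x) x := by
  have h1 := (HasFDerivAt.fun_sum (u := univ) fun i _ =>
    ((hF.smooth_differentiable i) x).hasGradientAt.hasFDerivAt).const_mul (1 / (N : ℝ))
  rw [hasGradientAt_iff_hasFDerivAt]
  refine h1.congr_fderiv ?_
  simp [meanGrad]

theorem gradient_globalObj (hF : ObjectiveAssumption F D x₀ Δ L σ) :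
    gradient (globalObj F D) = meanGrad (fun i => gradient (localObj F D i)) :=
  gradient_eq (hasGradientAt_globalObj hF)

theorem norm_meanGrad_sub_le {h : Fin N → Vec d → Vec d} (hL0 : 0 ≤ L)
    (hL : ∀ i x y, ‖h i x - h i y‖ ≤ L * ‖x - y‖) (x y : Vec d) :
    ‖meanGrad h x - meanGrad h y‖ ≤ L * ‖x - y‖ := by
  rw [meanGrad, meanGrad, ← smul_sub, ← Finset.sum_sub_distrib, norm_smul,
    Real.norm_of_nonneg (by positivity)]
  calc 1 / (N : ℝ) * ‖∑ i, (h i x - h i y)‖ ≤ 1 / (N : ℝ) * ∑ _i : Fin N, L * ‖x - y‖ := by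
        gcongr
        exact (norm_sum_le _ _).trans (Finset.sum_le_sum fun i _ => hL i x y)
    _ = (1 / (N : ℝ) * N) * (L * ‖x - y‖) := by simp; ring
    _ ≤ 1 * (L * ‖x - y‖) := by
        gcongr
        rcases eq_or_ne (N : ℝ) 0 with h0 | h0
        · simp [h0]
        · rw [one_div_mul_cancel h0]
    _ = _ := one_mul _

theorem abs_globalObj_sub_le (hF : ObjectiveAssumption F D x₀ Δ L σ) (hL0 : 0 ≤ L) (hL : L ≤ L')
    (x y : Vec d) :
    |globalObj F D y - globalObj F D x -
      ⟪meanGrad (fun i => gradient (localObj F D i)) x, y - x⟫_ℝ| ≤ L' * ‖y - x‖ ^ 2 := by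
  have h1 := abs_sub_sub_inner_gradient_le (f := globalObj F D) (L := L)
    (fun x => (hasGradientAt_globalObj hF x).differentiableAt) (by
      rw [gradient_globalObj hF]; exact norm_meanGrad_sub_le hL0 hF.smooth) hL0 x y
  rw [gradient_globalObj hF] at h1
  exact h1.trans (by gcongr)

theorem measurable_globalObj (hF : ObjectiveAssumption F D x₀ Δ L σ) :
    Measurable (globalObj F D) :=
  Continuous.measurable (Differentiable.continuous (𝕜 := ℝ)
    fun x => (hasGradientAt_globalObj hF x).differentiableAt)

end Objective

/-! ### Random weights -/

theorem uniformOn_Iio_eq (M : ℕ) :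
    uniformOn (Set.Iio M) = (M : ℝ≥0∞)⁻¹ • ∑ m ∈ range M, Measure.dirac m := by
  have h : ∀ M : ℕ, (Measure.count : Measure ℕ).restrict (Set.Iio M) =
      ∑ m ∈ range M, Measure.dirac m := by
    intro M
    induction M with
    | zero => simp
    | succ M ih =>
      have h1 : Set.Iio (M + 1) = Set.Iio M ∪ {M} := by
        ext m
        simp only [Set.mem_Iio, Set.mem_union, Set.mem_singleton_iff]
        lia
      rw [h1, Measure.restrict_union (by simp) (MeasurableSet.singleton M), ih,
        Finset.sum_range_succ, Measure.restrict_singleton]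
      simp
  have h2 : Measure.count (Set.Iio M) = (M : ℝ≥0∞) := by
    rw [Measure.count_apply measurableSet_Iio]
    simp [Set.encard_eq_coe_toFinset_card]
  rw [uniformOn, ProbabilityTheory.cond, h, h2]

/-- Turns the expectation over the random output index into the average over the windows. -/
theorem prod_uniformOn_Iio_eq {Ω : Type*} [MeasurableSpace Ω] (μ : Measure Ω)
    [IsProbabilityMeasure μ] (M : ℕ) :
    μ.prod (uniformOn (Set.Iio M)) =
      (M : ℝ≥0∞)⁻¹ • ∑ m ∈ range M, μ.map fun ω => (ω, m) := by
  have h : ∀ M : ℕ, μ.prod (∑ m ∈ range M, Measure.dirac m) =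
      ∑ m ∈ range M, μ.map fun ω => (ω, m) := by
    intro M
    induction M with
    | zero => simp
    | succ M ih =>
      have : SFinite (∑ m ∈ range M, Measure.dirac m : Measure ℕ) := inferInstance
      rw [Finset.sum_range_succ, Finset.sum_range_succ, Measure.prod_add, ih, Measure.prod_dirac]
  rw [uniformOn_Iio_eq, Measure.prod_smul_right, h]

theorem outputBound_of_sum_le {Ω Ξ : Type*} [MeasurableSpace Ω] [MeasurableSpace Ξ] {μ : Measure Ω}
    [IsProbabilityMeasure μ] {N d : ℕ} {F : Fin N → Vec d → Ξ → ℝ} {D : Fin N → Measure Ξ}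
    {x₀ : Vec d} {η γ : ℝ} {P R I B : ℕ} {q : Ω → ℕ → Fin N → ℝ} {ξ₀ : Ω → ℕ → Fin N → Ξ}
    {ξ : Ω → ℕ → ℕ → Fin N → Ξ} {b : ℝ} (hM : 1 ≤ R / P)
    (hi : ∀ m < R / P, Integrable (fun ω => ‖gradient (globalObj F D)
      (ampScaffold F x₀ η γ P I B q ξ₀ ξ m ω)‖ ^ 2) μ)
    (hb : ∑ m ∈ range (R / P), ∫ ω, ‖gradient (globalObj F D)
      (ampScaffold F x₀ η γ P I B q ξ₀ ξ m ω)‖ ^ 2 ∂μ ≤ (R / P : ℕ) * b) :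
    OutputBound μ F D x₀ η γ P R I B q ξ₀ ξ b := by
  have hM' : (0 : ℝ) < (R / P : ℕ) := by exact_mod_cast hM
  have hie : ∀ m ∈ range (R / P), Integrable (fun p : Ω × ℕ => ‖gradient (globalObj F D)
      (ampScaffold F x₀ η γ P I B q ξ₀ ξ p.2 p.1)‖ ^ 2) (μ.map fun ω => (ω, m)) := fun m hm =>
    (measurableEmbedding_prod_mk_right m).integrable_map_iff.2 (hi m (Finset.mem_range.1 hm))
  unfold OutputBound
  rw [prod_uniformOn_Iio_eq μ]
  constructor
  · refine Integrable.smul_measure (integrable_finsetSum_measure.2 hie) ?_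
    rw [ENNReal.inv_ne_top]
    exact_mod_cast (by lia : R / P ≠ 0)
  · rw [integral_smul_measure, integral_finsetSum_measure hie]
    simp only [(measurableEmbedding_prod_mk_right _).integral_map]
    rw [ENNReal.toReal_inv, ENNReal.toReal_natCast, smul_eq_mul, inv_mul_le_iff₀ hM']
    exact hb

/-! ### From random weights to fixed weights -/

section Reduction

set_option linter.unusedSectionVars false

variable {Ω Ξ : Type*} [MeasurableSpace Ω] [MeasurableSpace Ξ] {μ : Measure Ω}
  [IsProbabilityMeasure μ] {N d : ℕ} {F : Fin N → Vec d → Ξ → ℝ} {D : Fin N → Measure Ξ}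
  {x₀ : Vec d} {η γ ρ : ℝ} {P R I B : ℕ} {q : Ω → ℕ → Fin N → ℝ} {ξ₀ : Ω → ℕ → Fin N → Ξ}
  {ξ : Ω → ℕ → ℕ → Fin N → Ξ}

/-- The model at round `mP` as a function of the weights and the samples. -/
noncomputable def modelOf (F : Fin N → Vec d → Ξ → ℝ) (x₀ : Vec d) (η γ : ℝ) (P : ℕ) (c : Ξ) (m : ℕ)
    (p : (Fin R → Fin N → ℝ) × (SampleIdx N B R I → Ξ)) : Vec d :=
  (serverState η γ P I (sampleGrad (stochGrad F) (roundSample c p.2)) (extendWeights p.1)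
    (initState F x₀ B (initSample c p.2)) m).model

theorem ampScaffold_eq_modelOf (c : Ξ) {m : ℕ} (hm : m * P ≤ R) (ω : Ω) :
    ampScaffold F x₀ η γ P I B q ξ₀ ξ m ω = modelOf (R := R) F x₀ η γ P c m
      (fun r i => q ω r i, fun s => sample B R I ξ₀ ξ s ω) := by
  unfold ampScaffold modelOf
  congr 1
  have h0 : initState F x₀ B (ξ₀ ω) =
      initState F x₀ B (initSample c fun s => sample B R I ξ₀ ξ s ω) := by
    unfold initState
    congr 1
    funext i
    congr 1
    refine Finset.sum_congr rfl fun b hb => ?_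
    simp [initSample, Finset.mem_range.1 hb, sample]
  rw [h0]
  refine serverState_congr (fun i r hr k hk => ?_) fun r hr => ?_
  · funext x
    simp [sampleGrad, roundSample, hr.trans_le hm, hk, sample]
  · funext i
    simp [extendWeights, hr.trans_le hm]

theorem measurable_modelOf [∀ i, IsProbabilityMeasure (D i)] {h : Fin N → Vec d → Vec d} {L σ : ℝ}
    (hG : GradOracle (stochGrad F) h D L σ) (c : Ξ) (m : ℕ) :
    Measurable (modelOf (R := R) (I := I) (B := B) F x₀ η γ P c m) := by
  refine (measurable_serverState
    (g := fun p : (Fin R → Fin N → ℝ) × (SampleIdx N B R I → Ξ) =>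
      sampleGrad (stochGrad F) (roundSample c p.2)) (q := fun p => extendWeights p.1)
    (S := fun p => initState F x₀ B (initSample c p.2)) (fun i r k => ?_)
    (fun r i => (measurable_extendWeights r i).comp measurable_fst) measurable_const
    (fun i => ?_) m).1
  · exact (hG.measurable i).comp (measurable_snd.prodMk
      ((measurable_roundSample c r k i).comp (measurable_snd.comp measurable_fst)))
  · exact Measurable.fun_const_smul (Finset.measurable_sum _ fun b _ =>
      (measurable_initGrad hG c x₀ b i).comp measurable_snd) _

theorem measurable_weights (hW : WeightAssumption μ R ρ q) :
    Measurable fun ω (r : Fin R) (i : Fin N) => q ω r i :=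
  measurable_pi_lambda _ fun r => measurable_pi_lambda _ fun i => hW.measurable r r.2 i

/-- The independence assumptions in the form used: the joint law of weights and samples is a
product, with a product over the samples as second factor. -/
theorem measurePreserving_weights_samples [∀ i, IsProbabilityMeasure (D i)]
    (hW : WeightAssumption μ R ρ q) (hS : SampleAssumption μ B R I D q ξ₀ ξ) :
    MeasurePreserving
      (fun ω => ((fun (r : Fin R) (i : Fin N) => q ω r i), fun s => sample B R I ξ₀ ξ s ω)) μ
      ((μ.map fun ω (r : Fin R) (i : Fin N) => q ω r i).prod
        (Measure.pi fun s : SampleIdx N B R I => D s.client)) := by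
  have hQ := measurable_weights hW
  have hs : ∀ s, MeasurePreserving (sample B R I ξ₀ ξ s) μ (D (SampleIdx.client s)) := by
    rintro (⟨b, i⟩ | ⟨r, k, i⟩)
    · exact hS.law_init b b.2 i
    · exact hS.law r r.2 k k.2 i
  have hSm : Measurable fun ω s => sample B R I ξ₀ ξ s ω :=
    measurable_pi_lambda _ fun s => (hs s).measurable
  refine ⟨hQ.prodMk hSm, ?_⟩
  rw [(indepFun_iff_map_prod_eq_prod_map_map hQ.aemeasurable hSm.aemeasurable).1 hS.indep_weights,
    (iIndepFun_iff_map_fun_eq_pi_map fun s => (hs s).measurable.aemeasurable).1 hS.indep]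
  simp only [(hs _).map_eq]

/-- Transfers the almost sure assumptions to the law of the weights, so that almost every fixed
array of weights is admissible in all windows at once. -/
theorem ae_regularWindow (hW : WeightAssumption μ R ρ q) (hreg : IsRegularized μ P R q) :
    ∀ᵐ w ∂(μ.map fun ω (r : Fin R) (i : Fin N) => q ω r i),
      ∀ m < R / P, RegularWindow P ρ (extendWeights w) (m * P) := by
  have hQ := measurable_weights hW
  have hext : ∀ ω, ∀ r < R, ∀ i,
      extendWeights (fun (r : Fin R) (i : Fin N) => q ω r i) r i = q ω r i :=
    fun ω r hr i => by simp [extendWeights, hr]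
  have hlt : ∀ m < R / P, ∀ j < P, m * P + j < R := fun m hm j hj =>
    calc m * P + j < m * P + P := by lia
      _ = (m + 1) * P := by ring
      _ ≤ R / P * P := Nat.mul_le_mul_right P hm
      _ ≤ R := Nat.div_mul_le_self R P
  have hm := fun r i => measurable_extendWeights (R := R) (N := N) r i
  have h1 : ∀ᵐ w ∂(μ.map fun ω (r : Fin R) (i : Fin N) => q ω r i),
      ∀ r < R, ∀ i, 0 ≤ extendWeights w r i := by
    simp only [ae_all_iff]
    intro r hr i
    refine (ae_map_iff hQ.aemeasurable (measurableSet_le measurable_const (hm r i))).2 ?_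
    filter_upwards [hW.nonneg r hr i] with ω h
    rwa [hext ω r hr i]
  have h2 : ∀ᵐ w ∂(μ.map fun ω (r : Fin R) (i : Fin N) => q ω r i),
      ∀ r < R, ∑ i, extendWeights w r i = 1 := by
    simp only [ae_all_iff]
    intro r hr
    refine (ae_map_iff hQ.aemeasurable (measurableSet_eq_fun
      (Finset.measurable_sum _ fun i _ => hm r i) measurable_const)).2 ?_
    filter_upwards [hW.sum_eq_one r hr] with ω h
    simpa only [hext ω r hr] using h
  have h3 : ∀ᵐ w ∂(μ.map fun ω (r : Fin R) (i : Fin N) => q ω r i),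
      ∀ r < R, ∑ i, extendWeights w r i ^ 2 ≤ ρ ^ 2 := by
    simp only [ae_all_iff]
    intro r hr
    refine (ae_map_iff hQ.aemeasurable (measurableSet_le
      (Finset.measurable_sum _ fun i _ => (hm r i).pow_const 2) measurable_const)).2 ?_
    filter_upwards [hW.sum_sq_le r hr] with ω h
    simpa only [hext ω r hr] using h
  have h4 : ∀ᵐ w ∂(μ.map fun ω (r : Fin R) (i : Fin N) => q ω r i),
      ∀ m < R / P, ∀ i, qBar P (extendWeights w) (m * P) i = 1 / (N : ℝ) := by
    simp only [ae_all_iff]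
    intro m hmR i
    refine (ae_map_iff hQ.aemeasurable (measurableSet_eq_fun
      ((Finset.measurable_sum _ fun j _ => hm _ i).const_mul _) measurable_const)).2 ?_
    filter_upwards [hreg m hmR i] with ω h
    rw [← h]
    refine congrFun (qBar_congr fun r hr1 hr2 => ?_) i
    funext i
    refine hext ω r ?_ i
    have := hlt m hmR (r - m * P) (by lia)
    lia
  filter_upwards [h1, h2, h3, h4] with w h1 h2 h3 h4 m hmR
  exact ⟨fun j hj => h1 _ (hlt m hmR j hj), fun j hj => h2 _ (hlt m hmR j hj),
    fun j hj => h3 _ (hlt m hmR j hj), h4 m hmR⟩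

theorem pos_of_weightAssumption (hW : WeightAssumption μ R ρ q) (hR : 0 < R) : 0 < N := by
  rcases Nat.eq_zero_or_pos N with rfl | h
  · obtain ⟨ω, hω⟩ := (hW.sum_eq_one 0 hR).exists
    simp at hω
  · exact h

/-- For almost every array of weights the bound with fixed weights holds with the same constants;
Tonelli integrates it over the weights. It is applied to lower integrals first, since integrability
under the product law is only a consequence of the bound. -/
theorem outputBound_of_parameters {Δ L L' σ ε b : ℝ} (hF : ObjectiveAssumption F D x₀ Δ L σ)
    (hW : WeightAssumption μ R ρ q) (hreg : IsRegularized μ P R q)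
    (hS : SampleAssumption μ B R I D q ξ₀ ξ) (hB : 1 ≤ B) (hP : 0 < P) (hI : 0 < I)
    (hM : 1 ≤ R / P) (hL0 : 0 ≤ L) (hL : L ≤ L') (hL' : 0 < L') (hη : 0 ≤ η)
    (hγ : γ * η * P * I = 1 / (24 * L')) (hρ : ρ ^ 2 * σ ^ 2 / (P * I) ≤ ε ^ 2)
    (hη1 : 64 * (216 * (η * P * I * L') ^ 2) ≤ 1)
    (hη2 : 5 * (216 * (η * P * I * L') ^ 2) * σ ^ 2 ≤ ε ^ 2)
    (hb : 2 * (Δ / (1 / (24 * L'))) + 3 * (R / P : ℕ) * ε ^ 2 ≤ (R / P : ℕ) * b) (hb0 : 0 ≤ b) :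
    OutputBound μ F D x₀ η γ P R I B q ξ₀ ξ b := by
  have hR : R / P * P ≤ R := Nat.div_mul_le_self R P
  have hR0 : 0 < R := by
    rcases Nat.eq_zero_or_pos R with rfl | h
    · simp at hM
    · exact h
  have hN := pos_of_weightAssumption hW hR0
  have hD : ∀ i, IsProbabilityMeasure (D i) := fun i =>
    (hS.law 0 hR0 0 hI i).map_eq ▸
      Measure.isProbabilityMeasure_map (hS.law 0 hR0 0 hI i).aemeasurable
  obtain ⟨ω₀⟩ : Nonempty Ω := μ.nonempty_of_neZero
  -- An arbitrary value standing for samples out of range; a realized sample shows that one exists.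
  set c : Ξ := ξ ω₀ 0 0 ⟨0, hN⟩
  have hG := gradOracle_stochGrad hF hL0 hL
  set h := fun i => gradient (localObj F D i) with hh
  set π := Measure.pi fun s : SampleIdx N B R I => D s.client with hπ
  set ν := μ.map fun ω (r : Fin R) (i : Fin N) => q ω r i with hν
  have hmp := measurePreserving_weights_samples hW hS
  have : IsProbabilityMeasure ν := Measure.isProbabilityMeasure_map
    (measurable_weights hW).aemeasurable
  set ψ : ℕ → (Fin R → Fin N → ℝ) × (SampleIdx N B R I → Ξ) → ℝ := fun m p =>
    ‖meanGrad h (modelOf F x₀ η γ P c m p)‖ ^ 2 with hψ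
  have hmg : Measurable (meanGrad h) :=
    (Finset.measurable_sum _ fun i _ => (hG.continuous i).measurable).fun_const_smul _
  have hψm : ∀ m, Measurable (ψ m) := fun m =>
    (hmg.comp (measurable_modelOf hG c m)).norm.pow_const 2
  have hψ0 : ∀ m p, 0 ≤ ψ m p := fun m p => sq_nonneg _
  have hle : ∀ m < R / P, m * P ≤ R := fun m hm => (Nat.mul_le_mul_right P hm.le).trans hR
  have hT := adaptedState_initState (R := R) (I := I) (B := B) hG c x₀
  have hξ := resampling_pi (B := B) (R := R) (I := I) D c
  have hwi : ∀ w, ∀ m < R / P, Integrable (fun z => ψ m (w, z)) π := fun w m hm =>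
    (memLp_meanGrad hG (adaptedState_serverState (η := η) (γ := γ) (q := extendWeights w)
      hG hξ hT (hle m hm))).integrable_norm_sq
  have hw : ∀ᵐ w ∂ν, ∑ m ∈ range (R / P), ∫ z, ψ m (w, z) ∂π ≤ (R / P : ℕ) * b := by
    filter_upwards [ae_regularWindow hW hreg] with w hw
    exact (sum_integral_meanGrad_sq_le hG hξ hT hM hR hP hI hN hw (measurable_globalObj hF)
      (abs_globalObj_sub_le hF hL0 hL) (fun _ => rfl) hF.gap
      (integral_controlError_initState_le hG c x₀ hB hN) hL' hη hγ hρ hη1 hη2).trans hb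
  have hlin : ∑ m ∈ range (R / P), ∫⁻ p, ENNReal.ofReal (ψ m p) ∂(ν.prod π) ≤
      ENNReal.ofReal ((R / P : ℕ) * b) := by
    calc _ = ∑ m ∈ range (R / P), ∫⁻ w, ∫⁻ z, ENNReal.ofReal (ψ m (w, z)) ∂π ∂ν :=
          Finset.sum_congr rfl fun m _ =>
            lintegral_prod _ (hψm m).ennreal_ofReal.aemeasurable
      _ = ∫⁻ w, ∑ m ∈ range (R / P), ∫⁻ z, ENNReal.ofReal (ψ m (w, z)) ∂π ∂ν :=
          (lintegral_finsetSum _ fun m _ =>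
            (hψm m).ennreal_ofReal.lintegral_prod_right').symm
      _ ≤ ∫⁻ _w, ENNReal.ofReal ((R / P : ℕ) * b) ∂ν := by
          refine lintegral_mono_ae ?_
          filter_upwards [hw] with w hw
          calc _ = ∑ m ∈ range (R / P), ENNReal.ofReal (∫ z, ψ m (w, z) ∂π) :=
                Finset.sum_congr rfl fun m hm => (ofReal_integral_eq_lintegral_ofReal
                  (hwi w m (Finset.mem_range.1 hm)) (Filter.Eventually.of_forall
                    fun z => hψ0 m _)).symm
            _ = ENNReal.ofReal (∑ m ∈ range (R / P), ∫ z, ψ m (w, z) ∂π) :=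
                (ENNReal.ofReal_sum_of_nonneg fun m _ => integral_nonneg fun z => hψ0 m _).symm
            _ ≤ _ := ENNReal.ofReal_le_ofReal hw
      _ = _ := by simp
  have hi : ∀ m ∈ range (R / P), Integrable (ψ m) (ν.prod π) := fun m hm => by
    refine ⟨(hψm m).aestronglyMeasurable, ?_⟩
    rw [hasFiniteIntegral_iff_ofReal (Filter.Eventually.of_forall fun p => hψ0 m p)]
    exact ((Finset.single_le_sum (f := fun m => ∫⁻ p, ENNReal.ofReal (ψ m p) ∂(ν.prod π))
      (fun _ _ => zero_le) hm).trans hlin).trans_lt ENNReal.ofReal_lt_top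
  have heq : ∀ m < R / P, (fun ω => ‖gradient (globalObj F D)
      (ampScaffold F x₀ η γ P I B q ξ₀ ξ m ω)‖ ^ 2) = fun ω => ψ m
        (fun r i => q ω r i, fun s => sample B R I ξ₀ ξ s ω) := fun m hm => by
    funext ω
    rw [gradient_globalObj hF, ampScaffold_eq_modelOf c (hle m hm)]
  refine outputBound_of_sum_le hM (fun m hm => ?_) ?_
  · rw [heq m hm]
    exact hmp.integrable_comp_of_integrable (hi m (Finset.mem_range.2 hm))
  · have h1 : ∀ m ∈ range (R / P), ∫ ω, ‖gradient (globalObj F D)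
        (ampScaffold F x₀ η γ P I B q ξ₀ ξ m ω)‖ ^ 2 ∂μ = ∫ p, ψ m p ∂(ν.prod π) := by
      intro m hm
      rw [heq m (Finset.mem_range.1 hm), ← hmp.map_eq,
        integral_map hmp.aemeasurable (hψm m).aestronglyMeasurable]
    rw [Finset.sum_congr rfl h1]
    refine (ENNReal.ofReal_le_ofReal_iff (by positivity)).1 (le_trans (le_of_eq ?_) hlin)
    rw [ENNReal.ofReal_sum_of_nonneg fun m _ => integral_nonneg (hψ0 m)]
    exact Finset.sum_congr rfl fun m hm =>
      ofReal_integral_eq_lintegral_ofReal (hi m hm) (Filter.Eventually.of_forall (hψ0 m))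

end Reduction

/-! ### Regularized participation satisfies the regularity conditions -/

section Regularity

variable {Ω : Type*} [mΩ : MeasurableSpace Ω] {μ : Measure Ω} {N P R : ℕ} {ρ : ℝ}
  {q : Ω → ℕ → Fin N → ℝ}

theorem pastWeights_le (hW : WeightAssumption μ R ρ q) {m : ℕ} (hm : m < R / P) :
    pastWeights q (m * P) ≤ mΩ := by
  refine Measurable.comap_le (measurable_pi_lambda _ fun r => measurable_pi_lambda _ fun i =>
    hW.measurable r (r.2.trans_le ?_) i)
  exact (Nat.mul_le_mul_right P hm.le).trans (Nat.div_mul_le_self R P)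

theorem condExp_ae_eq_const [IsProbabilityMeasure μ] {m' : MeasurableSpace Ω}
    (hm' : m' ≤ mΩ) {f : Ω → ℝ} {c : ℝ} (hf : f =ᵐ[μ] fun _ => c) :
    μ[f | m'] =ᵐ[μ] fun _ => c := by
  have h := condExp_congr_ae (m := m') hf
  rwa [condExp_const hm'] at h

/-- The prefactors `1 / (P q̄^j)` are all `N / P`; summing over `j` first gives `∑_j q_s^j = 1`,
then `∑_s q_s^i = P / N`. -/
theorem wCoeff_eq_of_regular {w : ℕ → Fin N → ℝ} {r₀ : ℕ} (hP : 0 < P) (hN : 0 < N)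
    (hq : ∀ i, qBar P w r₀ i = 1 / (N : ℝ)) (h1 : ∀ j < P, ∑ i, w (r₀ + j) i = 1) (i : Fin N) :
    wCoeff P w r₀ i = 1 / (N : ℝ) := by
  have hN' : (0 : ℝ) < N := by positivity
  have hP' : (0 : ℝ) < P := by positivity
  have h2 : ∑ j : Fin N, ∑ s ∈ range P, w (r₀ + s) i * w (r₀ + s) j = P * (1 / N) := by
    rw [Finset.sum_comm, ← sum_weights_of_qBar hP (hq i)]
    refine Finset.sum_congr rfl fun s hs => ?_
    rw [← Finset.mul_sum, h1 s (Finset.mem_range.1 hs), mul_one]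
  simp only [wCoeff, hq, one_div_pos.2 hN', if_true]
  rw [← Finset.mul_sum, h2]
  field_simp

theorem ae_wCoeff_eq [IsProbabilityMeasure μ] (hP : 0 < P) (hW : WeightAssumption μ R ρ q)
    (hreg : IsRegularized μ P R q) {m : ℕ} (hm : m < R / P) (i : Fin N) :
    (fun ω => wCoeff P (q ω) (m * P) i) =ᵐ[μ] fun _ => 1 / (N : ℝ) := by
  have h1 : ∀ᵐ ω ∂μ, ∀ r < R, ∑ i, q ω r i = 1 := by
    simp only [ae_all_iff]
    exact hW.sum_eq_one
  have h2 : ∀ᵐ ω ∂μ, ∀ i, qBar P (q ω) (m * P) i = 1 / (N : ℝ) := ae_all_iff.2 (hreg m hm)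
  filter_upwards [h1, h2] with ω h1 h2
  refine wCoeff_eq_of_regular hP (Fin.pos i) h2 (fun j hj => h1 _ ?_) i
  calc m * P + j < m * P + P := by lia
    _ = (m + 1) * P := by ring
    _ ≤ R / P * P := Nat.mul_le_mul_right P hm
    _ ≤ R := Nat.div_mul_le_self R P

theorem unbiasedParticipation_of_regularized [IsProbabilityMeasure μ]
    (hW : WeightAssumption μ R ρ q) (hreg : IsRegularized μ P R q) :
    UnbiasedParticipation μ P R q := fun m hm i =>
  condExp_ae_eq_const (pastWeights_le hW hm) (hreg m hm i)

theorem sampledWithProb_of_regularized [IsProbabilityMeasure μ]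
    (hW : WeightAssumption μ R ρ q) (hreg : IsRegularized μ P R q) :
    SampledWithProb μ P R q 1 := by
  intro m hm i
  have h1 : Set.indicator {ω' | 0 < qBar P (q ω') (m * P) i} (fun _ => (1 : ℝ)) =ᵐ[μ]
      fun _ => 1 := by
    filter_upwards [hreg m hm i] with ω h
    have hN : (0 : ℝ) < N := by exact_mod_cast Fin.pos i
    rw [Set.indicator_of_mem]
    simp only [Set.mem_ofPred_eq, h]
    positivity
  filter_upwards [condExp_ae_eq_const (pastWeights_le hW hm) h1] with ω h
  exact h.ge

theorem wCondition_of_regularized [IsProbabilityMeasure μ] (hP : 1 ≤ P)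
    (hW : WeightAssumption μ R ρ q) (hreg : IsRegularized μ P R q) : WCondition μ P R q := by
  intro m hm i
  have h := ae_wCoeff_eq hP hW hreg hm i
  have hb : 1 / (N : ℝ) ≤ (P : ℝ) ^ 2 / N := by
    gcongr
    exact one_le_pow₀ (by exact_mod_cast hP)
  refine ⟨(integrable_const _).congr h.symm, ?_, ?_⟩
  · rw [integral_congr_ae h]
    simpa using hb
  · filter_upwards [condExp_ae_eq_const (pastWeights_le hW hm) h] with ω hω
    rw [hω]
    exact hb

/-- Each `v^i` vanishes almost surely, whatever the value of `Λ^i`. -/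
theorem vCondition_of_regularized (hreg : IsRegularized μ P R q) : VCondition μ P R ρ q := by
  intro m hm
  have h : (fun ω => ∑ i, (vCoeff P (q ω) (m * P) i) ^ 2 * lambdaCoeff P (q ω) m i) =ᵐ[μ]
      fun _ => 0 := by
    filter_upwards [ae_all_iff.2 (hreg m hm)] with ω hω
    simp [vCoeff, hω]
  refine ⟨(integrable_zero _ _ _).congr h.symm, ?_⟩
  rw [integral_congr_ae h]
  simpa using sq_nonneg ρ

end Regularity

/-! ### Parameters -/

theorem natCeil_le_two_mul {x : ℝ} (hx : 1 ≤ x) : (⌈x⌉₊ : ℝ) ≤ 2 * x := by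
  linarith [Nat.ceil_lt_add_one (zero_le_one.trans hx)]

/-- `M` and `I` are the claimed orders rounded up, which costs a factor two each. The local step is
fixed through `t = η P I L'`, and `γ` restores the effective step `1 / (24 L')` however small `t`
is. -/
theorem exists_parameters {P : ℕ} {Δ L σ ρ ε : ℝ} (hP : 1 ≤ P) (hΔ : 0 ≤ Δ) (hL : 0 ≤ L)
    (hσ : 0 ≤ σ) (hε : 0 < ε) :
    ∃ (η γ L' : ℝ) (I M : ℕ), 0 < η ∧ 0 < γ ∧ 1 ≤ I ∧ 1 ≤ M ∧
      (M : ℝ) ≤ 2 * max 1 (Δ * L / ε ^ 2) ∧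
      (I : ℝ) ≤ 2 * max 1 (ρ ^ 2 * σ ^ 2 / (P * ε ^ 2)) ∧ L ≤ L' ∧ 0 < L' ∧
      γ * η * P * I = 1 / (24 * L') ∧ ρ ^ 2 * σ ^ 2 / (P * I) ≤ ε ^ 2 ∧
      64 * (216 * (η * P * I * L') ^ 2) ≤ 1 ∧
      5 * (216 * (η * P * I * L') ^ 2) * σ ^ 2 ≤ ε ^ 2 ∧
      2 * (Δ / (1 / (24 * L'))) + 3 * M * ε ^ 2 ≤ M * (100 * ε ^ 2) := by
  have hP' : (0 : ℝ) < P := by positivity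
  -- Positive even for `L = 0`, while `Δ L'` exceeds `Δ L` by at most `ε²`, so the number of windows
  -- keeps its order.
  set L' : ℝ := L + ε ^ 2 / (Δ + 1) with hL'
  set M : ℕ := ⌈max 1 (Δ * L / ε ^ 2)⌉₊ with hM
  set I : ℕ := ⌈max 1 (ρ ^ 2 * σ ^ 2 / (P * ε ^ 2))⌉₊ with hI
  have hL'0 : 0 < L' := by positivity
  have hMle : max 1 (Δ * L / ε ^ 2) ≤ M := Nat.le_ceil _
  have hIle : max 1 (ρ ^ 2 * σ ^ 2 / (P * ε ^ 2)) ≤ I := Nat.le_ceil _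
  have hM1 : (1 : ℝ) ≤ M := (le_max_left _ _).trans hMle
  have hI1 : (1 : ℝ) ≤ I := (le_max_left _ _).trans hIle
  have hI0 : (0 : ℝ) < I := by linarith
  -- Gives both `120 t ≤ 1` and `120 t σ ≤ ε`; the number `120` is taken because `64 * 216 = 13824 ≤
  -- 120²`.
  set t : ℝ := ε / (120 * (ε + σ)) with ht
  have ht0 : 0 < t := by positivity
  have hη : t / (P * I * L') * P * I * L' = t := by field_simp
  have htε : 120 * t * (ε + σ) = ε := by rw [ht]; field_simp
  have ht1 : 120 * t ≤ 1 := by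
    by_contra! h
    nlinarith
  have ht2 : 120 * t * σ ≤ ε := by
    have : 0 ≤ 120 * t * ε := by positivity
    linarith
  refine ⟨t / (P * I * L'), 1 / (24 * t), L', I, M, by positivity, by positivity,
    by exact_mod_cast hI1, by exact_mod_cast hM1, natCeil_le_two_mul (le_max_left _ _),
    natCeil_le_two_mul (le_max_left _ _), le_add_of_nonneg_right (by positivity), hL'0, by field_simp, ?_, ?_, ?_, ?_⟩
  · have h1 : ρ ^ 2 * σ ^ 2 / (P * ε ^ 2) ≤ I := (le_max_right _ _).trans hIle
    rw [div_le_iff₀ (by positivity)] at h1 ⊢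
    linarith
  · rw [hη]
    nlinarith
  · rw [hη]
    have h1 : (120 * t * σ) ^ 2 ≤ ε ^ 2 := by gcongr
    have h2 : 0 ≤ t ^ 2 * σ ^ 2 := by positivity
    linarith
  · have h1 : Δ * L ≤ M * ε ^ 2 := by
      have := (le_max_right _ _).trans hMle
      rwa [div_le_iff₀ (by positivity)] at this
    have h2 : Δ * (ε ^ 2 / (Δ + 1)) ≤ ε ^ 2 := by
      rw [mul_div_assoc', div_le_iff₀ (by positivity)]
      linarith [sq_nonneg ε]
    have h3 : 1 * ε ^ 2 ≤ M * ε ^ 2 := by gcongr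
    -- The bound needed becomes `48 Δ L' + 3 M ε² ≤ (96 + 3) M ε²`, below `100 M ε²`.
    have h4 : Δ * L' ≤ 2 * (M * ε ^ 2) := by rw [hL', mul_add]; linarith
    have h5 : Δ / (1 / (24 * L')) = 24 * (Δ * L') := by field_simp
    rw [h5]
    linarith [show 0 ≤ M * ε ^ 2 by positivity]

end AmpScaffold

/-! ### The main theorem -/

theorem mainTheorem3 :
    (∀ {Ω : Type*} [MeasurableSpace Ω] (μ : Measure Ω) [IsProbabilityMeasure μ]
        (N P R : ℕ) (ρ : ℝ) (q : Ω → ℕ → Fin N → ℝ),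
        1 ≤ P → P ∣ R →
        AmpScaffold.WeightAssumption μ R ρ q →
        AmpScaffold.IsRegularized μ P R q →
        AmpScaffold.UnbiasedParticipation μ P R q ∧
        AmpScaffold.SampledWithProb μ P R q 1 ∧
        AmpScaffold.WCondition μ P R q ∧
        AmpScaffold.VCondition μ P R ρ q) ∧
    (∃ C : ℝ, 0 < C ∧
      ∀ (P : ℕ) (Δ L σ ρ ε : ℝ), 1 ≤ P → 0 ≤ Δ → 0 ≤ L → 0 ≤ σ → 0 ≤ ρ → 0 < ε →
        ∃ (η γ : ℝ) (I R : ℕ), 0 < η ∧ 0 < γ ∧ 1 ≤ I ∧ 1 ≤ R ∧ P ∣ R ∧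
          (R : ℝ) ≤ C * (P * max 1 (Δ * L / ε ^ 2)) ∧
          (R : ℝ) * I ≤
            C * (P * max 1 (Δ * L / ε ^ 2) * max 1 (ρ ^ 2 * σ ^ 2 / (P * ε ^ 2))) ∧
          (ε ^ 2 ≤ Δ * L → (R : ℝ) ≤ C * (Δ * L * P / ε ^ 2)) ∧
          (ε ^ 2 ≤ Δ * L → P * ε ^ 2 ≤ ρ ^ 2 * σ ^ 2 →
            (R : ℝ) * I ≤ C * (Δ * L * ρ ^ 2 * σ ^ 2 / ε ^ 4)) ∧
          ∀ {Ω Ξ : Type*} [MeasurableSpace Ω] [MeasurableSpace Ξ]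
            (μ : Measure Ω) [IsProbabilityMeasure μ] (N d B : ℕ)
            (F : Fin N → AmpScaffold.Vec d → Ξ → ℝ) (D : Fin N → Measure Ξ)
            (x₀ : AmpScaffold.Vec d) (q : Ω → ℕ → Fin N → ℝ)
            (ξ₀ : Ω → ℕ → Fin N → Ξ) (ξ : Ω → ℕ → ℕ → Fin N → Ξ),
            1 ≤ B →
            AmpScaffold.ObjectiveAssumption F D x₀ Δ L σ →
            AmpScaffold.WeightAssumption μ R ρ q →
            AmpScaffold.IsRegularized μ P R q →
            AmpScaffold.SampleAssumption μ B R I D q ξ₀ ξ →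
            AmpScaffold.OutputBound μ F D x₀ η γ P R I B q ξ₀ ξ (C * ε ^ 2)) := by
  refine ⟨fun μ _ N P R ρ q hP _ hW hreg =>
    ⟨AmpScaffold.unbiasedParticipation_of_regularized hW hreg,
      AmpScaffold.sampledWithProb_of_regularized hW hreg,
      AmpScaffold.wCondition_of_regularized hP hW hreg,
      AmpScaffold.vCondition_of_regularized hreg⟩,
    -- The value `100` is dictated by the gradient bound; the two complexity bounds hold with `2`
    -- and `4`.
    100, by norm_num, fun P Δ L σ ρ ε hP hΔ hL hσ _ hε => ?_⟩
  obtain ⟨η, γ, L', I, M, hη, hγ, hI, hM, hM2, hI2, hLL, hL', hγη, hρ, hη1, hη2, hb⟩ :=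
    AmpScaffold.exists_parameters (P := P) (ρ := ρ) hP hΔ hL hσ hε
  have hP' : (0 : ℝ) < P := by exact_mod_cast hP
  have hM0 : (0 : ℝ) ≤ M := Nat.cast_nonneg _
  set A : ℝ := max 1 (Δ * L / ε ^ 2) with hA
  set K : ℝ := max 1 (ρ ^ 2 * σ ^ 2 / (P * ε ^ 2)) with hK
  have hA1 : 1 ≤ A := le_max_left _ _
  have hK1 : 1 ≤ K := le_max_left _ _
  have hR : ((P * M : ℕ) : ℝ) ≤ 2 * (P * A) := by
    push_cast
    linarith [mul_le_mul_of_nonneg_left hM2 hP'.le]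
  have hRI : ((P * M : ℕ) : ℝ) * I ≤ 4 * (P * A * K) := by
    calc ((P * M : ℕ) : ℝ) * I ≤ 2 * (P * A) * (2 * K) := by gcongr
      _ = _ := by ring
  have hPA : 0 ≤ P * A := by positivity
  have hPAK : 0 ≤ P * A * K := by positivity
  have hA' : ε ^ 2 ≤ Δ * L → A = Δ * L / ε ^ 2 := fun h =>
    max_eq_right ((one_le_div (by positivity)).2 h)
  refine ⟨η, γ, I, P * M, hη, hγ, hI, Nat.mul_pos hP hM, Dvd.intro M rfl, by linarith, by linarith,
    fun h => ?_, fun h h' => ?_, fun μ _ N d B F D x₀ q ξ₀ ξ hB hF hW hreg hS => ?_⟩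
  · have h1 : Δ * L * P / ε ^ 2 = P * A := by rw [hA' h]; ring
    rw [h1]
    linarith
  · have h1 : Δ * L * ρ ^ 2 * σ ^ 2 / ε ^ 4 = P * A * K := by
      rw [hA' h, hK, max_eq_right ((one_le_div (by positivity)).2 h')]
      field_simp
    rw [h1]
    linarith
  · have hdiv : P * M / P = M := Nat.mul_div_cancel_left M hP
    exact AmpScaffold.outputBound_of_parameters hF hW hreg hS hB hP hI (by rw [hdiv]; exact hM) hL
      hLL hL' hη.le hγη hρ hη1 hη2 (by rw [hdiv]; exact hb) (by positivity)
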